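/- Let $B_n$ be the braid group on $n$ strands, $p_*\colon B_n\to\Sigma_n$ the underlying-permutation map, and $\circ_i$ the partial compositions of the braid operad. Let $\Omega(n)$ be the set of parenthesized words in a constant $x_0$ (used any number of times) and variables $x_1,\dots,x_n$ (each used exactly once), i.e. the free symmetric operad on a binary operation $\nu$ and a nullary operation $x_0$; for $p\in\Omega(n)$ let $\mathrm{len}(p)$ be its number of characters, $\tau(p)\in\Sigma_n$ the permutation listing its variables from left to right, and $t_p^{-1}(i)$ the position of $x_i$ among all its characters. The operad $\mathrm{PaB}$ of (weakly unital) parenthesized braids, in groupoids, has $\mathrm{Ob}\,\mathrm{PaB}(n)=\Omega(n)$ and $\mathrm{Hom}(p,q)=p_*^{-1}(\tau(q)^{-1}\tau(p))\subseteq B_n$; composition of morphisms is multiplication in $B_n$, the operadic composite of $g\colon p\to q$ and $g'\colon p'\to q'$ is $g\circ_{\tau(q)^{-1}(i)}g'$, and $\Sigma_n$ acts by renaming variables and as the identity on braids. The weak braiding operad $\mathrm{wPaB}$ has as objects of arity $n$ the pairs $(p,A)$ with $p\in\Omega(n)$ and $A\in B_{\mathrm{len}(p)}$, with $(p,A)\circ_i(q,C)=(p\circ_i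 q,\,A\circ_{t_p^{-1}(i)}C)$ and $\sigma(p,A)=(\sigma p,A)$. Writing $\pi(A)\in B_n$ for the braid obtained from $A$ by deleting the strands whose output positions are coloured by $x_0$, one has $\mathrm{Hom}((p,A),(q,C))=p_*^{-1}(\tau(q)^{-1}\tau(p))\cap\{\pi(C)\pi(A)^{-1}\}$, with composites, operadic composites and symmetric group actions on morphisms given by the same formulas as in $\mathrm{PaB}$. Forgetting the braids of the objects is a morphism of symmetric operads $f\colon\mathrm{wPaB}\to\mathrm{PaB}$. For a category $\mathcal C$ let $\mathrm{End}_{\mathcal C}(n)$ be the category of functors $\mathcal C^n\to\mathcal C$; a weak braided monoidal structure on $\mathcal C$ is a morphism of symmetric operads $\mathrm{wPaB}\to\mathrm{End}_{\mathcal C}$. **Statement.** Let $\mathcal C$ be a braided monoidal category. Then there is a morphism of symmetric operads $\varphi\colon\mathrm{PaB}\to\mathrm{End}_{\mathcal C}$ given by the braided monoidal structure: it sends a word to the corresponding iterated tensor product (with $\mathbb 1$ for each $x_0$), the trivial braids $\nu(\nu(x_1,x_2),x_3)\to\nu(x_1,\nu(x_2,x_3))$, $\nu(x_0,x_1)\to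 x_1$, $\nu(x_1,x_0)\to x_1$ to the associator and the unitors, and the generating braid $\nu(x_1,x_2)\to\nu(x_2,x_1)$ to the braiding. The composite $\varphi\circ f\colon\mathrm{wPaB}\to\mathrm{PaB}\to\mathrm{End}_{\mathcal C}$ is a weak braided monoidal structure on $\mathcal C$; in particular, every braided monoidal category is weak braided. -/

import Mathlib

open CategoryTheory

universe u v

namespace WeakBraid

universe u₁ v₁ u₂ v₂ u₃ v₃

open scoped MonoidalCategory

/-! ### Braid groups -/

/-- Artin's relations on the generators `σ₀, …, σ_{n-2}` of the braid group on `n` strands. -/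
def artinRels (n : ℕ) : Set (FreeGroup (Fin (n - 1))) :=
  {r | ∃ i j : Fin (n - 1), (i : ℕ) + 1 < j ∧
      r = FreeGroup.of i * FreeGroup.of j * (FreeGroup.of j * FreeGroup.of i)⁻¹} ∪
  {r | ∃ i j : Fin (n - 1), (i : ℕ) + 1 = j ∧
      r = FreeGroup.of i * FreeGroup.of j * FreeGroup.of i *
        (FreeGroup.of j * FreeGroup.of i * FreeGroup.of j)⁻¹}

/-- The braid group `Bₙ`, in Artin's presentation. In a product `g * h` the braid `h` comes
first; strands run from their input positions to their output positions. -/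
abbrev Braid (n : ℕ) : Type := PresentedGroup (artinRels n)

/-- The generator `σᵢ` of `Bₙ`, the strand at position `i` crossing the one at position `i + 1`
(`1` when `i + 1 ≥ n`). -/
def gen (n i : ℕ) : Braid n := if h : i < n - 1 then PresentedGroup.of ⟨i, h⟩ else 1

theorem gen_comm (n : ℕ) {i j : ℕ} (h : i + 1 < j) :
    gen n i * gen n j = gen n j * gen n i := by
  unfold gen
  split_ifs with h1 h2
  · have : PresentedGroup.mk (artinRels n) _ = 1 :=
      PresentedGroup.one_of_mem (Or.inl ⟨⟨i, h1⟩, ⟨j, h2⟩, h, rfl⟩)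
    rw [map_mul, map_inv, mul_inv_eq_one, map_mul, map_mul] at this
    exact this
  all_goals simp

theorem gen_braid (n : ℕ) {i : ℕ} (h : i + 2 < n) :
    gen n i * gen n (i + 1) * gen n i = gen n (i + 1) * gen n i * gen n (i + 1) := by
  have h1 : i < n - 1 := by omega
  have h2 : i + 1 < n - 1 := by omega
  have : PresentedGroup.mk (artinRels n) _ = 1 :=
    PresentedGroup.one_of_mem (Or.inr ⟨⟨i, h1⟩, ⟨i + 1, h2⟩, rfl, rfl⟩)
  rw [map_mul, map_inv, mul_inv_eq_one, map_mul, map_mul, map_mul, map_mul] at this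
  simp only [gen, h1, h2, dif_pos]
  exact this

/-- Homomorphisms out of `Bₙ`, given on generators. -/
def Braid.lift {n : ℕ} {G : Type*} [Group G] (f : ℕ → G)
    (hc : ∀ i j, i + 1 < j → j + 1 < n → f i * f j = f j * f i)
    (hb : ∀ i, i + 2 < n → f i * f (i + 1) * f i = f (i + 1) * f i * f (i + 1)) :
    Braid n →* G :=
  PresentedGroup.toGroup (f := fun i : Fin (n - 1) => f i) (by
    rintro r (⟨i, j, hij, rfl⟩ | ⟨i, j, hij, rfl⟩)
    · simp only [map_mul, map_inv, FreeGroup.lift_apply_of, mul_inv_eq_one]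
      exact hc _ _ hij (by omega)
    · simp only [map_mul, map_inv, FreeGroup.lift_apply_of, mul_inv_eq_one]
      rw [← hij]
      exact hb _ (by omega))

theorem Braid.lift_gen {n : ℕ} {G : Type*} [Group G] (f : ℕ → G) (hc hb) {i : ℕ}
    (h : i + 1 < n) : Braid.lift (n := n) f hc hb (gen n i) = f i := by
  have h1 : i < n - 1 := by omega
  simp only [gen, h1, dif_pos, Braid.lift, PresentedGroup.toGroup.of]

theorem Braid.induction {n : ℕ} {P : Braid n → Prop} (g : Braid n) (one : P 1)
    (of : ∀ i, i + 1 < n → P (gen n i)) (mul : ∀ a b, P a → P b → P (a * b))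
    (inv : ∀ a, P a → P a⁻¹) : P g := by
  have hg : g ∈ Subgroup.closure (Set.range (PresentedGroup.of (rels := artinRels n))) := by
    rw [PresentedGroup.closure_range_of]; trivial
  induction hg using Subgroup.closure_induction with
  | mem x hx =>
    obtain ⟨i, rfl⟩ := hx
    have := of i (by omega)
    simpa [gen] using this
  | one => exact one
  | mul x y _ _ hx hy => exact mul _ _ hx hy
  | inv x _ hx => exact inv _ hx

/-- The transposition of the positions `i` and `i + 1` (the identity when `i + 1 ≥ n`). -/
def adj (n i : ℕ) : Equiv.Perm (Fin n) :=
  if h : i + 1 < n then Equiv.swap ⟨i, by omega⟩ ⟨i + 1, h⟩ else 1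

theorem adj_val {n i : ℕ} (h : i + 1 < n) (k : Fin n) :
    (adj n i k : ℕ) = if (k : ℕ) = i then i + 1 else if (k : ℕ) = i + 1 then i else k := by
  simp only [adj, h, dif_pos, Equiv.swap_apply_def, Fin.ext_iff]
  split_ifs <;> simp_all

/-- The underlying permutation `p_* : Bₙ → Σₙ`: the strand with input position `k` has output
position `perm g k`. -/
def perm {n : ℕ} : Braid n →* Equiv.Perm (Fin n) :=
  Braid.lift (adj n)
    (by
      intro i j h1 h2; ext k
      have hi : i + 1 < n := by omega
      simp only [Equiv.Perm.mul_apply, adj_val h2, adj_val hi]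
      split_ifs <;> omega)
    (by
      intro i h; ext k
      have h1 : i + 1 < n := by omega
      have h2 : i + 1 + 1 < n := by omega
      simp only [Equiv.Perm.mul_apply, adj_val h2, adj_val h1]
      split_ifs <;> omega)

theorem perm_gen {n i : ℕ} (h : i + 1 < n) : perm (gen n i) = adj n i :=
  Braid.lift_gen _ _ _ h

/-! ### Cabling -/

/-- The positive braid in which the strand at position `o + a` moves left past the `a` strands at
positions `o, …, o + a - 1`. -/
def strandCross (N o : ℕ) : ℕ → Braid N
  | 0 => 1
  | a + 1 => strandCross N o a * gen N (o + a)

/-- The positive braid in which the block of `a` parallel strands starting at position `o` crosses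
the adjacent block of `b` parallel strands starting at position `o + a`. -/
def blockCross (N o a : ℕ) : ℕ → Braid N
  | 0 => 1
  | b + 1 => strandCross N (o + b) a * blockCross N o a b

section cross

variable {N : ℕ}

theorem strandCross_one (o : ℕ) : strandCross N o 1 = gen N o := by
  simp [strandCross]

theorem strandCross_add (o a b : ℕ) :
    strandCross N o (a + b) = strandCross N o a * strandCross N (o + a) b := by
  induction b with
  | zero => simp [strandCross]
  | succ b ih => rw [← add_assoc, strandCross, ih, strandCross, mul_assoc, add_assoc]

theorem strandCross_gen_far (o a i : ℕ) (h : i + 1 < o ∨ o + a < i) :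
    strandCross N o a * gen N i = gen N i * strandCross N o a := by
  induction a with
  | zero => simp [strandCross]
  | succ a ih =>
    have h1 : gen N (o + a) * gen N i = gen N i * gen N (o + a) := by
      rcases h with h | h
      · exact (gen_comm N (by omega)).symm
      · exact gen_comm N (by omega)
    rw [strandCross, mul_assoc, h1, ← mul_assoc, ih (by omega), mul_assoc]

theorem strandCross_gen (o a i : ℕ) (h1 : o ≤ i) (h2 : i + 1 < o + a) (h3 : o + a < N) :
    strandCross N o a * gen N i = gen N (i + 1) * strandCross N o a := by
  obtain ⟨c, rfl⟩ := Nat.exists_eq_add_of_le h1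
  obtain ⟨d, rfl⟩ : ∃ d, a = c + (2 + d) := ⟨a - (c + 2), by omega⟩
  have e1 : strandCross N (o + c) 2 = gen N (o + c) * gen N (o + c + 1) := by
    simp [strandCross]
  have e2 := strandCross_gen_far (N := N) (o + c + 2) d (o + c) (by omega)
  have e3 := strandCross_gen_far (N := N) o c (o + c + 1) (by omega)
  have e4 := gen_braid N (i := o + c) (by omega)
  rw [strandCross_add, strandCross_add, e1]
  calc _ = strandCross N o c * (gen N (o + c) * gen N (o + c + 1)) *
        (strandCross N (o + c + 2) d * gen N (o + c)) := by group
    _ = strandCross N o c * (gen N (o + c) * gen N (o + c + 1) * gen N (o + c)) *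
        strandCross N (o + c + 2) d := by rw [e2]; group
    _ = strandCross N o c * gen N (o + c + 1) * (gen N (o + c) * gen N (o + c + 1)) *
        strandCross N (o + c + 2) d := by rw [e4]; group
    _ = _ := by rw [e3]; group

theorem blockCross_zero_left (o b : ℕ) : blockCross N o 0 b = 1 := by
  induction b with
  | zero => rfl
  | succ b ih => simp [blockCross, ih, strandCross]

theorem blockCross_add_right (o a b c : ℕ) :
    blockCross N o a (b + c) = blockCross N (o + b) a c * blockCross N o a b := by
  induction c with
  | zero => simp [blockCross]
  | succ c ih => rw [← add_assoc, blockCross, ih, blockCross, mul_assoc, add_assoc]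

theorem blockCross_one (o a : ℕ) : blockCross N o a 1 = strandCross N o a := by
  simp [blockCross]

theorem blockCross_gen_far (o a b i : ℕ) (h : i + 1 < o ∨ o + a + b ≤ i) :
    blockCross N o a b * gen N i = gen N i * blockCross N o a b := by
  induction b with
  | zero => simp [blockCross]
  | succ b ih =>
    rw [blockCross, mul_assoc, ih (by omega), ← mul_assoc,
      strandCross_gen_far _ _ _ (by omega), mul_assoc]

theorem blockCross_strandCross_far (o a b i e : ℕ) (h : i + e < o ∨ o + a + b ≤ i) :
    blockCross N o a b * strandCross N i e = strandCross N i e * blockCross N o a b := by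
  induction e with
  | zero => simp [strandCross]
  | succ e ih =>
    rw [strandCross, ← mul_assoc, ih (by omega), mul_assoc,
      blockCross_gen_far _ _ _ _ (by omega), mul_assoc]

theorem blockCross_add_left (o a a' b : ℕ) :
    blockCross N o (a + a') b = blockCross N o a b * blockCross N (o + a) a' b := by
  induction b with
  | zero => simp [blockCross]
  | succ b ih =>
    have := blockCross_strandCross_far (N := N) o a b (o + b + a) a' (by omega)
    rw [blockCross, ih, strandCross_add, blockCross, blockCross,
      show o + a + b = o + b + a by omega]
    calc _ = strandCross N (o + b) a *
          (strandCross N (o + b + a) a' * blockCross N o a b) * blockCross N (o + a) a' b := by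
            group
      _ = _ := by rw [← this]; group

theorem blockCross_gen_left (o a b i : ℕ) (h1 : o ≤ i) (h2 : i + 1 < o + a)
    (h3 : o + a + b ≤ N) :
    blockCross N o a b * gen N i = gen N (i + b) * blockCross N o a b := by
  induction b with
  | zero => simp [blockCross]
  | succ b ih =>
    rw [blockCross, mul_assoc, ih (by omega), ← mul_assoc,
      strandCross_gen _ _ _ (by omega) (by omega) (by omega), mul_assoc, add_assoc]

theorem strandCross_strandCross (o a e i : ℕ) (h1 : o ≤ i) (h2 : i + e < o + a)
    (h3 : o + a < N) :
    strandCross N o a * strandCross N i e = strandCross N (i + 1) e * strandCross N o a := by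
  induction e with
  | zero => simp [strandCross]
  | succ e ih =>
    rw [strandCross, ← mul_assoc, ih (by omega), mul_assoc,
      strandCross_gen _ _ _ (by omega) (by omega) h3, strandCross, mul_assoc,
      show i + e + 1 = i + 1 + e by omega]

theorem blockCross_strandCross_left (o a b i e : ℕ) (h1 : o ≤ i) (h2 : i + e < o + a)
    (h3 : o + a + b ≤ N) :
    blockCross N o a b * strandCross N i e = strandCross N (i + b) e * blockCross N o a b := by
  induction e with
  | zero => simp [strandCross]
  | succ e ih =>
    rw [strandCross, ← mul_assoc, ih (by omega), mul_assoc,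
      blockCross_gen_left _ _ _ _ (by omega) (by omega) h3, strandCross, mul_assoc,
      show i + e + b = i + b + e by omega]

theorem blockCross_blockCross_left (o d c i e f : ℕ) (h1 : o ≤ i) (h2 : i + e + f ≤ o + d)
    (h3 : o + d + c ≤ N) :
    blockCross N o d c * blockCross N i e f = blockCross N (i + c) e f * blockCross N o d c := by
  induction f with
  | zero => simp [blockCross]
  | succ f ih =>
    rw [blockCross, ← mul_assoc, blockCross_strandCross_left _ _ _ _ _ (by omega) (by omega) h3,
      mul_assoc, ih (by omega), ← mul_assoc, blockCross, show i + f + c = i + c + f by omega]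

theorem blockCross_gen_right (o a b i : ℕ) (h1 : o ≤ i) (h2 : i + 1 < o + b)
    (h3 : o + a + b ≤ N) :
    blockCross N o a b * gen N (i + a) = gen N i * blockCross N o a b := by
  obtain ⟨c, rfl⟩ := Nat.exists_eq_add_of_le h1
  obtain ⟨d, rfl⟩ : ∃ d, b = c + (2 + d) := ⟨b - (c + 2), by omega⟩
  have e1 : blockCross N (o + c) a 2 =
      strandCross N (o + c + 1) a * strandCross N (o + c) a := by
    simp [blockCross]
  have e2 := blockCross_gen_far (N := N) o a c (o + c + a) (by omega)
  have e3 := blockCross_gen_far (N := N) (o + c + 2) a d (o + c) (by omega)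
  have e4 := strandCross_strandCross (N := N) (o + c) (a + 1) a (o + c) le_rfl (by omega)
    (by omega)
  have e5 : strandCross N (o + c) (a + 1) = strandCross N (o + c) a * gen N (o + c + a) := rfl
  have e6 : strandCross N (o + c) (a + 1) = gen N (o + c) * strandCross N (o + c + 1) a := by
    rw [add_comm a, strandCross_add, strandCross_one]
  rw [blockCross_add_right, blockCross_add_right, e1]
  calc _ = blockCross N (o + c + 2) a d * (strandCross N (o + c + 1) a * strandCross N (o + c) a) *
        (blockCross N o a c * gen N (o + c + a)) := by group
    _ = blockCross N (o + c + 2) a d * (strandCross N (o + c + 1) a *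
        strandCross N (o + c) (a + 1)) * blockCross N o a c := by rw [e2, e5]; group
    _ = (blockCross N (o + c + 2) a d * gen N (o + c)) *
        (strandCross N (o + c + 1) a * strandCross N (o + c) a) * blockCross N o a c := by
          rw [← e4, e6]; group
    _ = _ := by rw [e3]; group

theorem blockCross_far (o a b o' a' b' : ℕ) (h : o + a + b ≤ o') :
    blockCross N o a b * blockCross N o' a' b' = blockCross N o' a' b' * blockCross N o a b := by
  induction b' with
  | zero => simp [blockCross]
  | succ b' ih =>
    rw [blockCross, ← mul_assoc, blockCross_strandCross_far _ _ _ _ _ (by omega), mul_assoc, ih,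
      mul_assoc]

theorem blockCross_yang_baxter (o a b c : ℕ) (h : o + a + b + c ≤ N) :
    blockCross N o b c * blockCross N (o + b) a c * blockCross N o a b =
      blockCross N (o + c) a b * blockCross N o a c * blockCross N (o + a) b c := by
  rw [← blockCross_add_left, blockCross_blockCross_left _ _ _ _ _ _ le_rfl (by omega) (by omega),
    add_comm b a, blockCross_add_left, mul_assoc]

end cross
/-- The function on positions listed by `l`. -/
def fn (n : ℕ) (l : List ℕ) : Fin n → ℕ := fun j => l.getD j 0

theorem fn_ofFn {n : ℕ} (k : Fin n → ℕ) : fn n (List.ofFn k) = k := by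
  funext j; simp [fn]

theorem ofFn_fn {n : ℕ} (l : List ℕ) (h : l.length = n) : List.ofFn (fn n l) = l := by
  subst h
  apply List.ext_getElem?
  intro i
  by_cases hi : i < l.length
  · simp [fn, hi]
  · simp [hi]

theorem exists_split {α : Type*} {n i : ℕ} (w : Fin n → α) (h : i + 1 < n) :
    ∃ P x y Q, P.length = i ∧ List.ofFn w = P ++ x :: y :: Q := by
  have hl : (List.ofFn w).length = n := List.length_ofFn
  refine ⟨(List.ofFn w).take i, w ⟨i, by omega⟩, w ⟨i + 1, h⟩, (List.ofFn w).drop (i + 2),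
    by simp; omega, ?_⟩
  conv_lhs => rw [← List.take_append_drop i (List.ofFn w)]
  rw [List.drop_eq_getElem_cons (by omega), List.drop_eq_getElem_cons (by omega)]
  simp

/-- Permuting the values of a function by an adjacent transposition, in terms of lists. -/
theorem ofFn_adj {α : Type*} {n : ℕ} (w : Fin n → α) (P Q : List α) (x y : α)
    (h : List.ofFn w = P ++ x :: y :: Q) :
    List.ofFn (w ∘ adj n P.length) = P ++ y :: x :: Q := by
  have hl : P.length + (Q.length + 2) = n := by
    have := congrArg List.length h
    simpa using this.symm
  have key : ∀ k : Fin n, some (w k) = (P ++ x :: y :: Q)[(k : ℕ)]? := by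
    intro k; rw [← h]; simp
  apply List.ext_getElem?
  intro j
  by_cases hj : j < n
  · have e1 : (List.ofFn (w ∘ adj n P.length))[j]? = some (w (adj n P.length ⟨j, hj⟩)) := by
      simp [hj]
    rw [e1, key, adj_val (by omega)]
    simp only
    split_ifs with h1 h2
    · subst h1; simp
    · subst h2; simp
    · rcases lt_or_ge j P.length with h3 | h3
      · simp [List.getElem?_append_left h3]
      · obtain ⟨d, rfl⟩ : ∃ d, j = P.length + (d + 2) := ⟨j - (P.length + 2), by omega⟩
        simp [List.getElem?_append_right]
  · rw [List.getElem?_eq_none (by simpa using hj),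
      List.getElem?_eq_none (by simp; omega)]

/-- Given the sizes `k` of the blocks at the output positions, the total size of the blocks to the
left of output position `j`. -/
def offset {n : ℕ} (k : Fin n → ℕ) (j : ℕ) : ℕ := ((List.ofFn k).take j).sum

/-- Permutations act on families indexed by the output block sizes. -/
def sizesAct (n : ℕ) (G : Type) [Group G] :
    Equiv.Perm (Fin n) →* MulAut ((Fin n → ℕ) → G) where
  toFun s :=
    { toFun := fun f k => f (k ∘ s)
      invFun := fun f k => f (k ∘ s.symm)
      left_inv := fun f => by funext k; simp [Function.comp_assoc]
      right_inv := fun f => by funext k; simp [Function.comp_assoc]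
      map_mul' := fun _ _ => rfl }
  map_one' := rfl
  map_mul' _ _ := rfl

/-- The size of the block at output position `j`. -/
def size {n : ℕ} (k : Fin n → ℕ) (j : ℕ) : ℕ := if h : j < n then k ⟨j, h⟩ else 0

/-- The cabling of `σᵢ` with output blocks of sizes `k`, as a braid on `N = ∑ k` strands: the
block at input position `i`, whose size is `k (i + 1)`, crosses the block at input position
`i + 1`, whose size is `k i`. (The value `1` for `N ≠ ∑ k` is never used.) -/
def cableGen (n N i : ℕ) : (Fin n → ℕ) → Braid N := fun k =>
  if ∑ j, k j = N then blockCross N (offset k i) (size k (i + 1)) (size k i) else 1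

theorem size_eq {n : ℕ} (k : Fin n → ℕ) (j : ℕ) : size k j = (List.ofFn k).getD j 0 := by
  unfold size
  split_ifs with h <;> simp [h]

theorem cableGen_eq {n N : ℕ} (k : Fin n → ℕ) (P Q : List ℕ) (x y : ℕ)
    (h : List.ofFn k = P ++ y :: x :: Q) (hN : (P ++ y :: x :: Q).sum = N) :
    cableGen n N P.length k = blockCross N P.sum x y := by
  have e : ∑ j, k j = N := by rw [← List.sum_ofFn, h, hN]
  rw [cableGen, if_pos e, offset, size_eq, size_eq, h]
  simp

theorem sum_comp_perm {n : ℕ} (k : Fin n → ℕ) (s : Equiv.Perm (Fin n)) :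
    ∑ j, (k ∘ s) j = ∑ j, k j := Equiv.sum_comp s k

theorem cableGen_comm (n N : ℕ) {i j : ℕ} (h1 : i + 1 < j) (h2 : j + 1 < n) (k : Fin n → ℕ) :
    cableGen n N i k * cableGen n N j (k ∘ adj n i) =
      cableGen n N j k * cableGen n N i (k ∘ adj n j) := by
  by_cases hN : ∑ j, k j = N
  swap
  · simp only [cableGen, sum_comp_perm, hN, if_false]
  obtain ⟨P', x', y', Q, hP', hk⟩ := exists_split k h2
  have hi : i + 1 < P'.length := by omega
  obtain ⟨P, x, y, R, hP, hR⟩ := exists_split (fun a : Fin P'.length => P'[a]) hi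
  have hR' : P' = P ++ x :: y :: R := by rw [← hR]; simp
  subst hP
  have hk1 : List.ofFn k = P ++ x :: y :: (R ++ x' :: y' :: Q) := by rw [hk, hR']; simp
  have hk2 : List.ofFn k = (P ++ x :: y :: R) ++ x' :: y' :: Q := by rw [hk, hR']
  have hj : j = (P ++ x :: y :: R).length := by rw [← hP', hR']
  have a1 := ofFn_adj k _ _ _ _ hk1
  have a2 := ofFn_adj k _ _ _ _ hk2
  have hs : (P ++ x :: y :: (R ++ x' :: y' :: Q)).sum = N := by
    rw [← hk1, List.sum_ofFn, hN]
  simp only [List.sum_append, List.sum_cons] at hs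
  rw [hj]
  rw [cableGen_eq k _ _ _ _ hk1 (by simp; omega), cableGen_eq k _ _ _ _ hk2 (by simp; omega)]
  have b1 : List.ofFn (k ∘ adj n P.length) = (P ++ y :: x :: R) ++ x' :: y' :: Q := by
    rw [a1]; simp
  have b2 : List.ofFn (k ∘ adj n (P ++ x :: y :: R).length) =
      P ++ x :: y :: (R ++ y' :: x' :: Q) := by
    rw [a2]; simp
  have c1 := cableGen_eq (N := N) _ _ _ _ _ b1 (by simp; omega)
  have c2 := cableGen_eq (N := N) _ _ _ _ _ b2 (by simp; omega)
  rw [show (P ++ y :: x :: R).length = (P ++ x :: y :: R).length by simp] at c1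
  rw [c1, c2, show (P ++ y :: x :: R).sum = (P ++ x :: y :: R).sum by simp; omega]
  exact blockCross_far _ _ _ _ _ _ (by simp; omega)

theorem cableGen_braid (n N : ℕ) {i : ℕ} (h : i + 2 < n) (k : Fin n → ℕ) :
    cableGen n N i k * cableGen n N (i + 1) (k ∘ adj n i) *
        cableGen n N i ((k ∘ adj n i) ∘ adj n (i + 1)) =
      cableGen n N (i + 1) k * cableGen n N i (k ∘ adj n (i + 1)) *
        cableGen n N (i + 1) ((k ∘ adj n (i + 1)) ∘ adj n i) := by
  by_cases hN : ∑ j, k j = N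
  swap
  · simp only [cableGen, sum_comp_perm, hN, if_false]
  obtain ⟨P', b, a, Q, hP', hk⟩ := exists_split k (i := i + 1) h
  obtain ⟨P, c, rfl⟩ : ∃ P c, P' = P ++ [c] := by
    rcases List.eq_nil_or_concat P' with rfl | ⟨P, c, rfl⟩
    · simp at hP'
    · exact ⟨P, c, by simp⟩
  obtain rfl : P.length = i := by simpa using hP'
  have hs : (P ++ [c] ++ b :: a :: Q).sum = N := by rw [← hk, List.sum_ofFn, hN]
  simp only [List.sum_append, List.sum_cons, List.sum_nil] at hs
  have L : ∀ x y z : ℕ, P ++ [x] ++ y :: z :: Q = P ++ x :: y :: (z :: Q) := by simp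
  have hl : ∀ x : ℕ, (P ++ [x]).length = P.length + 1 := by simp
  have A : ∀ (w : Fin n → ℕ) (x y z : ℕ), x + y + z = a + b + c →
      List.ofFn w = P ++ x :: y :: z :: Q →
      cableGen n N P.length w = blockCross N P.sum y x ∧
      cableGen n N (P.length + 1) w = blockCross N (P.sum + x) z y ∧
      List.ofFn (w ∘ adj n P.length) = P ++ y :: x :: z :: Q ∧
      List.ofFn (w ∘ adj n (P.length + 1)) = P ++ x :: z :: y :: Q := by
    intro w x y z hxyz hw
    have hw' : List.ofFn w = P ++ [x] ++ y :: z :: Q := by rw [hw, L]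
    refine ⟨cableGen_eq w P _ _ _ hw (by simp; omega), ?_, ofFn_adj w _ _ _ _ hw, ?_⟩
    · have := cableGen_eq (N := N) w (P ++ [x]) _ _ _ hw' (by simp; omega)
      simpa using this
    · have := ofFn_adj w (P ++ [x]) _ _ _ hw'
      rw [hl] at this
      rw [this, L]
  obtain ⟨e1, e2, e3, e4⟩ := A k c b a (by omega) (by rw [hk, L])
  obtain ⟨-, f2, -, f4⟩ := A _ b c a (by omega) e3
  obtain ⟨g1, -, -, -⟩ := A _ b a c (by omega) f4
  obtain ⟨p1, -, p3, -⟩ := A _ c a b (by omega) e4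
  obtain ⟨-, q2, -, -⟩ := A _ a c b (by omega) p3
  rw [e1, e2, f2, g1, p1, q2]
  exact blockCross_yang_baxter _ _ _ _ (by omega)

/-- The cabling `Bₙ → (sizes → B_N) ⋊ Σₙ`; the group law on the right-hand side says that the
cabling of `g * h` with output sizes `k` is the cabling of `g` with output sizes `k` times the
cabling of `h` with the sizes `k ∘ perm g` between `h` and `g`. -/
def cableHom (n N : ℕ) :
    Braid n →* ((Fin n → ℕ) → Braid N) ⋊[sizesAct n (Braid N)] Equiv.Perm (Fin n) :=
  Braid.lift (fun i => ⟨cableGen n N i, adj n i⟩)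
    (by
      intro i j h1 h2
      have e : adj n i * adj n j = adj n j * adj n i := by
        rw [← perm_gen h2, ← perm_gen (by omega : i + 1 < n), ← map_mul, ← map_mul, gen_comm n h1]
      refine SemidirectProduct.ext ?_ e
      funext k
      exact cableGen_comm n N h1 h2 k)
    (by
      intro i h
      have e : adj n i * adj n (i + 1) * adj n i = adj n (i + 1) * adj n i * adj n (i + 1) := by
        rw [← perm_gen (by omega : i + 1 < n), ← perm_gen (by omega : i + 1 + 1 < n), ← map_mul,
          ← map_mul, gen_braid n h, map_mul, map_mul]
      refine SemidirectProduct.ext ?_ e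
      funext k
      exact cableGen_braid n N h k)

/-- The braid obtained from `A ∈ Bₙ` by replacing the strand with output position `j` by `k j`
parallel strands, for every `j`; here `∑ k = N`. It is the full operadic composite
`∘[A; id_{k 0}, …, id_{k (n-1)}]` in the braid operad. -/
def cable {n : ℕ} (N : ℕ) (k : Fin n → ℕ) (A : Braid n) : Braid N := (cableHom n N A).left k

theorem cableHom_right {n N : ℕ} (A : Braid n) : (cableHom n N A).right = perm A := by
  induction A using Braid.induction with
  | one => simp
  | of i h => rw [cableHom, Braid.lift_gen _ _ _ h, perm_gen h]
  | mul a b ha hb => simp [ha, hb]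
  | inv a ha => simp [ha]

theorem cable_one {n N : ℕ} (k : Fin n → ℕ) : cable N k (1 : Braid n) = 1 := by
  simp [cable]

theorem cable_mul {n N : ℕ} (k : Fin n → ℕ) (A B : Braid n) :
    cable N k (A * B) = cable N k A * cable N (k ∘ perm A) B := by
  rw [← cableHom_right (N := N) A]
  simp only [cable, map_mul, SemidirectProduct.mul_left]
  rfl

theorem cable_inv {n N : ℕ} (k : Fin n → ℕ) (A : Braid n) :
    cable N k A⁻¹ = (cable N (k ∘ perm A⁻¹) A)⁻¹ := by
  rw [eq_inv_iff_mul_eq_one, ← cable_mul, inv_mul_cancel, cable_one]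

theorem cable_gen {n N i : ℕ} (h : i + 1 < n) (k : Fin n → ℕ) :
    cable N k (gen n i) = cableGen n N i k := by
  rw [cable, cableHom, Braid.lift_gen _ _ _ h]

theorem cable_gen_eq {n N : ℕ} (k : Fin n → ℕ) (P Q : List ℕ) (x y : ℕ)
    (h : List.ofFn k = P ++ y :: x :: Q) (hN : (P ++ y :: x :: Q).sum = N) :
    cable N k (gen n P.length) = blockCross N P.sum x y := by
  have : P.length + 1 < n := by
    have := congrArg List.length h
    simp at this; omega
  rw [cable_gen this, cableGen_eq k P Q x y h hN]

/-- The braid `1 ⊕ A ⊕ 1` on `N` strands, `A` being placed on the strands `o, …, o + m - 1`. -/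
def shift {m N : ℕ} (o : ℕ) (h : o + m ≤ N) : Braid m →* Braid N :=
  Braid.lift (fun i => gen N (o + i))
    (fun i j h1 _ => gen_comm N (by omega))
    (fun i h1 => gen_braid N (by omega))

theorem shift_gen {m N o i : ℕ} (h : o + m ≤ N) (hi : i + 1 < m) :
    shift o h (gen m i) = gen N (o + i) := Braid.lift_gen _ _ _ hi

/-- The sizes of the blocks when the strand at output position `a` is replaced by `m` strands. -/
def single {n : ℕ} (a : Fin n) (m : ℕ) : Fin n → ℕ := fun j => if j = a then m else 1

/-- The partial composition `A ∘ₐ C` in the braid operad, as a braid on `N = n + m - 1` strands: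
the strand of `A` with output position `a` is replaced by the braid `C`. -/
def braidComp {n m N : ℕ} (h : N + 1 = n + m) (a : Fin n) (A : Braid n) (C : Braid m) : Braid N :=
  shift (a : ℕ) (by omega) C * cable N (single a m) A
/-! ### Properties of cabling -/

section carries

variable {α : Type*} {n N : ℕ}

/-- `A` carries the list `l` of colours of its input positions to the list `l'` of colours of its
output positions. -/
def Carries (A : Braid n) (l l' : List α) : Prop :=
  l.length = n ∧ l'.length = n ∧ ∀ k : Fin n, l'[(perm A k : ℕ)]? = l[(k : ℕ)]?

theorem Carries.one {l : List α} (h : l.length = n) : Carries (1 : Braid n) l l :=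
  ⟨h, h, fun k => by simp⟩

theorem Carries.mul {A B : Braid n} {l l' l'' : List α} (hA : Carries A l' l'')
    (hB : Carries B l l') : Carries (A * B) l l'' :=
  ⟨hB.1, hA.2.1, fun k => by rw [map_mul, Equiv.Perm.mul_apply, hA.2.2, hB.2.2]⟩

theorem Carries.inv {A : Braid n} {l l' : List α} (hA : Carries A l l') : Carries A⁻¹ l' l :=
  ⟨hA.2.1, hA.1, fun k => by
    have := hA.2.2 (perm A⁻¹ k)
    rw [← this]; simp⟩

theorem Carries.gen (P Q : List α) (x y : α) (h : (P ++ x :: y :: Q).length = n) :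
    Carries (gen n P.length) (P ++ x :: y :: Q) (P ++ y :: x :: Q) := by
  refine ⟨h, by simpa using h, fun k => ?_⟩
  have hn : P.length + (Q.length + 2) = n := by simpa using h
  rw [perm_gen (by omega), adj_val (by omega)]
  split_ifs with h1 h2
  · simp [h1]
  · simp [h2]
  · rcases lt_or_ge (k : ℕ) P.length with h3 | h3
    · simp [List.getElem?_append_left h3]
    · obtain ⟨d, hd⟩ : ∃ d, (k : ℕ) = P.length + (d + 2) := ⟨k - (P.length + 2), by omega⟩
      rw [hd]; simp [List.getElem?_append_right]

theorem Carries.strandCross (P A Q : List α) (x : α) (h : (P ++ A ++ x :: Q).length = n) :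
    Carries (strandCross n P.length A.length) (P ++ A ++ x :: Q) (P ++ x :: (A ++ Q)) := by
  induction A using List.reverseRecOn generalizing Q with
  | nil => simpa [WeakBraid.strandCross] using Carries.one h
  | append_singleton A y ih =>
    have h1 := Carries.gen (P ++ A) Q y x (n := n) (by simp at h ⊢; omega)
    have h2 := ih (y :: Q) (by simp at h ⊢; omega)
    have h3 := h2.mul h1
    simpa [WeakBraid.strandCross] using h3

theorem Carries.blockCross (P A B Q : List α) (h : (P ++ A ++ B ++ Q).length = n) :
    Carries (blockCross n P.length A.length B.length) (P ++ A ++ B ++ Q) (P ++ B ++ A ++ Q) := by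
  induction B using List.reverseRecOn generalizing Q with
  | nil => simpa [WeakBraid.blockCross] using Carries.one h
  | append_singleton B x ih =>
    have h1 := ih (x :: Q) (by simp at h ⊢; omega)
    have h2 := Carries.strandCross (P ++ B) A Q x (n := n) (by simp at h ⊢; omega)
    have h3 := h2.mul (by simpa using h1)
    simpa [WeakBraid.blockCross] using h3

theorem comp_perm_of_carries {A : Braid n} {l l' : List ℕ} (h : Carries A l l') :
    fn n l' ∘ perm A = fn n l := by
  funext k
  simp only [fn, Function.comp, List.getD_eq_getElem?_getD, h.2.2 k]

theorem cable_mul_of_carries {A B : Braid n} {l l' : List ℕ} (h : Carries A l l') :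
    cable N (fn n l') (A * B) = cable N (fn n l') A * cable N (fn n l) B := by
  rw [cable_mul, comp_perm_of_carries h]

theorem flatten_ofFn_adj (w : Fin n → List α) {i : ℕ} (h : i + 1 < n) :
    ∃ P Q x y, P.length = i ∧ List.ofFn w = P ++ x :: y :: Q ∧
      List.ofFn (w ∘ adj n i) = P ++ y :: x :: Q := by
  obtain ⟨P, x, y, Q, rfl, e⟩ := exists_split w h
  exact ⟨P, Q, x, y, rfl, e, ofFn_adj w _ _ _ _ e⟩

theorem ofFn_comp {β γ : Type*} (f : β → γ) (w : Fin n → β) :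
    List.ofFn (f ∘ w) = (List.ofFn w).map f := by
  simp [List.map_ofFn]

/-- Cabled braids permute blocks. -/
theorem Carries.cable (A : Braid n) (w : Fin n → List α) (h : ∑ j, (w j).length = N) :
    Carries (cable N (List.length ∘ w) A) (List.ofFn (w ∘ perm A)).flatten
      (List.ofFn w).flatten := by
  have hl : ∀ w : Fin n → List α, (List.ofFn w).flatten.length = ∑ j, (w j).length := by
    intro w
    rw [List.length_flatten, ← ofFn_comp, List.sum_ofFn]; rfl
  induction A using Braid.induction generalizing w with
  | one =>
    rw [cable_one]
    simpa using Carries.one (by rw [hl, h])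
  | of i hi =>
    obtain ⟨P, Q, x, y, rfl, e1, e2⟩ := flatten_ofFn_adj w hi
    have e3 : List.ofFn (List.length ∘ w) =
        P.map List.length ++ x.length :: y.length :: Q.map List.length := by
      rw [ofFn_comp, e1]; simp
    have e4 := hl w
    rw [h, e1] at e4
    have e5 := cable_gen_eq (N := N) _ _ _ _ _ e3 (by simpa using e4)
    rw [List.length_map] at e5
    rw [e5, perm_gen hi, e1, e2]
    have := Carries.blockCross P.flatten y x Q.flatten (n := N) (by simp at e4 ⊢; omega)
    simpa using this
  | mul A B hA hB =>
    rw [cable_mul, map_mul]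
    refine (hA w h).mul ?_
    have := hB (w ∘ perm A) (by rw [← h]; exact Equiv.sum_comp (perm A) fun j => (w j).length)
    exact this
  | inv A hA =>
    rw [cable_inv]
    have := hA (w ∘ perm A⁻¹)
      (by rw [← h]; exact Equiv.sum_comp (perm A⁻¹) fun j => (w j).length)
    have e : (w ∘ perm A⁻¹) ∘ perm A = w := by funext j; simp
    rw [e] at this
    exact this.inv

theorem cable_strandCross (P A Q : List ℕ) (x : ℕ) (h : (P ++ x :: (A ++ Q)).length = n)
    (hN : (P ++ x :: (A ++ Q)).sum = N) :
    cable N (fn n (P ++ x :: (A ++ Q))) (strandCross n P.length A.length) =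
      blockCross N P.sum A.sum x := by
  induction A using List.reverseRecOn generalizing Q with
  | nil => simp [strandCross, cable_one, blockCross_zero_left]
  | append_singleton A y ih =>
    have h1 := Carries.strandCross P A (y :: Q) x (n := n) (by simp at h ⊢; omega)
    have h2 := ih (y :: Q) (by simpa using h) (by simpa using hN)
    have e1 : P ++ x :: (A ++ [y] ++ Q) = P ++ x :: (A ++ y :: Q) := by simp
    have e2 : List.ofFn (fn n (P ++ A ++ x :: y :: Q)) = P ++ A ++ x :: y :: Q :=
      ofFn_fn _ (by simp at h ⊢; omega)
    have h3 := cable_gen_eq (N := N) _ _ _ _ _ e2 (by simp at hN ⊢; omega)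
    rw [List.length_append] at h3
    rw [e1, List.length_append, List.length_singleton, strandCross, cable_mul_of_carries h1, h2, h3,
      List.sum_append, List.sum_append, List.sum_singleton, blockCross_add_left]

theorem cable_blockCross (P A B Q : List ℕ) (h : (P ++ B ++ A ++ Q).length = n)
    (hN : (P ++ B ++ A ++ Q).sum = N) :
    cable N (fn n (P ++ B ++ A ++ Q)) (blockCross n P.length A.length B.length) =
      blockCross N P.sum A.sum B.sum := by
  induction B using List.reverseRecOn generalizing Q with
  | nil => simp [blockCross, cable_one]
  | append_singleton B x ih =>
    have h1 := Carries.strandCross (P ++ B) A Q x (n := n) (by simp at h ⊢; omega)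
    have h2 := cable_strandCross (N := N) (P ++ B) A Q x (n := n) (by simp at h ⊢; omega)
      (by simp at hN ⊢; omega)
    have h3 := ih (x :: Q) (by simp at h ⊢; omega) (by simp at hN ⊢; omega)
    have e1 : P ++ (B ++ [x]) ++ A ++ Q = P ++ B ++ x :: (A ++ Q) := by simp
    rw [List.length_append] at h1 h2
    rw [e1, List.length_append, List.length_singleton, blockCross, cable_mul_of_carries h1, h2, h3,
      List.sum_append, List.sum_append, List.sum_singleton, blockCross_add_right]

/-- Iterated cabling. -/
theorem cable_cable {M : ℕ} (A : Braid n) (w : Fin n → List ℕ) (h : ∑ j, (w j).length = N)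
    (hM : ∑ j, (w j).sum = M) :
    cable M (fn N (List.ofFn w).flatten) (cable N (List.length ∘ w) A) =
      cable M (List.sum ∘ w) A := by
  have hl : ∀ w : Fin n → List ℕ, (List.ofFn w).flatten.length = ∑ j, (w j).length := by
    intro w
    rw [List.length_flatten, ← ofFn_comp, List.sum_ofFn]; rfl
  have hs : ∀ w : Fin n → List ℕ, (List.ofFn w).flatten.sum = ∑ j, (w j).sum := by
    intro w
    rw [List.sum_flatten, ← ofFn_comp, List.sum_ofFn]; rfl
  induction A using Braid.induction generalizing w with
  | one => simp [cable_one]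
  | of i hi =>
    obtain ⟨P, Q, x, y, rfl, e1, -⟩ := flatten_ofFn_adj w hi
    have e3 : List.ofFn (List.length ∘ w) =
        P.map List.length ++ x.length :: y.length :: Q.map List.length := by
      rw [ofFn_comp, e1]; simp
    have e4 : List.ofFn (List.sum ∘ w) =
        P.map List.sum ++ x.sum :: y.sum :: Q.map List.sum := by
      rw [ofFn_comp, e1]; simp
    have e5 := hl w
    have e6 := hs w
    rw [h, e1] at e5
    rw [hM, e1] at e6
    have e7 := cable_gen_eq (N := N) _ _ _ _ _ e3 (by simpa using e5)
    have e8 := cable_gen_eq (N := M) _ _ _ _ _ e4 (by simpa [List.sum_flatten] using e6)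
    rw [List.length_map] at e7 e8
    have := cable_blockCross (N := M) P.flatten y x Q.flatten (n := N)
      (by simp at e5 ⊢; omega) (by simp at e6 ⊢; omega)
    rw [e7, e8, e1]
    rw [List.length_flatten, List.sum_flatten] at this
    simpa using this
  | mul A B hA hB =>
    have h' : ∑ j, ((w ∘ perm A) j).length = N := by
      rw [← h]; exact Equiv.sum_comp (perm A) fun j => (w j).length
    have hM' : ∑ j, ((w ∘ perm A) j).sum = M := by
      rw [← hM]; exact Equiv.sum_comp (perm A) fun j => (w j).sum
    rw [cable_mul, cable_mul_of_carries (Carries.cable A w h), hA w h hM, cable_mul]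
    congr 1
    exact hB (w ∘ perm A) h' hM'
  | inv A hA =>
    have h' : ∑ j, ((w ∘ perm A⁻¹) j).length = N := by
      rw [← h]; exact Equiv.sum_comp (perm A⁻¹) fun j => (w j).length
    have hM' : ∑ j, ((w ∘ perm A⁻¹) j).sum = M := by
      rw [← hM]; exact Equiv.sum_comp (perm A⁻¹) fun j => (w j).sum
    have c := (Carries.cable A (w ∘ perm A⁻¹) h')
    have e : (w ∘ perm A⁻¹) ∘ perm A = w := by funext j; simp
    rw [e] at c
    have c1 := comp_perm_of_carries c.inv
    have c2 := hA (w ∘ perm A⁻¹) h' hM'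
    rw [cable_inv _ A, cable_inv _ A]
    change cable M _ (cable N (List.length ∘ (w ∘ perm A⁻¹)) A)⁻¹ =
      (cable M (List.sum ∘ (w ∘ perm A⁻¹)) A)⁻¹
    rw [cable_inv]
    rw [c1, c2]

theorem Carries.shift {m : ℕ} {C : Braid m} {l l' : List α} (hC : Carries C l l')
    (P Q : List α) (h : P.length + m ≤ N) (hN : (P ++ l ++ Q).length = N) :
    Carries (shift P.length h C) (P ++ l ++ Q) (P ++ l' ++ Q) := by
  obtain ⟨h1, h2, h3⟩ := hC
  induction C using Braid.induction generalizing l l' with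
  | one =>
    have : l = l' := by
      apply List.ext_getElem?
      intro i
      by_cases hi : i < m
      · simpa using (h3 ⟨i, hi⟩).symm
      · rw [List.getElem?_eq_none (by omega), List.getElem?_eq_none (by omega)]
    subst this
    simpa using Carries.one hN
  | of i hi =>
    subst h1
    rw [shift_gen h hi]
    obtain ⟨P1, Q1, x, y, rfl, e1, -⟩ : ∃ P1 Q1 x y, P1.length = i ∧ l = P1 ++ x :: y :: Q1 ∧
        True := by
      obtain ⟨P1, Q1, x, y, h, e, -⟩ : ∃ P Q x y, P.length = i ∧
          List.ofFn l.get = P ++ x :: y :: Q ∧ True := by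
        obtain ⟨P, x, y, Q, h, e⟩ := exists_split l.get hi
        exact ⟨P, Q, x, y, h, e, trivial⟩
      exact ⟨P1, Q1, x, y, h, by rw [← e, List.ofFn_get], trivial⟩
    have hl' : l' = P1 ++ y :: x :: Q1 := by
      have g := Carries.gen P1 Q1 x y (n := l.length) (by rw [← e1])
      apply List.ext_getElem?
      intro j
      by_cases hj : j < l.length
      · have a1 := h3 ((perm (WeakBraid.gen l.length P1.length)).symm ⟨j, hj⟩)
        have a2 := g.2.2 ((perm (WeakBraid.gen l.length P1.length)).symm ⟨j, hj⟩)
        rw [Equiv.apply_symm_apply] at a1 a2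
        simp only at a1 a2
        rw [a1, a2, ← e1]
      · rw [List.getElem?_eq_none (by omega), List.getElem?_eq_none (by have := g.2.1; omega)]
    have := Carries.gen (P ++ P1) (Q1 ++ Q) x y (n := N) (by rw [← hN, e1]; simp)
    rw [e1, hl']
    simpa using this
  | mul A B hA hB =>
    obtain ⟨l1, hl1⟩ : ∃ l1 : List α, Carries B l l1 := by
      subst h1
      refine ⟨List.ofFn (l.get ∘ (perm B).symm), rfl, by simp, fun k => by simp⟩
    have hA' : ∀ k : Fin m, l'[(perm A k : ℕ)]? = l1[(k : ℕ)]? := by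
      intro k
      have a1 := h3 ((perm B).symm k)
      have a2 := hl1.2.2 ((perm B).symm k)
      rw [map_mul, Equiv.Perm.mul_apply, Equiv.apply_symm_apply] at a1
      rw [Equiv.apply_symm_apply] at a2
      rw [a1, a2]
    rw [map_mul]
    exact (hA (l := l1) (l' := l') (by have := hl1.2.1; simp at hN ⊢; omega) hl1.2.1 h2 hA').mul
      (hB hN h1 hl1.2.1 hl1.2.2)
  | inv A hA =>
    rw [map_inv]
    refine (hA (l := l') (l' := l) (by simp at hN ⊢; omega) h2 h1 ?_).inv
    intro k
    have := h3 (perm A k)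
    rw [← this]; simp

theorem Carries.exists {m : ℕ} (C : Braid m) (l' : List α) (h : l'.length = m) :
    ∃ l, Carries C l l' := by
  subst h
  exact ⟨List.ofFn (l'.get ∘ perm C), by simp, rfl, fun k => by simp⟩

theorem shift_strandCross {m o o' a : ℕ} (h : o + m ≤ N) (h' : o' + a < m ∨ a = 0) :
    shift o h (strandCross m o' a) = strandCross N (o + o') a := by
  induction a with
  | zero => simp [strandCross]
  | succ a ih =>
    rw [strandCross, map_mul, ih (by omega), shift_gen h (by omega), strandCross, add_assoc]

theorem shift_blockCross {m o o' a b : ℕ} (h : o + m ≤ N) (h' : o' + a + b ≤ m) :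
    shift o h (blockCross m o' a b) = blockCross N (o + o') a b := by
  induction b with
  | zero => simp [blockCross]
  | succ b ih =>
    rw [blockCross, map_mul, ih (by omega), shift_strandCross h (by omega), blockCross, add_assoc]

theorem cable_shift {m M m' : ℕ} (C : Braid m) (P l Q : List ℕ) (h : P.length + m ≤ N)
    (hl : l.length = m) (hN : (P ++ l ++ Q).length = N) (hM : (P ++ l ++ Q).sum = M)
    (hm' : l.sum = m') (h' : P.sum + m' ≤ M) :
    cable M (fn N (P ++ l ++ Q)) (shift P.length h C) = shift P.sum h' (cable m' (fn m l) C) := by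
  have key : ∀ {A : Braid m} {l l' : List ℕ}, Carries A l l' → l'.sum = l.sum := by
    intro A l l' hA
    have := comp_perm_of_carries hA
    have e1 : (List.ofFn (fn m l)).sum = (List.ofFn (fn m l')).sum := by
      rw [List.sum_ofFn, List.sum_ofFn, ← this, sum_comp_perm]
    rw [ofFn_fn _ hA.1, ofFn_fn _ hA.2.1] at e1
    exact e1.symm
  induction C using Braid.induction generalizing l with
  | one => simp [cable_one]
  | of i hi =>
    obtain ⟨P1, x, y, Q1, rfl, e1⟩ := exists_split (fn m l) hi
    have e2 := cable_gen_eq (N := m') _ _ _ _ _ e1 (by rw [← e1, ofFn_fn _ hl, hm'])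
    rw [ofFn_fn _ hl] at e1
    have e3 : List.ofFn (fn N (P ++ l ++ Q)) = (P ++ P1) ++ x :: y :: (Q1 ++ Q) := by
      rw [ofFn_fn _ hN, e1]; simp
    have e4 := cable_gen_eq (N := M) _ _ _ _ _ e3 (by rw [← hM, e1]; simp)
    rw [List.length_append, List.sum_append] at e4
    rw [shift_gen h hi, e4, e2, shift_blockCross]
    rw [e1] at hm'; simp at hm'; omega
  | mul A B hA hB =>
    obtain ⟨l1, hl1⟩ := Carries.exists A l hl
    have k1 := key hl1
    have c := Carries.shift hl1 P Q h (by have := hl1.1; simp at hN ⊢; omega)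
    rw [map_mul, cable_mul_of_carries c, cable_mul_of_carries hl1, map_mul, hA l hl hN hM hm',
      hB l1 hl1.1 c.1 (by simp at hM ⊢; omega) (by omega)]
  | inv A hA =>
    obtain ⟨l1, hl1⟩ := Carries.exists A⁻¹ l hl
    have k1 := key hl1
    have c := Carries.shift hl1 P Q h (by have := hl1.1; simp at hN ⊢; omega)
    have i1 := hA l1 hl1.1 c.1 (by simp at hM ⊢; omega) (by omega)
    rw [map_inv] at c ⊢
    rw [cable_inv, comp_perm_of_carries c, i1, cable_inv, comp_perm_of_carries hl1, map_inv]

end carries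
section equivariance

variable {n m N : ℕ}

theorem braidComp_arity (h : N + 1 = n + m) (a : Fin n) : (a : ℕ) + m ≤ N := by omega

theorem single_comp_perm (a : Fin n) (m : ℕ) (s : Equiv.Perm (Fin n)) :
    single a m ∘ s = single (s.symm a) m := by
  funext j
  simp [single, Equiv.eq_symm_apply]

theorem ofFn_single (a : Fin n) (m : ℕ) :
    List.ofFn (single a m) =
      List.replicate a 1 ++ m :: List.replicate (n - a - 1) 1 := by
  apply List.ext_getElem?
  intro j
  by_cases hj : j < n
  · rw [List.getElem?_ofFn, dif_pos hj]
    simp only [single, Fin.ext_iff]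
    rcases lt_trichotomy j a with h | h | h
    · rw [if_neg (by omega), List.getElem?_append_left (by simpa using h)]
      simp [h]
    · simp [h]
    · rw [if_neg (by omega)]
      obtain ⟨d, rfl⟩ : ∃ d, j = a + (d + 1) := ⟨j - (a + 1), by omega⟩
      have : d < n - a - 1 := by omega
      rw [List.getElem?_append_right (by simp)]
      simp [this]
  · rw [List.getElem?_eq_none (by simpa using hj), List.getElem?_eq_none (by simp; omega)]

theorem shift_of {o : ℕ} (h : o + m ≤ N) (D : Braid m) (x : Braid N) (o' : ℕ) (h' : o' + m ≤ N)
    (hx : ∀ i, i + 1 < m → x * gen N (o' + i) = gen N (o + i) * x) :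
    x * shift o' h' D = shift o h D * x := by
  induction D using Braid.induction with
  | one => simp
  | of i hi => rw [shift_gen h hi, shift_gen h' hi, hx i hi]
  | mul A B hA hB => rw [map_mul, map_mul, ← mul_assoc, hA, mul_assoc, hB, mul_assoc]
  | inv A hA =>
    rw [map_inv, map_inv, mul_inv_eq_iff_eq_mul, mul_assoc, hA, inv_mul_cancel_left]

/-- A braid can be moved along the strand it replaces. -/
theorem cable_shift_comm (h : N + 1 = n + m) (a : Fin n) (A : Braid n) (D : Braid m) :
    cable N (single a m) A * shift ((perm A).symm a : ℕ) (braidComp_arity h _) D =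
      shift (a : ℕ) (braidComp_arity h a) D * cable N (single a m) A := by
  induction A using Braid.induction generalizing a with
  | one => rw [cable_one, one_mul, mul_one]; rfl
  | of j hj =>
    have hsym : (perm (gen n j)).symm a = adj n j a := by
      rw [perm_gen hj, Equiv.symm_apply_eq]
      apply Fin.ext
      rw [adj_val hj, adj_val hj]
      split_ifs <;> omega
    have hval := adj_val hj a
    rw [← hsym] at hval
    have hR : ∀ c d : ℕ, (List.replicate c 1 ++ m :: List.replicate d 1).sum = c + m + d := by
      intro c d; simp [add_assoc]
    have hs := ofFn_single a m
    have ha := a.isLt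
    refine shift_of _ _ _ _ _ fun i hi => ?_
    rcases lt_trichotomy j (a : ℕ) with h1 | h1 | h1
    · rcases Nat.lt_or_ge (j + 1) (a : ℕ) with h2 | h2
      · have e : List.ofFn (single a m) = List.replicate j 1 ++ 1 :: 1 ::
            (List.replicate (a - j - 2) 1 ++ m :: List.replicate (n - a - 1) 1) := by
          rw [hs]
          conv_lhs => rw [show (a : ℕ) = j + ((a - j - 2) + 1 + 1) by omega]
          rw [List.replicate_add, List.replicate_succ, List.replicate_succ]
          simp
          omega
        have c := cable_gen_eq (N := N) _ _ _ _ _ e (by simp; omega)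
        simp only [List.length_replicate, List.sum_replicate, smul_eq_mul, mul_one] at c
        rw [c]
        rw [if_neg (by omega), if_neg (by omega)] at hval
        rw [hval]
        exact blockCross_gen_far _ _ _ _ (by omega)
      · have h3 : (a : ℕ) = j + 1 := by omega
        have e : List.ofFn (single a m) = List.replicate j 1 ++ 1 :: m ::
            List.replicate (n - a - 1) 1 := by
          rw [hs, h3, List.replicate_succ']
          simp
        have c := cable_gen_eq (N := N) _ _ _ _ _ e (by simp; omega)
        simp only [List.length_replicate, List.sum_replicate, smul_eq_mul, mul_one] at c
        rw [c]
        rw [if_neg (by omega), if_pos h3] at hval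
        rw [hval, h3, show j + 1 + i = j + i + 1 by omega]
        exact blockCross_gen_left _ _ _ _ (by omega) (by omega) (by omega)
    · have e : List.ofFn (single a m) = List.replicate j 1 ++ m :: 1 ::
          List.replicate (n - a - 2) 1 := by
        rw [hs, h1, show n - (a : ℕ) - 1 = (n - a - 2) + 1 by omega, List.replicate_succ]
      have c := cable_gen_eq (N := N) _ _ _ _ _ e (by simp; omega)
      simp only [List.length_replicate, List.sum_replicate, smul_eq_mul, mul_one] at c
      rw [c]
      rw [if_pos h1.symm] at hval
      rw [hval, ← h1, show j + 1 + i = j + i + 1 by omega]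
      exact blockCross_gen_right _ _ _ _ (by omega) (by omega) (by omega)
    · have e : List.ofFn (single a m) = (List.replicate a 1 ++ m :: List.replicate (j - a - 1) 1) ++
          1 :: 1 :: List.replicate (n - j - 2) 1 := by
        rw [hs, show n - (a : ℕ) - 1 = (j - a - 1) + ((n - j - 2) + 1 + 1) by omega,
          List.replicate_add, List.replicate_succ, List.replicate_succ]
        simp
      have c := cable_gen_eq (N := N) _ _ _ _ _ e (by simp; omega)
      have hj' : (List.replicate (a : ℕ) 1 ++ m :: List.replicate (j - a - 1) 1).length = j := by
        simp; omega
      rw [hR, hj'] at c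
      rw [c]
      rw [if_neg (by omega), if_neg (by omega)] at hval
      rw [hval]
      exact blockCross_gen_far _ _ _ _ (by omega)
  | mul A B hA hB =>
    have e : (perm (A * B)).symm a = (perm B).symm ((perm A).symm a) := by
      rw [map_mul]; rfl
    rw [cable_mul, single_comp_perm, mul_assoc]
    simp only [e]
    rw [hB, ← mul_assoc, hA, mul_assoc]
  | inv A hA =>
    have e : (perm A⁻¹).symm a = perm A a := by
      rw [map_inv]; rfl
    have e2 : (perm A).symm (perm A a) = a := by simp
    have := hA (perm A a)
    simp only [e2] at this
    rw [cable_inv, single_comp_perm]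
    simp only [e]
    rw [inv_mul_eq_iff_eq_mul, ← mul_assoc, this, mul_inv_cancel_right]

/-- Equivariance of the partial compositions in the braid operad. -/
theorem braidComp_mul (h : N + 1 = n + m) (a : Fin n) (A B : Braid n) (C D : Braid m) :
    braidComp h a (A * B) (C * D) =
      braidComp h a A C * braidComp h ((perm A).symm a) B D := by
  have := cable_shift_comm h a A D
  simp only [braidComp]
  rw [map_mul, cable_mul, single_comp_perm, mul_assoc, mul_assoc,
    ← mul_assoc (cable N (single a m) A), this, mul_assoc]

theorem braidComp_one (h : N + 1 = n + m) (a : Fin n) :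
    braidComp h a (1 : Braid n) (1 : Braid m) = 1 := by
  simp [braidComp, cable_one]

theorem braidComp_inv (h : N + 1 = n + m) (a : Fin n) (A : Braid n) (C : Braid m) :
    braidComp h ((perm A).symm a) A⁻¹ C⁻¹ = (braidComp h a A C)⁻¹ := by
  refine eq_inv_of_mul_eq_one_right ?_
  rw [← braidComp_mul, mul_inv_cancel, mul_inv_cancel, braidComp_one]

end equivariance
/-! ### Parenthesized words -/

/-- Parenthesized words in variables from `α` and a constant `x₀`: the elements of the free magma
with a distinguished constant. -/
inductive Term (α : Type) : Type
  | x0 : Term α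
  | var : α → Term α
  | nu : Term α → Term α → Term α

namespace Term

variable {α β : Type}

/-- Substitution of words for the variables. -/
def bind (f : α → Term β) : Term α → Term β
  | x0 => x0
  | var a => f a
  | nu p q => nu (p.bind f) (q.bind f)

/-- Renaming of the variables. -/
def rename (f : α → β) (p : Term α) : Term β := p.bind fun a => var (f a)

/-- The characters of a word from left to right, `none` standing for `x₀`. -/
def chars : Term α → List (Option α)
  | x0 => [none]
  | var a => [some a]
  | nu p q => p.chars ++ q.chars

/-- The variables occurring in a word, from left to right. -/
def vars (p : Term α) : List α := p.chars.reduceOption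

theorem chars_bind (f : α → Term β) (p : Term α) :
    (p.bind f).chars = p.chars.flatMap fun c => c.elim [none] fun a => (f a).chars := by
  induction p with
  | x0 => rfl
  | var a => simp [bind, chars]
  | nu p q hp hq => simp [bind, chars, hp, hq]

theorem vars_bind (f : α → Term β) (p : Term α) :
    (p.bind f).vars = p.vars.flatMap fun a => (f a).vars := by
  induction p with
  | x0 => rfl
  | var a => simp [bind, vars, chars, List.reduceOption]
  | nu p q hp hq =>
    simp only [bind, vars, chars, List.reduceOption_append, List.flatMap_append] at *
    rw [hp, hq]

theorem vars_rename (f : α → β) (p : Term α) : (p.rename f).vars = p.vars.map f := by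
  rw [rename, vars_bind, List.map_eq_flatMap]
  rfl

theorem chars_rename (f : α → β) (p : Term α) :
    (p.rename f).chars = p.chars.map (Option.map f) := by
  rw [rename, chars_bind, List.map_eq_flatMap]
  congr 1
  funext c
  cases c <;> rfl

end Term

/-- The `n`-ary operations of the free symmetric operad on a binary operation `ν` and a nullary
operation `x₀`: the parenthesized words in `x₀` and the variables `x₁, …, xₙ` (numbered from `0`
here) in which each variable occurs exactly once. -/
structure Word (n : ℕ) : Type where
  term : Term (Fin n)
  nodup : term.vars.Nodup
  mem : ∀ a, a ∈ term.vars

/-- The variable `xⱼ` of the outer word after something of arity `m` has been substituted for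
`xᵢ` (`none` for `xᵢ` itself): variables after `xᵢ` are shifted by `m - 1`. -/
def slot {n m N : ℕ} (h : N + 1 = n + m) (i j : Fin n) : Option (Fin N) :=
  if hlt : j < i then some ⟨j, by omega⟩
  else if hgt : i < j then some ⟨j + m - 1, by omega⟩
  else none

/-- The variable `xₖ` of the inner word after its substitution for `xᵢ`. -/
def inner {n m N : ℕ} (h : N + 1 = n + m) (i : Fin n) (k : Fin m) : Fin N :=
  ⟨i + k, by omega⟩

/-- `p ∘ᵢ q`: the word `q` is substituted for the `i`-th variable of `p`. -/
def Term.comp {n m N : ℕ} (h : N + 1 = n + m) (i : Fin n) (p : Term (Fin n)) (q : Term (Fin m)) :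
    Term (Fin N) :=
  p.bind fun j => (slot h i j).elim (q.rename (inner h i)) Term.var

section slot

variable {n m N : ℕ} (h : N + 1 = n + m) (i : Fin n)

theorem slot_self : slot h i i = none := by simp [slot]

theorem slot_eq_none {j : Fin n} : slot h i j = none ↔ j = i := by
  constructor
  · intro hj
    unfold slot at hj
    split_ifs at hj
    omega
  · rintro rfl; exact slot_self h _

theorem slot_inj {j k : Fin n} {b : Fin N} (hj : slot h i j = some b) (hk : slot h i k = some b) :
    j = k := by
  unfold slot at hj hk
  split_ifs at hj hk <;> simp only [Option.some.injEq, Fin.ext_iff] at hj hk <;> omega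

theorem slot_ne_inner {j : Fin n} {k : Fin m} : slot h i j ≠ some (inner h i k) := by
  intro hj
  unfold slot inner at hj
  split_ifs at hj <;> simp only [Option.some.injEq, Fin.ext_iff] at hj <;> omega

theorem slot_surj (b : Fin N) : (∃ k, inner h i k = b) ∨ ∃ j, slot h i j = some b := by
  rcases lt_or_ge (b : ℕ) i with h1 | h1
  · refine Or.inr ⟨⟨b, by omega⟩, ?_⟩
    rw [slot, dif_pos (by exact h1)]
  · rcases lt_or_ge (b : ℕ) (i + m) with h2 | h2
    · exact Or.inl ⟨⟨b - i, by omega⟩, Fin.ext (by simp [inner]; omega)⟩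
    · refine Or.inr ⟨⟨b + 1 - m, by omega⟩, ?_⟩
      have h3 : ¬ (⟨b + 1 - m, by omega⟩ : Fin n) < i := by
        simp only [Fin.lt_def]; omega
      have h4 : i < (⟨b + 1 - m, by omega⟩ : Fin n) := by
        simp only [Fin.lt_def]; omega
      rw [slot, dif_neg h3, dif_pos h4]
      simp only [Option.some.injEq, Fin.ext_iff]
      omega

/-- The block of variables replacing `xⱼ`. -/
def blockVars (l : List (Fin m)) (j : Fin n) : List (Fin N) :=
  (slot h i j).elim (l.map (inner h i)) fun b => [b]

theorem vars_comp (p : Term (Fin n)) (q : Term (Fin m)) :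
    (p.comp h i q).vars = p.vars.flatMap (blockVars h i q.vars) := by
  rw [Term.comp, Term.vars_bind]
  congr 1
  funext j
  unfold blockVars
  cases slot h i j with
  | none => exact Term.vars_rename _ _
  | some b => rfl

end slot

namespace Word

variable {n m N : ℕ}

/-- The partial composition `p ∘ᵢ q`. -/
def comp (h : N + 1 = n + m) (i : Fin n) (p : Word n) (q : Word m) : Word N where
  term := p.term.comp h i q.term
  nodup := by
    have hinj : Function.Injective (inner h i) := fun a b hab => by
      simp only [inner, Fin.ext_iff] at hab ⊢; omega
    rw [vars_comp, List.nodup_flatMap]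
    refine ⟨fun j _ => ?_, p.nodup.imp fun {j k} hjk => ?_⟩
    · unfold blockVars
      cases slot h i j with
      | none => exact q.nodup.map hinj
      | some b => simp
    · simp only [Function.onFun, List.disjoint_left, blockVars]
      intro b hb hb'
      cases ej : slot h i j with
      | none =>
        cases ek : slot h i k with
        | none => exact hjk (((slot_eq_none h i).1 ej).trans ((slot_eq_none h i).1 ek).symm)
        | some d =>
          simp only [ej, ek, Option.elim, List.mem_map, List.mem_singleton] at hb hb'
          obtain ⟨c, -, rfl⟩ := hb
          subst hb'
          exact slot_ne_inner h i ek
      | some d =>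
        cases ek : slot h i k with
        | none =>
          simp only [ej, ek, Option.elim, List.mem_map, List.mem_singleton] at hb hb'
          obtain ⟨c, -, rfl⟩ := hb'
          subst hb
          exact slot_ne_inner h i ej
        | some d' =>
          simp only [ej, ek, Option.elim, List.mem_singleton] at hb hb'
          subst hb hb'
          exact hjk (slot_inj h i ej ek)
  mem b := by
    rw [vars_comp, List.mem_flatMap]
    rcases slot_surj h i b with ⟨k, rfl⟩ | ⟨j, hj⟩
    · exact ⟨i, p.mem i, by simp [blockVars, slot_self, q.mem]⟩
    · exact ⟨j, p.mem j, by simp [blockVars, hj]⟩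

/-- The action of the symmetric group by renaming `xⱼ` to `x_{σ j}`. -/
def act (σ : Equiv.Perm (Fin n)) (p : Word n) : Word n where
  term := p.term.rename σ
  nodup := by rw [Term.vars_rename]; exact p.nodup.map σ.injective
  mem a := by
    rw [Term.vars_rename, List.mem_map]
    exact ⟨σ.symm a, p.mem _, by simp⟩

/-- The operadic unit `x₁`. -/
def one : Word 1 := ⟨.var 0, by simp [Term.vars, Term.chars, List.reduceOption], fun a => by
  simp [Term.vars, Term.chars, List.reduceOption, Subsingleton.elim a 0]⟩

theorem length_vars (p : Word n) : p.term.vars.length = n := by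
  have := List.toFinset_card_of_nodup p.nodup
  rw [← this, Finset.eq_univ_of_forall (s := p.term.vars.toFinset)
    (fun a => List.mem_toFinset.2 (p.mem a)), Finset.card_univ, Fintype.card_fin]

/-- The underlying permutation `τ(p)`: the `k`-th variable of the word `p` (constants `x₀` being
ignored) is `x_{τ(p) k}`. -/
def tau (p : Word n) : Equiv.Perm (Fin n) :=
  (finCongr p.length_vars.symm).trans (p.nodup.getEquivOfForallMemList _ p.mem)

theorem tau_apply (p : Word n) (k : Fin n) : p.term.vars[(k : ℕ)]? = some (p.tau k) := by
  have : (k : ℕ) < p.term.vars.length := by rw [p.length_vars]; exact k.isLt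
  rw [List.getElem?_eq_getElem this]
  rfl

theorem ofFn_tau (p : Word n) : List.ofFn p.tau = p.term.vars := by
  apply List.ext_getElem?
  intro j
  by_cases hj : j < n
  · rw [p.tau_apply ⟨j, hj⟩]; simp [hj]
  · rw [List.getElem?_eq_none (by simpa using hj),
      List.getElem?_eq_none (by rw [p.length_vars]; omega)]

theorem tau_act (σ : Equiv.Perm (Fin n)) (p : Word n) : (p.act σ).tau = σ * p.tau := by
  ext k
  have h1 := (p.act σ).tau_apply k
  rw [act, Term.vars_rename, List.getElem?_map, p.tau_apply k] at h1
  exact (congrArg Fin.val (Option.some.inj h1)).symm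

end Word

/-! ### The groupoids `CoB(n)` and `wCoB(n)` of coloured braids -/

/-- Morphisms `u ⟶ v` in the action groupoid `CoB(n) = Σₙ // Bₙ`, where `g • u = u * (perm g)⁻¹`:
the set `p_*⁻¹(v⁻¹ u)`. -/
@[ext]
structure CoBHom {n : ℕ} (u v : Equiv.Perm (Fin n)) : Type where
  braid : Braid n
  perm_eq : perm braid = v⁻¹ * u

/-- Morphisms `(u, A) ⟶ (v, C)` in the action groupoid `wCoB(n) = (Σₙ × Bₙ) // Bₙ`, where
`g • (u, A) = (u * (perm g)⁻¹, g * A)`: the set `p_*⁻¹(v⁻¹ u) ∩ {C A⁻¹}`. -/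
@[ext]
structure wCoBHom {n : ℕ} (x y : Equiv.Perm (Fin n) × Braid n) : Type where
  braid : Braid n
  perm_eq : perm braid = y.1⁻¹ * x.1
  braid_eq : braid = y.2 * x.2⁻¹

/-! ### The groupoids `PaB(n)` -/

/-- The groupoid `PaB(n)` of parenthesized braids: its objects are the words, and its morphisms
are pulled back from `CoB(n)` along `τ`. -/
instance pab (n : ℕ) : Groupoid (Word n) where
  Hom p q := CoBHom p.tau q.tau
  id p := ⟨1, by simp⟩
  comp {p q r} f g := ⟨g.braid * f.braid, by rw [map_mul, f.perm_eq, g.perm_eq]; group⟩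
  inv {p q} f := ⟨f.braid⁻¹, by rw [map_inv, f.perm_eq]; group⟩
  id_comp f := CoBHom.ext (mul_one _)
  comp_id f := CoBHom.ext (one_mul _)
  assoc f g h := CoBHom.ext (mul_assoc _ _ _).symm
  inv_comp f := CoBHom.ext (mul_inv_cancel _)
  comp_inv f := CoBHom.ext (inv_mul_cancel _)

theorem carries_iff {n : ℕ} {p q : Word n} {g : Braid n} :
    perm g = q.tau⁻¹ * p.tau ↔ Carries g p.term.vars q.term.vars := by
  constructor
  · intro hg
    refine ⟨p.length_vars, q.length_vars, fun k => ?_⟩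
    rw [p.tau_apply, q.tau_apply, hg]
    simp
  · rintro ⟨-, -, h⟩
    ext k
    have := h k
    rw [p.tau_apply, q.tau_apply] at this
    rw [Equiv.Perm.mul_apply, ← Option.some.inj this]
    simp

theorem Word.symm_tau_eq {n : ℕ} {p q : Word n} {g : Braid n} (hg : perm g = q.tau⁻¹ * p.tau)
    (i : Fin n) : (perm g).symm (q.tau.symm i) = p.tau.symm i := by
  rw [Equiv.symm_apply_eq, hg]
  simp

theorem vars_comp_eq {n m N : ℕ} (h : N + 1 = n + m) (i : Fin n) (p : Word n) :
    ∃ P Q : List (Fin N), P.length = (p.tau.symm i : ℕ) ∧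
      ∀ l : List (Fin m), p.term.vars.flatMap (blockVars h i l) =
        P ++ l.map (inner h i) ++ Q := by
  have h1 := p.tau_apply (p.tau.symm i)
  rw [Equiv.apply_symm_apply] at h1
  obtain ⟨hlt, h2⟩ := List.getElem?_eq_some_iff.1 h1
  set a := ((p.tau.symm i : Fin n) : ℕ)
  have hv : p.term.vars = p.term.vars.take a ++ i :: p.term.vars.drop (a + 1) := by
    conv_lhs => rw [← List.take_append_drop a p.term.vars, List.drop_eq_getElem_cons hlt, h2]
  have hnd := p.nodup
  rw [hv, List.nodup_append, List.nodup_cons] at hnd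
  have key : ∀ (L : List (Fin n)), i ∉ L → ∀ l', L.flatMap (blockVars h i l') =
      L.flatMap (blockVars h i []) := by
    intro L hL l'
    refine List.flatMap_congr fun j hj => ?_
    cases e : slot h i j with
    | none => exact absurd ((slot_eq_none h i).1 e ▸ hj) hL
    | some b => simp [blockVars, e]
  have k1 : i ∉ p.term.vars.take a := fun hi => hnd.2.2 i hi i (by simp) rfl
  have k2 : i ∉ p.term.vars.drop (a + 1) := hnd.2.1.1
  have key2 : ∀ l', p.term.vars.flatMap (blockVars h i l') =
      (p.term.vars.take a).flatMap (blockVars h i []) ++ l'.map (inner h i) ++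
        (p.term.vars.drop (a + 1)).flatMap (blockVars h i []) := by
    intro l'
    conv_lhs => rw [hv]
    rw [List.flatMap_append, List.flatMap_cons, key _ k1, key _ k2]
    simp [blockVars, slot_self]
  refine ⟨_, _, ?_, key2⟩
  rw [List.length_flatMap]
  have : ∀ x ∈ (p.term.vars.take a).map fun j => (blockVars h i [] j).length, x = 1 := by
    intro x hx
    obtain ⟨j, hj, rfl⟩ := List.mem_map.1 hx
    cases e : slot h i j with
    | none => exact absurd ((slot_eq_none h i).1 e ▸ hj) k1
    | some b => simp [blockVars, e]
  rw [List.eq_replicate_of_mem this]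
  simp
  omega

/-- Partial composites of morphisms of `PaB` are morphisms of `PaB`. -/
theorem perm_braidComp {n m N : ℕ} (h : N + 1 = n + m) (i : Fin n) {p q : Word n} {p' q' : Word m}
    {g : Braid n} {g' : Braid m} (hg : perm g = q.tau⁻¹ * p.tau)
    (hg' : perm g' = q'.tau⁻¹ * p'.tau) :
    perm (braidComp h (q.tau.symm i) g g') =
      (q.comp h i q').tau⁻¹ * (p.comp h i p').tau := by
  rw [carries_iff]
  have c' := carries_iff.1 hg'
  obtain ⟨P, Q, hP, hPQ⟩ := vars_comp_eq (m := m) h i q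
  have e : ∀ (r : Word n) (l : List (Fin m)),
      (List.ofFn (blockVars h i l ∘ r.tau)).flatten = r.term.vars.flatMap (blockVars h i l) := by
    intro r l
    rw [ofFn_comp, r.ofFn_tau, List.flatMap_def]
  have hsingle : List.length ∘ (blockVars h i p'.term.vars ∘ q.tau) =
      single (q.tau.symm i) m := by
    funext j
    simp only [Function.comp, single, blockVars, Equiv.eq_symm_apply]
    split_ifs with hj
    · rw [hj, slot_self]; simp [p'.length_vars]
    · cases e : slot h i (q.tau j) with
      | none => exact absurd ((slot_eq_none h i).1 e) hj
      | some b => rfl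
  have hsum : ∑ j, ((blockVars h i p'.term.vars ∘ q.tau) j).length = N := by
    have := (q.comp h i p').length_vars
    rw [Word.comp, vars_comp, ← e, List.length_flatten, ← ofFn_comp, List.sum_ofFn] at this
    exact this
  have c1 := Carries.cable g (blockVars h i p'.term.vars ∘ q.tau) hsum
  have hperm : (blockVars h i p'.term.vars ∘ q.tau) ∘ perm g =
      blockVars h i p'.term.vars ∘ p.tau := by
    funext j; simp [hg]
  rw [hsingle, hperm, e, e] at c1
  have c2 := Carries.shift (N := N) (l := p'.term.vars.map (inner h i))
    (l' := q'.term.vars.map (inner h i)) (C := g')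
    ⟨by simp [p'.length_vars], by simp [q'.length_vars], fun k => by
      rw [List.getElem?_map, List.getElem?_map, c'.2.2]⟩ P Q
    (by rw [hP]; exact braidComp_arity h _) (by rw [← hPQ]; exact c1.2.1)
  rw [← hPQ, ← hPQ] at c2
  have c3 := c2.mul c1
  simp only [hP] at c3
  rw [Word.comp, Word.comp, vars_comp, vars_comp]
  exact c3
/-! ### The groupoids `wPaB(n)` -/

/-- The set `Ω_Br(n)` of parenthesized coloured braids: words `p` of length `len(p)`, all
characters `x₀` being counted, with a braid on `len(p)` strands, whose output positions are
coloured by the characters of `p`. -/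
structure BWord (n : ℕ) : Type where
  word : Word n
  len : ℕ
  length_eq : word.term.chars.length = len
  braid : Braid len

namespace BWord

variable {n m N : ℕ}

/-- `0` for the constant `x₀`, `1` for a variable. -/
def charSize {α : Type} (c : Option α) : ℕ := c.elim 0 fun _ => 1

/-- The underlying coloured braid `π(p, A) = (τ(p), ∘[A; δ₁, …, δ_{len(p)}])`: all strands
coloured by `x₀` are removed from `A`. -/
def underlying (x : BWord n) : Equiv.Perm (Fin n) × Braid n :=
  (x.word.tau, cable n (fn x.len (x.word.term.chars.map charSize)) x.braid)

theorem some_mem_chars (x : BWord n) (i : Fin n) : some i ∈ x.word.term.chars :=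
  List.reduceOption_mem_iff.1 (x.word.mem i)

/-- The position `t_p⁻¹(i)` of the character `xᵢ` in the word `p`. -/
def pos (x : BWord n) (i : Fin n) : Fin x.len :=
  ⟨x.word.term.chars.idxOf (some i), by
    rw [← x.length_eq]; exact List.idxOf_lt_length_of_mem (x.some_mem_chars i)⟩

theorem chars_comp_map (h : N + 1 = n + m) (i : Fin n) (p : Term (Fin n))
    (q : Term (Fin m)) :
    (p.comp h i q).chars.map charSize =
      p.chars.flatMap fun c => if c = some i then q.chars.map charSize else [charSize c] := by
  rw [Term.comp, Term.chars_bind, List.map_flatMap]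
  refine List.flatMap_congr fun c _ => ?_
  cases c with
  | none => simp [charSize]
  | some j =>
    cases e : slot h i j with
    | none =>
      rw [(slot_eq_none h i).1 e]
      simp only [Option.elim, slot_self, if_true, Term.chars_rename, List.map_map]
      refine List.map_congr_left fun c _ => ?_
      cases c <;> rfl
    | some b =>
      have hj : j ≠ i := fun hj => by rw [(slot_eq_none h i).2 hj] at e; cases e
      simp [e, hj, Term.chars, charSize]

theorem sum_charSize {α : Type} (l : List (Option α)) :
    (l.map charSize).sum = l.reduceOption.length := by
  induction l with
  | nil => rfl
  | cons c l ih => cases c <;> simp [charSize, ih, List.reduceOption_cons_of_none,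
      List.reduceOption_cons_of_some, add_comm]

theorem sum_chars (x : BWord n) : (x.word.term.chars.map charSize).sum = n := by
  rw [sum_charSize]; exact x.word.length_vars

theorem exists_chars (x : BWord n) (i : Fin n) :
    ∃ P Q : List (Option (Fin n)), x.word.term.chars = P ++ some i :: Q ∧
      some i ∉ P ∧ some i ∉ Q ∧ P.length = x.pos i ∧
      (P.map charSize).sum = (x.word.tau.symm i : ℕ) := by
  obtain ⟨P, Q, hPQ, hP⟩ : ∃ P Q, x.word.term.chars = P ++ some i :: Q ∧ some i ∉ P := by
    obtain ⟨P, Q, h1, h2⟩ := List.append_of_mem (x.some_mem_chars i) |> fun ⟨s, t, hst⟩ =>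
      List.eq_append_cons_of_mem (x.some_mem_chars i)
    exact ⟨P, Q, h1, h2⟩
  have hv : x.word.term.vars = P.reduceOption ++ i :: Q.reduceOption := by
    rw [Term.vars, hPQ, List.reduceOption_append, List.reduceOption_cons_of_some]
  have hnd := x.word.nodup
  rw [hv, List.nodup_append, List.nodup_cons] at hnd
  refine ⟨P, Q, hPQ, hP, fun hi => hnd.2.1.1 (List.reduceOption_mem_iff.2 hi), ?_, ?_⟩
  · simp only [pos, hPQ]
    rw [List.idxOf_append_of_notMem hP]
    simp
  · rw [sum_charSize]
    have h1 := x.word.tau_apply (x.word.tau.symm i)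
    rw [Equiv.apply_symm_apply, hv] at h1
    have h2 : (P.reduceOption ++ i :: Q.reduceOption)[P.reduceOption.length]? = some i := by simp
    have hnd' := x.word.nodup
    rw [hv] at hnd'
    exact (List.getElem?_inj (i := P.reduceOption.length) (by simp) hnd').1 (h2.trans h1.symm)

theorem pos_arity (x : BWord n) (y : BWord m) (i : Fin n) :
    (x.len + y.len - 1) + 1 = x.len + y.len := by
  have := (x.pos i).isLt; omega

/-- The partial composition `(p, A) ∘ᵢ (q, C) = (p ∘ᵢ q, A ∘_{t_p⁻¹(i)} C)`. -/
def comp (h : N + 1 = n + m) (i : Fin n) (x : BWord n) (y : BWord m) : BWord N where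
  word := x.word.comp h i y.word
  len := x.len + y.len - 1
  length_eq := by
    have h1 := congrArg List.length (chars_comp_map h i x.word.term y.word.term)
    obtain ⟨P, Q, hPQ, hP, hQ, -, -⟩ := x.exists_chars i
    have key : ∀ L : List (Option (Fin n)), some i ∉ L →
        (L.flatMap fun c => if c = some i then y.word.term.chars.map charSize
          else [charSize c]) = L.map charSize := by
      intro L hL
      rw [List.map_eq_flatMap (l := L)]
      exact List.flatMap_congr fun c hc => if_neg fun (e : c = some i) => hL (e ▸ hc)
    have h2 := x.length_eq
    rw [hPQ, List.flatMap_append, List.flatMap_cons, key P hP, key Q hQ, if_pos rfl] at h1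
    rw [hPQ] at h2
    have h3 := y.length_eq
    simp only [List.length_map, List.length_append, List.length_cons] at h1 h2
    rw [Word.comp, h1]
    omega
  braid := braidComp (x.pos_arity y i) (x.pos i) x.braid y.braid

/-- `σ (p, A) = (σ p, A)`. -/
def act (σ : Equiv.Perm (Fin n)) (x : BWord n) : BWord n where
  word := x.word.act σ
  len := x.len
  length_eq := by rw [Word.act, Term.chars_rename, List.length_map, x.length_eq]
  braid := x.braid

/-- The operadic unit `(x₁, id₁)`. -/
def one : BWord 1 := ⟨Word.one, 1, rfl, 1⟩

theorem underlying_act (σ : Equiv.Perm (Fin n)) (x : BWord n) :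
    (x.act σ).underlying = (σ * x.word.tau, x.underlying.2) := by
  refine Prod.ext (Word.tau_act σ x.word) ?_
  simp only [underlying, act, Word.act, Term.chars_rename, List.map_map]
  congr 2
  refine List.map_congr_left fun c _ => ?_
  cases c <;> rfl

theorem single_eq {k : ℕ} (a : Fin k) (m : ℕ) (l : List ℕ) (P Q : List ℕ) (hl : l.length = k)
    (e : l = P ++ m :: Q) (hP : ∀ x ∈ P, x = 1) (hQ : ∀ x ∈ Q, x = 1) (ha : P.length = a) :
    fn k l = single a m := by
  apply List.ofFn_injective
  rw [ofFn_fn _ hl, ofFn_single, e]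
  have h2 : Q.length = k - a - 1 := by
    have := congrArg List.length e
    simp only [List.length_append, List.length_cons] at this
    omega
  rw [List.eq_replicate_of_mem hP, List.eq_replicate_of_mem hQ, ha, h2]

theorem shift_congr {m N o o' : ℕ} (e : o = o') (h : o + m ≤ N) (h' : o' + m ≤ N) (C : Braid m) :
    shift o h C = shift o' h' C := by
  subst e; rfl

/-- Removing the strands coloured by `x₀` is compatible with partial composition. -/
theorem underlying_comp (h : N + 1 = n + m) (i : Fin n) (x : BWord n) (y : BWord m) :
    (x.comp h i y).underlying.2 =
      braidComp h (x.word.tau.symm i) x.underlying.2 y.underlying.2 := by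
  obtain ⟨P, Q, hPQ, hP, hQ, hpos, htau⟩ := x.exists_chars i
  have hL := x.length_eq
  set Ly := y.word.term.chars.map charSize with hLy
  have hLyl : Ly.length = y.len := by simp [hLy, y.length_eq]
  have hLys : Ly.sum = m := y.sum_chars
  obtain ⟨v, hv⟩ : ∃ v : Fin x.len → Option (Fin n), List.ofFn v = x.word.term.chars := by
    rw [← hL]; exact ⟨x.word.term.chars.get, List.ofFn_get _⟩
  have hxlen : P.length + (Q.length + 1) = x.len := by rw [← hL, hPQ]; simp
  let G : List ℕ → Option (Fin n) → List ℕ := fun l c => if c = some i then l else [charSize c]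
  have hG : ∀ l, ∀ L : List (Option (Fin n)), some i ∉ L → L.map (G l) = L.map fun c =>
      [charSize c] := fun l L hL => List.map_congr_left fun c hc => if_neg fun (e : c = some i) => hL (e ▸ hc)
  have hGi : ∀ l, G l (some i) = l := fun l => if_pos rfl
  have hw : ∀ l, List.ofFn (G l ∘ v) =
      (P.map fun c => [charSize c]) ++ l :: (Q.map fun c => [charSize c]) := by
    intro l
    rw [ofFn_comp, hv, hPQ, List.map_append, List.map_cons, hG l P hP, hG l Q hQ, hGi]
  have hflat : ∀ l, (List.ofFn (G l ∘ v)).flatten = P.map charSize ++ l ++ Q.map charSize := by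
    intro l
    rw [hw, List.flatten_append, List.flatten_cons, ← List.flatMap_def, ← List.flatMap_def,
      ← List.map_eq_flatMap, ← List.map_eq_flatMap, List.append_assoc]
  have hchars : (x.comp h i y).word.term.chars.map charSize =
      P.map charSize ++ Ly ++ Q.map charSize := by
    rw [← hflat, ofFn_comp, hv, ← List.flatMap_def]
    exact chars_comp_map h i x.word.term y.word.term
  have hsumPQ : (P.map charSize).sum + (Q.map charSize).sum + 1 = n := by
    have := x.sum_chars
    rw [hPQ] at this
    simp only [List.map_append, List.map_cons, List.sum_append, List.sum_cons] at this
    have e : charSize (some i) = 1 := rfl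
    omega
  have hlen : ∀ l : List ℕ, List.length ∘ (G l ∘ v) = single (x.pos i) l.length := by
    intro l
    rw [← fn_ofFn (List.length ∘ (G l ∘ v))]
    refine single_eq _ _ _ (P.map fun _ => 1) (Q.map fun _ => 1) (by simp) ?_ (by simp) (by simp)
      (by simpa using hpos)
    rw [ofFn_comp, hw, List.map_append, List.map_cons, List.map_map, List.map_map]
    rfl
  have hsum : ∀ l : List ℕ, List.sum ∘ (G l ∘ v) =
      fun j => if v j = some i then l.sum else charSize (v j) := by
    intro l
    funext j
    simp only [Function.comp, G]
    split_ifs <;> simp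
  have hT : ∀ l : List ℕ, l.length = y.len → ∑ j, ((G l ∘ v) j).length = x.len + y.len - 1 := by
    intro l hl
    have : ∑ j, ((G l ∘ v) j).length = (List.ofFn (G l ∘ v)).flatten.length := by
      rw [List.length_flatten, ← ofFn_comp, List.sum_ofFn]; rfl
    rw [this, hflat]
    simp
    omega
  have hS : ∀ l : List ℕ, l.sum = m → ∑ j, ((G l ∘ v) j).sum = N := by
    intro l hl
    have : ∑ j, ((G l ∘ v) j).sum = (List.ofFn (G l ∘ v)).flatten.sum := by
      rw [List.sum_flatten, ← ofFn_comp, List.sum_ofFn]; rfl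
    rw [this, hflat]
    simp only [List.sum_append]
    omega
  obtain ⟨l0, hl0⟩ := Carries.exists y.braid Ly hLyl
  have hl0s : l0.sum = m := by
    have := comp_perm_of_carries hl0
    have e1 : (List.ofFn (fn y.len l0)).sum = (List.ofFn (fn y.len Ly)).sum := by
      rw [List.sum_ofFn, List.sum_ofFn, ← this, sum_comp_perm]
    rw [ofFn_fn _ hl0.1, ofFn_fn _ hLyl] at e1
    omega
  have hoff : (P.map charSize).length = (x.pos i : ℕ) := by simpa using hpos
  have hb1 : (P.map charSize).length + y.len ≤ x.len + y.len - 1 := by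
    rw [hoff]; exact braidComp_arity (x.pos_arity y i) _
  have hb2 : (P.map charSize).sum + m ≤ N := by omega
  have c1 : Carries (shift _ hb1 y.braid) (P.map charSize ++ l0 ++ Q.map charSize)
      (P.map charSize ++ Ly ++ Q.map charSize) :=
    Carries.shift hl0 _ _ hb1 (by have := hl0.1; simp; omega)
  have s1 := cable_shift (M := N) y.braid (P.map charSize) Ly (Q.map charSize) hb1 hLyl
    (by simp; omega) (by simp only [List.sum_append]; omega) hLys hb2
  have s2 := cable_cable x.braid (G l0 ∘ v) (hT l0 hl0.1) (hS l0 hl0s)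
  rw [hflat, hlen, hl0.1, hsum, hl0s] at s2
  have lhs : (x.comp h i y).underlying.2 = shift _ hb2 y.underlying.2 *
      cable N (fun j => if v j = some i then m else charSize (v j)) x.braid := by
    simp only [underlying, hchars]
    change cable N (fn (x.len + y.len - 1) _) (braidComp (x.pos_arity y i) (x.pos i) x.braid
      y.braid) = _
    rw [braidComp, shift_congr hoff.symm _ hb1, cable_mul_of_carries c1, s1, s2]
  -- the right-hand side
  let H : Option (Fin n) → List ℕ := fun c => if c = some i then [m] else
    List.replicate (charSize c) 1
  have hH : ∀ L : List (Option (Fin n)), some i ∉ L → L.map H = L.map fun c =>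
      List.replicate (charSize c) 1 :=
    fun L hL => List.map_congr_left fun c hc => if_neg fun (e : c = some i) => hL (e ▸ hc)
  have hHl : List.length ∘ (H ∘ v) = fn x.len (x.word.term.chars.map charSize) := by
    rw [← fn_ofFn (List.length ∘ (H ∘ v)), ← hv, ← ofFn_comp, fn_ofFn, fn_ofFn]
    funext j
    simp only [Function.comp, H]
    split_ifs with hj
    · rw [hj]; rfl
    · simp
  have hHs : List.sum ∘ (H ∘ v) = fun j => if v j = some i then m else charSize (v j) := by
    funext j
    simp only [Function.comp, H]
    split_ifs <;> simp
  have hHf : (List.ofFn (H ∘ v)).flatten =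
      (P.map fun c => List.replicate (charSize c) 1).flatten ++ m ::
        (Q.map fun c => List.replicate (charSize c) 1).flatten := by
    rw [ofFn_comp, hv, hPQ, List.map_append, List.map_cons, hH P hP, hH Q hQ]
    simp [H]
  have hrep : ∀ L : List (Option (Fin n)),
      ∀ z ∈ (L.map fun c => List.replicate (charSize c) 1).flatten, z = 1 := by
    intro L z hz
    obtain ⟨l, hl, hzl⟩ := List.mem_flatten.1 hz
    obtain ⟨c, -, rfl⟩ := List.mem_map.1 hl
    exact List.eq_of_mem_replicate hzl
  have hrepl : ∀ L : List (Option (Fin n)),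
      (L.map fun c => List.replicate (charSize c) 1).flatten.length = (L.map charSize).sum := by
    intro L
    rw [List.length_flatten, List.map_map]
    congr 1
    exact List.map_congr_left fun c _ => by simp
  have hsingle : fn n (List.ofFn (H ∘ v)).flatten = single (x.word.tau.symm i) m := by
    refine single_eq _ _ _ _ _ ?_ hHf (hrep P) (hrep Q) ?_
    · rw [hHf]
      simp only [List.length_append, List.length_cons, hrepl]
      omega
    · rw [hrepl, htau]
  have t := cable_cable (N := n) (M := N) x.braid (H ∘ v) (by
      have := List.sum_ofFn (f := List.length ∘ (H ∘ v))
      rw [hHl, ofFn_fn _ (by simp [hL]), x.sum_chars, ← hHl] at this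
      exact this.symm) (by
      have e := hS [m] (by simp)
      have : ∀ j, ((H ∘ v) j).sum = ((G [m] ∘ v) j).sum := fun j => by
        have a := congrFun hHs j
        have b := congrFun (hsum [m]) j
        simp only [Function.comp] at a b ⊢
        rw [a, b]; simp
      rw [Finset.sum_congr rfl fun j _ => this j, e])
  rw [hsingle, hHl, hHs] at t
  rw [lhs, braidComp]
  rw [shift_congr htau hb2 (braidComp_arity h _)]
  congr 1
  exact t.symm

end BWord

/-- The weak braiding operad's groupoid `wPaB(n)`: its objects are the parenthesized coloured
braids, and its morphisms are pulled back from `wCoB(n)` along `π`. -/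
instance wpab (n : ℕ) : Groupoid (BWord n) where
  Hom x y := wCoBHom x.underlying y.underlying
  id x := ⟨1, by simp, by simp⟩
  comp {x y z} f g := ⟨g.braid * f.braid, by rw [map_mul, f.perm_eq, g.perm_eq]; group, by
    rw [f.braid_eq, g.braid_eq]; group⟩
  inv {x y} f := ⟨f.braid⁻¹, by rw [map_inv, f.perm_eq]; group, by rw [f.braid_eq]; group⟩
  id_comp f := wCoBHom.ext (mul_one _)
  comp_id f := wCoBHom.ext (one_mul _)
  assoc f g h := wCoBHom.ext (mul_assoc _ _ _).symm
  inv_comp f := wCoBHom.ext (mul_inv_cancel _)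
  comp_inv f := wCoBHom.ext (inv_mul_cancel _)

/-- Partial composites of morphisms of `wPaB` are morphisms of `wPaB`. -/
theorem braidComp_underlying {n m N : ℕ} (h : N + 1 = n + m) (i : Fin n) {x y : BWord n}
    {x' y' : BWord m} (f : x ⟶ y) (f' : x' ⟶ y') :
    braidComp h (y.word.tau.symm i) f.braid f'.braid =
      (y.comp h i y').underlying.2 * (x.comp h i x').underlying.2⁻¹ := by
  have hf : (perm f.braid).symm (y.word.tau.symm i) = x.word.tau.symm i :=
    Word.symm_tau_eq f.perm_eq i
  have e : y.underlying.2 = f.braid * x.underlying.2 := by rw [f.braid_eq]; group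
  have e' : y'.underlying.2 = f'.braid * x'.underlying.2 := by rw [f'.braid_eq]; group
  rw [BWord.underlying_comp h i y y', e, e', braidComp_mul, hf, BWord.underlying_comp h i x x',
    mul_inv_cancel_right]

/-! ### Symmetric operads in categories -/

/-- The structure maps of a symmetric operad in the category of categories: the operadic unit, the
actions of the symmetric groups, and the partial compositions `∘ᵢ : P(n) × P(m) ⥤ P(n + m - 1)`,
where the inputs are numbered from `0`. (Only the three concrete operads below are used.) -/
structure OperadData : Type (max (u₁ + 1) (v₁ + 1)) where
  /-- The category of `n`-ary operations. -/
  obj : ℕ → Type u₁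
  [cat : ∀ n, Category.{v₁} (obj n)]
  one : obj 1
  act : ∀ {n : ℕ}, Equiv.Perm (Fin n) → (obj n ⥤ obj n)
  comp : ∀ {n m N : ℕ}, N + 1 = n + m → Fin n → (obj n × obj m ⥤ obj N)

attribute [instance] OperadData.cat

/-- Morphisms of symmetric operads: families of functors that strictly preserve the operadic unit,
the actions of the symmetric groups and the partial compositions. -/
structure OperadData.Hom (P : OperadData.{u₁, v₁}) (Q : OperadData.{u₂, v₂}) where
  map : ∀ n, P.obj n ⥤ Q.obj n
  map_one : (map 1).obj P.one = Q.one
  map_act : ∀ {n : ℕ} (σ : Equiv.Perm (Fin n)), P.act σ ⋙ map n = map n ⋙ Q.act σ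
  map_comp : ∀ {n m N : ℕ} (h : N + 1 = n + m) (i : Fin n),
    P.comp h i ⋙ map N = (map n).prod (map m) ⋙ Q.comp h i

/-- The composite of morphisms of symmetric operads. -/
def OperadData.Hom.trans {P : OperadData.{u₁, v₁}} {Q : OperadData.{u₂, v₂}} {R : OperadData.{u₃, v₃}}
    (F : P.Hom Q) (G : Q.Hom R) : P.Hom R where
  map n := F.map n ⋙ G.map n
  map_one := by simp [F.map_one, G.map_one]
  map_act σ := by
    rw [← Functor.assoc, F.map_act, Functor.assoc, G.map_act, Functor.assoc]
  map_comp h i := by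
    rw [← Functor.assoc, F.map_comp, Functor.assoc, G.map_comp]
    rfl

/-- The operad `PaB` of parenthesized braids. The partial composite of morphisms `g : p ⟶ q` and
`g' : p' ⟶ q'` is `g ∘ₐ g'` for the output position `a = τ(q)⁻¹(i)`. -/
def PaB : OperadData where
  obj := Word
  one := Word.one
  act σ :=
    { obj := Word.act σ
      map := fun {p q} g => ⟨g.braid, by rw [g.perm_eq, Word.tau_act, Word.tau_act]; group⟩ }
  comp h i :=
    { obj := fun p => p.1.comp h i p.2
      map := fun {p q} g => ⟨braidComp h (q.1.tau.symm i) g.1.braid g.2.braid,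
        perm_braidComp h i g.1.perm_eq g.2.perm_eq⟩
      map_id := fun p => CoBHom.ext (braidComp_one h _)
      map_comp := fun {p q r} f g => CoBHom.ext (by
        have := braidComp_mul h (r.1.tau.symm i) g.1.braid f.1.braid g.2.braid f.2.braid
        rw [Word.symm_tau_eq g.1.perm_eq] at this
        exact this) }

/-- The weak braiding operad `wPaB`. -/
def wPaB : OperadData where
  obj := BWord
  one := BWord.one
  act σ :=
    { obj := BWord.act σ
      map := fun {x y} g => ⟨g.braid, by
        rw [BWord.underlying_act, BWord.underlying_act, g.perm_eq]
        simp only [BWord.underlying]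
        group, by
        rw [BWord.underlying_act, BWord.underlying_act]
        exact g.braid_eq⟩ }
  comp h i :=
    { obj := fun x => x.1.comp h i x.2
      map := fun {x y} g => ⟨braidComp h (y.1.word.tau.symm i) g.1.braid g.2.braid,
        perm_braidComp h i g.1.perm_eq g.2.perm_eq, braidComp_underlying h i g.1 g.2⟩
      map_id := fun p => wCoBHom.ext (braidComp_one h _)
      map_comp := fun {x y z} f g => wCoBHom.ext (by
        have := braidComp_mul h (z.1.word.tau.symm i) g.1.braid f.1.braid g.2.braid f.2.braid
        rw [Word.symm_tau_eq g.1.perm_eq] at this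
        exact this) }

/-- The morphism of symmetric operads `wPaB ⟶ PaB` which forgets the braids of the objects. -/
def forgetBraid : wPaB.Hom PaB where
  map n :=
    { obj := fun x => BWord.word x
      map := fun {x y} g => ⟨g.braid, g.perm_eq⟩ }
  map_one := rfl
  map_act σ := rfl
  map_comp h i := rfl

/-! ### Algebras -/

section algebras

variable (C : Type u) [Category.{v} C]

/-- The functor `(G, X₁, …, X_N) ↦ (X₁, …, X_{i-1}, G(Xᵢ, …, X_{i+m-1}), X_{i+m}, …, X_N)`. -/
def insert {n m N : ℕ} (h : N + 1 = n + m) (i : Fin n) :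
    ((Fin m → C) ⥤ C) × (Fin N → C) ⥤ (Fin n → C) :=
  Functor.pi' fun j =>
    match slot h i j with
    | some b => CategoryTheory.Prod.snd _ _ ⋙ Pi.eval (fun _ => C) b
    | none =>
      (𝟭 _).prod (Pi.comap (fun _ => C) (inner h i)) ⋙ CategoryTheory.Prod.swap _ _ ⋙
        evaluationUncurried (Fin m → C) C

/-- The endomorphism operad of a category: `End_C(n)` is the category of functors `Cⁿ ⥤ C`,
`(σ F)(X₁, …, Xₙ) = F(X_{σ 1}, …, X_{σ n})`, and
`(F ∘ᵢ G)(X₁, …, X_N) = F(X₁, …, X_{i-1}, G(Xᵢ, …, X_{i+m-1}), X_{i+m}, …, X_N)`. -/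
def endOperad : OperadData where
  obj n := (Fin n → C) ⥤ C
  one := Pi.eval (fun _ => C) 0
  act σ := (Functor.whiskeringLeft _ _ _).obj (Pi.comap (fun _ => C) σ)
  comp {n m N} h i :=
    Functor.curry.obj
      (prod.associator ((Fin n → C) ⥤ C) ((Fin m → C) ⥤ C) (Fin N → C) ⋙
        (𝟭 _).prod (insert C h i) ⋙ CategoryTheory.Prod.swap _ _ ⋙
          evaluationUncurried (Fin n → C) C)

/-- A weak braided monoidal structure on `C` is the structure of a `wPaB`-algebra. -/
abbrev WeakBraidedStructure := wPaB.Hom (endOperad C)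

variable {C}
variable [MonoidalCategory C]

/-- The tensor product of the objects `X a` in the order and with the parentheses of a word, `x₀`
standing for the monoidal unit. -/
def tensorTerm {α : Type} : Term α → ((α → C) ⥤ C)
  | .x0 => (Functor.const _).obj (𝟙_ C)
  | .var a => Pi.eval (fun _ => C) a
  | .nu p q => (tensorTerm p).prod' (tensorTerm q) ⋙ MonoidalCategory.tensor C

end algebras

/-! ### The generating morphisms of `PaB` -/

namespace Word

/-- `ν(x₁, x₂)` -/
def nu₁₂ : Word 2 := ⟨.nu (.var 0) (.var 1), by decide, by decide⟩

/-- `ν(x₂, x₁)` -/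
def nu₂₁ : Word 2 := ⟨.nu (.var 1) (.var 0), by decide, by decide⟩

/-- `ν(x₀, x₁)` -/
def nu₀₁ : Word 1 := ⟨.nu .x0 (.var 0), by decide, by decide⟩

/-- `ν(x₁, x₀)` -/
def nu₁₀ : Word 1 := ⟨.nu (.var 0) .x0, by decide, by decide⟩

/-- `ν(ν(x₁, x₂), x₃)` -/
def nuLeft : Word 3 := ⟨.nu (.nu (.var 0) (.var 1)) (.var 2), by decide, by decide⟩

/-- `ν(x₁, ν(x₂, x₃))` -/
def nuRight : Word 3 := ⟨.nu (.var 0) (.nu (.var 1) (.var 2)), by decide, by decide⟩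

/-- The trivial braid `ν(ν(x₁, x₂), x₃) ⟶ ν(x₁, ν(x₂, x₃))`. -/
def associator : nuLeft ⟶ nuRight := ⟨1, carries_iff.2 (Carries.one rfl)⟩

/-- The trivial braid `ν(x₀, x₁) ⟶ x₁`. -/
def leftUnitor : nu₀₁ ⟶ one := ⟨1, carries_iff.2 (Carries.one rfl)⟩

/-- The trivial braid `ν(x₁, x₀) ⟶ x₁`. -/
def rightUnitor : nu₁₀ ⟶ one := ⟨1, carries_iff.2 (Carries.one rfl)⟩

/-- The generating braid `σ₀ : ν(x₁, x₂) ⟶ ν(x₂, x₁)`. -/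
def braiding : nu₁₂ ⟶ nu₂₁ := ⟨gen 2 0, carries_iff.2 (Carries.gen [] [] 0 1 rfl)⟩

end Word

/-- `φ` is the `PaB`-algebra given by the braided monoidal structure of `C`: a word acts by the
corresponding iterated tensor product, and the associator, the unitors and the braiding of `C` are
the actions of the corresponding morphisms of `PaB`. These conditions determine `φ`. -/
structure IsBraidedAlgebra {C : Type u} [Category.{v} C] [MonoidalCategory C] [BraidedCategory C]
    (φ : PaB.Hom (endOperad C)) : Prop where
  obj : ∀ (n : ℕ) (p : Word n), (φ.map n).obj p = tensorTerm p.term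
  associator : ∀ X : Fin 3 → C,
    HEq (((φ.map 3).map Word.associator).app X) (α_ (X 0) (X 1) (X 2)).hom
  leftUnitor : ∀ X : Fin 1 → C, HEq (((φ.map 1).map Word.leftUnitor).app X) (λ_ (X 0)).hom
  rightUnitor : ∀ X : Fin 1 → C, HEq (((φ.map 1).map Word.rightUnitor).app X) (ρ_ (X 0)).hom
  braiding : ∀ X : Fin 2 → C, HEq (((φ.map 2).map Word.braiding).app X) (β_ (X 0) (X 1)).hom

end WeakBraid

/-! The content is coherence for braided monoidal categories. A parenthesized braid `g : p ⟶ q` can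
be written in many ways as a composite of associators, unitors, braidings, their inverses and their
tensor products with identities. Each way gives a morphism between the tensor products of the words
`p` and `q`; such an expression must exist, and its value must depend on the braid alone. The
relation `TermActs X g p q f` records that `f` is the value of some expression whose underlying
braid is `g`.

Uniqueness (`TermActs.unique`). On tensor products along lists, parenthesized to the right, the
braidings of adjacent factors satisfy Artin's relations: distant ones commute by naturality, and
adjacent ones satisfy the Yang–Baxter equation. A braid permutes the factors, so it does not act on
a single object; it acts on the formal family of the tensor products along all lists of length `n`,
and the presentation of `Bₙ` gives a homomorphism to the automorphisms of this family
(`listAction`). Conjugation by `wordTensorIso` turns every expression into this action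
(`TermActs.listActs`), so the braid determines the morphism.

Existence (`TermActs.exists_of_carries`). Every word is connected by a trivial braid to a
right-parenthesized list, and on lists each generator of `Bₙ` is a braiding of two adjacent factors.

The action `braidMap` is the resulting unique choice. Every law of a morphism of operads then
follows by showing that both sides realize the same braid. For partial composites, substituting
words realizes cabling (`TermActs.bind`, where the hexagons enter through `TermActs.blockCross`),
and acting inside one factor realizes a shift (`TermActs.map`); their product is `braidComp`. On
objects the laws are strict because `tensorTerm` is defined by recursion on words. Finally,
`forgetBraid.trans φ` is again a morphism of operads. -/

namespace WeakBraid

open scoped MonoidalCategory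

/-! ### The action of the braid groups on iterated tensor products -/

/-! ### Tensor products along lists, and Artin's relations for adjacent braidings. -/

section listAction

variable {C : Type u} [Category.{v} C] [MonoidalCategory C] {A : Type} (X : A → C)

/-- The tensor product of the objects `X a` along a list, parenthesized to the right. -/
def tensorList : List A → C
  | [] => 𝟙_ C
  | a :: l => X a ⊗ tensorList l

/-- The tensor product of two lists is the tensor product along their concatenation. -/
def tensorListAppend : (l l' : List A) →
    (tensorList X l ⊗ tensorList X l' ≅ tensorList X (l ++ l'))
  | [], l' => λ_ (tensorList X l')
  | a :: l, l' => α_ (X a) (tensorList X l) (tensorList X l') ≪≫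
      MonoidalCategory.whiskerLeftIso (X a) (tensorListAppend l l')

theorem tensorListAppend_nil (l' : List A) : tensorListAppend X [] l' = λ_ (tensorList X l') := rfl

theorem tensorListAppend_cons (a : A) (l l' : List A) :
    tensorListAppend X (a :: l) l' = α_ (X a) (tensorList X l) (tensorList X l') ≪≫
      MonoidalCategory.whiskerLeftIso (X a) (tensorListAppend X l l') := rfl

/-- A list together with a morphism to the tensor product along it. -/
abbrev ListHom (Y : C) : Type v := Σ l : List A, Y ⟶ tensorList X l

variable {X}

/-- Lists such as `(l ++ l') ++ l''` and `l ++ (l' ++ l'')` are equal only propositionally. An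
equality in `ListHom` compares morphisms into their tensor products without transports; this lemma
and `ListHom.whisker_eq` are the congruence rules that replace rewriting. -/
theorem ListHom.comp_eq {l l' : List A} {Y : C} {f : Y ⟶ tensorList X l}
    {f' : Y ⟶ tensorList X l'} {Z : C} (k : Z ⟶ Y)
    (h : (⟨l, f⟩ : ListHom X Y) = ⟨l', f'⟩) :
    (⟨l, k ≫ f⟩ : ListHom X Z) = ⟨l', k ≫ f'⟩ := by
  cases h; rfl

theorem ListHom.whisker_eq {l l' : List A} {Y : C} {f : Y ⟶ tensorList X l}
    {f' : Y ⟶ tensorList X l'} (a : A)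
    (h : (⟨l, f⟩ : ListHom X Y) = ⟨l', f'⟩) :
    (⟨a :: l, X a ◁ f⟩ : ListHom X (X a ⊗ Y)) = ⟨a :: l', X a ◁ f'⟩ := by
  cases h; rfl

variable (X)

/-- Associativity of `tensorListAppend`. -/
theorem tensorListAppend_assoc (l l' l'' : List A) :
    (⟨(l ++ l') ++ l'', (tensorListAppend X l l').hom ▷ tensorList X l'' ≫
      (tensorListAppend X (l ++ l') l'').hom⟩ : ListHom X _) =
    ⟨l ++ (l' ++ l''), (α_ _ _ _).hom ≫ tensorList X l ◁ (tensorListAppend X l' l'').hom ≫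
      (tensorListAppend X l (l' ++ l'')).hom⟩ := by
  induction l with
  | nil =>
    simp only [List.nil_append, tensorListAppend_nil]
    congr 1
    simp [tensorList]
  | cons a l ih =>
    -- The induction hypothesis is tensored with `X a` and preceded by the reassociation that
    -- isolates `X a`. What remains at the two ends is naturality of the associator and the
    -- pentagon.
    have h := ListHom.comp_eq
      ((α_ (X a) (tensorList X l) (tensorList X l')).hom ▷ tensorList X l'' ≫ (α_ _ _ _).hom)
      (ListHom.whisker_eq a ih)
    refine Eq.trans ?_ (h.trans ?_)
    · refine congrArg (Sigma.mk _) ?_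
      simp [tensorListAppend_cons, tensorList]
    · refine congrArg (Sigma.mk _) ?_
      simp [tensorListAppend_cons, tensorList]

/-- Right unitality of `tensorListAppend`. -/
theorem tensorListAppend_right_unit (l : List A) :
    (⟨l ++ [], (tensorListAppend X l []).hom⟩ : ListHom X _) =
      ⟨l, (ρ_ (tensorList X l)).hom⟩ := by
  induction l with
  | nil =>
    refine congrArg (Sigma.mk _) ?_
    simp [tensorListAppend_nil, tensorList, MonoidalCategory.unitors_equal]
  | cons a l ih =>
    refine Eq.trans rfl ((ListHom.comp_eq (α_ (X a) (tensorList X l) (𝟙_ C)).hom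
      (ListHom.whisker_eq a ih)).trans ?_)
    · refine congrArg (Sigma.mk _) ?_
      simp [tensorList]

/-- Exchanging the entries `i` and `i + 1` of a list. -/
def swapAt : ℕ → List A → List A
  | 0, a :: b :: l => b :: a :: l
  -- Out of range nothing moves, which keeps `swapAt i` an involution on all lists.
  | 0, [a] => [a]
  | _, [] => []
  | i + 1, a :: l => a :: swapAt i l

omit X in
theorem swapAt_swapAt (i : ℕ) (l : List A) : swapAt i (swapAt i l) = l := by
  fun_induction swapAt i l <;> simp_all [swapAt]

omit X in
theorem length_swapAt (i : ℕ) (l : List A) : (swapAt i l).length = l.length := by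
  fun_induction swapAt i l <;> simp_all

variable [BraidedCategory C]

/-- The braiding of the factors `i` and `i + 1` of a tensor product along a list. -/
def swapIso : (i : ℕ) → (l : List A) → (tensorList X l ≅ tensorList X (swapAt i l))
  | 0, a :: b :: l => (α_ (X a) (X b) (tensorList X l)).symm ≪≫
      MonoidalCategory.whiskerRightIso (β_ (X a) (X b)) (tensorList X l) ≪≫ α_ _ _ _
  | 0, [_] => Iso.refl _
  | 0, [] => Iso.refl _
  | _ + 1, [] => Iso.refl _
  | i + 1, a :: l => MonoidalCategory.whiskerLeftIso (X a) (swapIso i l)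

omit X in
-- The source of the relation between distant generators: by the interchange law, the braiding of
-- the first two factors commutes with whatever happens in the tail.
theorem braiding_tail_naturality {x y W W' : C} (f : W ⟶ W') :
    x ◁ y ◁ f ≫ (α_ x y W').inv ≫ (β_ x y).hom ▷ W' ≫ (α_ y x W').hom =
      ((α_ x y W).inv ≫ (β_ x y).hom ▷ W ≫ (α_ y x W).hom) ≫ y ◁ x ◁ f := by
  rw [MonoidalCategory.associator_inv_naturality_right_assoc,
    MonoidalCategory.whisker_exchange_assoc]
  simp

omit X in
-- The source of the braid relation: the Yang–Baxter equation tensored with the remaining factors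
-- `W`.
theorem yang_baxter_tail (x y z W : C) :
    ((α_ x y (z ⊗ W)).inv ≫ (β_ x y).hom ▷ (z ⊗ W) ≫ (α_ y x (z ⊗ W)).hom) ≫
      y ◁ ((α_ x z W).inv ≫ (β_ x z).hom ▷ W ≫ (α_ z x W).hom) ≫
      ((α_ y z (x ⊗ W)).inv ≫ (β_ y z).hom ▷ (x ⊗ W) ≫ (α_ z y (x ⊗ W)).hom) =
    x ◁ ((α_ y z W).inv ≫ (β_ y z).hom ▷ W ≫ (α_ z y W).hom) ≫
      ((α_ x z (y ⊗ W)).inv ≫ (β_ x z).hom ▷ (y ⊗ W) ≫ (α_ z x (y ⊗ W)).hom) ≫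
      z ◁ ((α_ x y W).inv ≫ (β_ x y).hom ▷ W ≫ (α_ y x W).hom) := by
  -- The outer factors pass between right-parenthesized products and products of the form `(x ⊗ (y ⊗
  -- z)) ⊗ W`; afterwards only monoidal coherence separates the two forms.
  have := congrArg (fun f => (x ◁ (α_ y z W).inv ≫ (α_ x (y ⊗ z) W).inv) ≫
    f ▷ W ≫ ((α_ z (y ⊗ x) W).hom ≫ z ◁ (α_ y x W).hom)) (BraidedCategory.yang_baxter x y z)
  simp only [MonoidalCategory.comp_whiskerRight] at this
  calc _ = _ := by monoidal
    _ = _ := this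
    _ = _ := by monoidal

theorem swapIso_comm (i j : ℕ) (l : List A) (h : i + 1 < j) (hl : j + 1 < l.length) :
    (⟨_, (swapIso X j l).hom ≫ (swapIso X i (swapAt j l)).hom⟩ : ListHom X (tensorList X l)) =
      ⟨_, (swapIso X i l).hom ≫ (swapIso X j (swapAt i l)).hom⟩ := by
  induction i generalizing j l with
  | zero =>
    match j, l, h, hl with
    | j + 2, a :: b :: l, _, _ =>
      exact congrArg (Sigma.mk (b :: a :: swapAt j l)) (braiding_tail_naturality _)
  | succ i ih =>
    match j, l, h, hl with
    | j + 1, a :: l, h, hl =>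
      have := ListHom.whisker_eq a (ih j l (by omega) (by simpa using hl))
      simpa [swapIso, swapAt, tensorList] using this

theorem swapIso_braid (i : ℕ) (l : List A) (hl : i + 2 < l.length) :
    (⟨_, (swapIso X i l).hom ≫ (swapIso X (i + 1) (swapAt i l)).hom ≫
      (swapIso X i (swapAt (i + 1) (swapAt i l))).hom⟩ : ListHom X (tensorList X l)) =
      ⟨_, (swapIso X (i + 1) l).hom ≫ (swapIso X i (swapAt (i + 1) l)).hom ≫
      (swapIso X (i + 1) (swapAt i (swapAt (i + 1) l))).hom⟩ := by
  induction i generalizing l with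
  | zero =>
    match l, hl with
    | a :: b :: c :: l, _ =>
      exact congrArg (Sigma.mk (c :: b :: a :: l)) (yang_baxter_tail _ _ _ _)
  | succ i ih =>
    match l, hl with
    | a :: l, hl =>
      have := ListHom.whisker_eq a (ih l (by simp at hl; omega))
      simpa [swapIso, swapAt, tensorList] using this

end listAction

/-! ### The braid group action on the family of tensor products along lists. -/

section braidAction

variable {C : Type u} [Category.{v} C] [MonoidalCategory C] [BraidedCategory C] {A : Type}
  (X : A → C)

/-- The family of the tensor products along all lists of length `n`. -/
def listFamily (n : ℕ) : Limits.FormalCoproduct.{0} C where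
  I := {l : List A // l.length = n}
  obj l := tensorList X l.1

/-- `swapIso`, as an automorphism of the family of the tensor products along lists. -/
def swapAut (n i : ℕ) : Aut (listFamily X n) :=
  Limits.FormalCoproduct.isoOfComponents
    { toFun := fun l => ⟨swapAt i l.1, (length_swapAt i l.1).trans l.2⟩
      invFun := fun l => ⟨swapAt i l.1, (length_swapAt i l.1).trans l.2⟩
      left_inv := fun l => Subtype.ext (swapAt_swapAt i l.1)
      right_inv := fun l => Subtype.ext (swapAt_swapAt i l.1) }
    fun l => swapIso X i l.1

variable {X} in
omit [BraidedCategory C] in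
-- Extensionality for formal coproducts involves an `eqToHom` between components. This form absorbs
-- it into an equality in `ListHom`, the shape in which Artin's relations are proved.
theorem listFamily_hom_ext {n : ℕ} {f g : listFamily X n ⟶ listFamily X n}
    (h : ∀ l : {l : List A // l.length = n}, (⟨(f.f l).1, f.φ l⟩ : ListHom X (tensorList X l.1)) =
      ⟨(g.f l).1, g.φ l⟩) :
    f = g := by
  refine (Limits.FormalCoproduct.hom_ext_iff' f g).2 fun l => ?_
  have key : ∀ (a b : (listFamily X n).I) (x : (listFamily X n).obj l ⟶ (listFamily X n).obj a)
      (y : (listFamily X n).obj l ⟶ (listFamily X n).obj b),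
      (⟨a.1, x⟩ : ListHom X (tensorList X l.1)) = ⟨b.1, y⟩ →
      ∃ h : a = b, x ≫ eqToHom (by rw [h]) = y := by
    rintro ⟨a, ha⟩ ⟨b, hb⟩ x y e
    obtain ⟨rfl, e⟩ := Sigma.mk.inj e
    exact ⟨rfl, by rw [eqToHom_refl, Category.comp_id]; exact eq_of_heq e⟩
  exact key _ _ _ _ (h l)

/-- The action of the braid group on tensor products along lists of length `n`. -/
def listAction (n : ℕ) : Braid n →* Aut (listFamily X n) :=
  Braid.lift (swapAut X n)
    -- In a product in `Aut` the right factor acts first, as in `Braid`; hence the side `i * j` of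
    -- the relation swaps at `j` first.
    (fun i j h1 h2 => Iso.ext (listFamily_hom_ext fun l =>
      swapIso_comm X i j l.1 h1 (by rw [l.2]; exact h2)))
    (fun i h => Iso.ext (listFamily_hom_ext fun l =>
      swapIso_braid X i l.1 (by rw [l.2]; exact h)))

variable {X}

/-- The braid `g` acts on the tensor product along the list `l` by `f`. -/
def ListActs {n : ℕ} (g : Braid n) (l l' : List A) (f : tensorList X l ⟶ tensorList X l') : Prop :=
  ∃ h : l.length = n, (⟨((listAction X n g).hom.f ⟨l, h⟩).1, (listAction X n g).hom.φ ⟨l, h⟩⟩ :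
    ListHom X (tensorList X l)) = ⟨l', f⟩

namespace ListActs

variable {n N : ℕ} {g g' : Braid n} {l l' l'' : List A} {f f₁ : tensorList X l ⟶ tensorList X l'}

/-- `ListActs` is the graph of a function: `listAction` determines the target list together with the
morphism. All uniqueness statements below come from this. -/
theorem unique (h : ListActs g l l' f) (h₁ : ListActs g l l' f₁) : f = f₁ := by
  obtain ⟨hl, h⟩ := h
  obtain ⟨_, h₁⟩ := h₁
  exact eq_of_heq (Sigma.mk.inj (h.symm.trans h₁)).2

theorem congr (h : ListActs g l l' f) {f' : tensorList X l ⟶ tensorList X l''}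
    (e : (⟨l', f⟩ : ListHom X (tensorList X l)) = ⟨l'', f'⟩) : ListActs g l l'' f' := by
  cases e; exact h

theorem length_eq (h : ListActs g l l' f) : l.length = n := h.1

theorem length_eq' (h : ListActs g l l' f) : l'.length = n := by
  obtain ⟨hl, h⟩ := h
  exact (congrArg (fun s : ListHom X _ => s.1.length) h).symm.trans
    ((listAction X n g).hom.f ⟨l, hl⟩).2

theorem exists_of_length (g : Braid n) (h : l.length = n) :
    ∃ (l' : List A) (f : tensorList X l ⟶ tensorList X l'), ListActs g l l' f :=
  ⟨_, _, h, rfl⟩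

theorem one (h : l.length = n) : ListActs (1 : Braid n) l l (𝟙 (tensorList X l)) := by
  refine ⟨h, ?_⟩
  rw [map_one]
  rfl

theorem mul {f' : tensorList X l' ⟶ tensorList X l''} (h' : ListActs g' l' l'' f')
    (h : ListActs g l l' f) : ListActs (g' * g) l l'' (f ≫ f') := by
  obtain ⟨hl, h⟩ := h
  refine ⟨hl, ?_⟩
  cases h
  obtain ⟨hl', h'⟩ := h'
  cases h'
  rw [map_mul]
  rfl

theorem swap {i : ℕ} (hi : i + 1 < n) (h : l.length = n) :
    ListActs (gen n i) l (swapAt i l) (swapIso X i l).hom := by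
  refine ⟨h, ?_⟩
  have : listAction X n (gen n i) = swapAut X n i := Braid.lift_gen _ _ _ hi
  rw [this]
  rfl

theorem inv {e : tensorList X l ≅ tensorList X l'} (h : ListActs g l l' e.hom) :
    ListActs g⁻¹ l' l e.inv := by
  obtain ⟨l'', f', h'⟩ := exists_of_length (X := X) g⁻¹ h.length_eq'
  have h1 := h'.mul h
  rw [inv_mul_cancel] at h1
  obtain ⟨_, h2⟩ := h1
  obtain ⟨_, h3⟩ := one (X := X) h.length_eq
  obtain ⟨rfl, h4⟩ := Sigma.mk.inj (h2.symm.trans h3)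
  have : f' = e.inv := by
    rw [← cancel_epi e.hom, eq_of_heq h4, e.hom_inv_id]
  rwa [← this]

/-- Acting by `g`, then `g⁻¹`, then `g` again gives `f`, `f'` and `f₃` with `f ≫ f' = 𝟙` and `f' ≫
f₃ = 𝟙`; by uniqueness `f₃` is `f`. -/
theorem isIso (h : ListActs g l l' f) : IsIso f := by
  obtain ⟨hl, h⟩ := h
  cases h
  have h1 := one (X := X) hl
  obtain ⟨l'', f', h'⟩ := exists_of_length (X := X) g⁻¹ ((listAction X n g).hom.f ⟨l, hl⟩).2
  obtain ⟨l₃, f₃, h₃⟩ := exists_of_length (X := X) g h'.length_eq'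
  have h2 := h'.mul (g := g) ⟨hl, rfl⟩
  rw [inv_mul_cancel] at h2
  obtain ⟨_, h2⟩ := h2
  obtain ⟨_, h1⟩ := h1
  obtain ⟨rfl, h4⟩ := Sigma.mk.inj (h2.symm.trans h1)
  have h5 := h₃.mul h'
  rw [mul_inv_cancel] at h5
  obtain ⟨_, h5⟩ := h5
  obtain ⟨_, h6⟩ := one (X := X) h'.length_eq
  obtain ⟨rfl, h7⟩ := Sigma.mk.inj (h5.symm.trans h6)
  have : f₃ = (listAction X n g).hom.φ ⟨_, hl⟩ := h₃.unique ⟨hl, rfl⟩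
  refine ⟨f', eq_of_heq h4, ?_⟩
  rw [← this]; exact eq_of_heq h7

/-- Properties of the action can be checked on generators. -/
theorem induction {P : ∀ (_ : Braid n) (l l' : List A), (tensorList X l ⟶ tensorList X l') → Prop}
    (one : ∀ l, l.length = n → P 1 l l (𝟙 _))
    (swap : ∀ i l, i + 1 < n → l.length = n → P (WeakBraid.gen n i) l _ (swapIso X i l).hom)
    (mul : ∀ g g' l l' l'' f f', P g l l' f → P g' l' l'' f' → P (g' * g) l l'' (f ≫ f'))
    (inv : ∀ g l l' (e : tensorList X l ≅ tensorList X l'), P g l l' e.hom → P g⁻¹ l' l e.inv)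
    (h : ListActs g l l' f) : P g l l' f := by
  induction g using Braid.induction generalizing l l' with
  | one =>
    obtain ⟨hl, h⟩ := h
    obtain ⟨_, h'⟩ := ListActs.one (X := X) hl
    cases h'.symm.trans h
    exact one _ hl
  | of i hi =>
    obtain ⟨hl, h⟩ := h
    obtain ⟨_, h'⟩ := ListActs.swap (X := X) hi hl
    cases h'.symm.trans h
    exact swap _ _ hi hl
  | mul a b ha hb =>
    obtain ⟨l₁, f₁, h₁⟩ := exists_of_length (X := X) b h.length_eq
    obtain ⟨l₂, f₂, h₂⟩ := exists_of_length (X := X) a h₁.length_eq'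
    obtain ⟨hl, h⟩ := h
    obtain ⟨_, h'⟩ := h₂.mul h₁
    cases h'.symm.trans h
    exact mul _ _ _ _ _ _ _ (hb h₁) (ha h₂)
  | inv a ha =>
    -- The induction hypothesis concerns `a`, which acts from `l'` to `l` by the inverse of `f`.
    have := h.isIso
    have h1 : ListActs a⁻¹ l l' (asIso f).hom := h
    have h2 := h1.inv
    rw [inv_inv] at h2
    exact inv a _ _ (asIso f).symm (ha h2)

end ListActs

omit [BraidedCategory C] in
theorem associator_tail_comp {x y z W W' : C} (f : y ⊗ z ⟶ W) (g : W ⟶ W') :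
    ((α_ x y z).hom ≫ x ◁ f) ≫ x ◁ g = (α_ x y z).hom ≫ x ◁ (f ≫ g) := by
  simp

omit [BraidedCategory C] in
theorem associator_tail_left {x y z z' W : C} (f : z ⟶ z') (g : y ⊗ z' ⟶ W) :
    (α_ x y z).hom ≫ x ◁ (y ◁ f ≫ g) = (x ⊗ y) ◁ f ≫ (α_ x y z').hom ≫ x ◁ g := by
  simp

omit [BraidedCategory C] in
theorem associator_tail_right {x y y' z W : C} (f : y ⟶ y') (g : y' ⊗ z ⟶ W) :
    (α_ x y z).hom ≫ x ◁ (f ▷ z ≫ g) = (x ◁ f) ▷ z ≫ (α_ x y' z).hom ≫ x ◁ g := by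
  simp

variable (X) in
-- Concatenation is compatible with adjacent braidings, here in the right-hand list and in
-- `swapIso_append_right` in the left-hand one. These are the generator cases of
-- `ListActs.whiskerLeft` and `ListActs.whiskerRight`.
theorem swapIso_append_left (r l : List A) (i : ℕ) :
    (⟨_, (tensorListAppend X r l).hom ≫ (swapIso X (r.length + i) (r ++ l)).hom⟩ :
      ListHom X (tensorList X r ⊗ tensorList X l)) =
      ⟨_, tensorList X r ◁ (swapIso X i l).hom ≫ (tensorListAppend X r (swapAt i l)).hom⟩ := by
  induction r with
  | nil =>
    rw [List.length_nil, Nat.zero_add]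
    exact congrArg (Sigma.mk (swapAt i l)) (MonoidalCategory.leftUnitor_naturality _).symm
  | cons a r ih =>
    have e : (a :: r).length + i = (r.length + i) + 1 := by simp only [List.length_cons]; omega
    rw [e]
    refine Eq.trans ?_ ((ListHom.comp_eq (α_ (X a) (tensorList X r) (tensorList X l)).hom
      (ListHom.whisker_eq a ih)).trans ?_)
    · exact congrArg (Sigma.mk (a :: swapAt (r.length + i) (r ++ l))) (associator_tail_comp _ _)
    · exact congrArg (Sigma.mk (a :: (r ++ swapAt i l))) (associator_tail_left _ _)

/-- The base case of `swapIso_append_right`: the first two factors are braided either before or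
after the tails `L` and `R` are merged by `μ`. -/
theorem braiding_tail_append (x y L R : C) {M : C} (μ : L ⊗ R ⟶ M) :
    ((α_ x (y ⊗ L) R).hom ≫ x ◁ ((α_ y L R).hom ≫ y ◁ μ)) ≫
      ((α_ x y M).inv ≫ (β_ x y).hom ▷ M ≫ (α_ y x M).hom) =
    ((α_ x y L).inv ≫ (β_ x y).hom ▷ L ≫ (α_ y x L).hom) ▷ R ≫
      ((α_ y (x ⊗ L) R).hom ≫ y ◁ ((α_ x L R).hom ≫ x ◁ μ)) := by
  simp only [MonoidalCategory.whiskerLeft_comp, Category.assoc, braiding_tail_naturality,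
    MonoidalCategory.comp_whiskerRight]
  monoidal

variable (X) in
theorem swapIso_append_right (l r : List A) (i : ℕ) (h : i + 1 < l.length) :
    (⟨_, (tensorListAppend X l r).hom ≫ (swapIso X i (l ++ r)).hom⟩ :
      ListHom X (tensorList X l ⊗ tensorList X r)) =
      ⟨_, (swapIso X i l).hom ▷ tensorList X r ≫ (tensorListAppend X (swapAt i l) r).hom⟩ := by
  induction i generalizing l with
  | zero =>
    match l, h with
    | a :: b :: l, _ =>
      exact congrArg (Sigma.mk (b :: a :: (l ++ r))) (braiding_tail_append _ _ _ _ _)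
  | succ i ih =>
    match l, h with
    | a :: l, h =>
      refine Eq.trans ?_ ((ListHom.comp_eq (α_ (X a) (tensorList X l) (tensorList X r)).hom
        (ListHom.whisker_eq a (ih l (by simp at h; omega)))).trans ?_)
      · exact congrArg (Sigma.mk (a :: swapAt i (l ++ r))) (associator_tail_comp _ _)
      · exact congrArg (Sigma.mk (a :: (swapAt i l ++ r))) (associator_tail_right _ _)

namespace ListActs

variable {n N : ℕ} {g g' : Braid n} {l l' l'' : List A} {f f₁ : tensorList X l ⟶ tensorList X l'}

/-- Adding idle strands to a braid is tensoring its action with an identity. Both sides respect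
products and inverses, so generators suffice. -/
theorem whiskerLeft (r : List A) (hN : r.length + n = N) (h : ListActs g l l' f) :
    ListActs (WeakBraid.shift r.length hN.le g) (r ++ l) (r ++ l')
      ((tensorListAppend X r l).inv ≫ tensorList X r ◁ f ≫ (tensorListAppend X r l').hom) := by
  refine h.induction (P := fun g l l' f => ListActs (WeakBraid.shift r.length hN.le g) (r ++ l)
    (r ++ l') ((tensorListAppend X r l).inv ≫ tensorList X r ◁ f ≫
      (tensorListAppend X r l').hom)) ?_ ?_ ?_ ?_
  · intro l hl
    rw [map_one, MonoidalCategory.whiskerLeft_id, Category.id_comp, Iso.inv_hom_id]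
    exact one (by simp; omega)
  · intro i l hi hl
    rw [shift_gen _ hi]
    refine (swap (X := X) (l := r ++ l) (i := r.length + i) (by omega) (by simp; omega)).congr ?_
    have := ListHom.comp_eq (tensorListAppend X r l).inv (swapIso_append_left X r l i)
    rwa [Iso.inv_hom_id_assoc] at this
  · intro g g' l l' l'' f f' h h'
    rw [map_mul]
    have := h'.mul h
    simpa using this
  · intro g l l' e h
    rw [map_inv]
    have : ListActs (WeakBraid.shift r.length hN.le g) (r ++ l) (r ++ l')
      ((tensorListAppend X r l).symm ≪≫ MonoidalCategory.whiskerLeftIso (tensorList X r) e ≪≫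
        tensorListAppend X r l').hom := h
    simpa using this.inv

theorem whiskerRight (r : List A) (hN : n + r.length = N) (h : ListActs g l l' f) :
    ListActs (WeakBraid.shift 0 (by omega) g : Braid N) (l ++ r) (l' ++ r)
      ((tensorListAppend X l r).inv ≫ f ▷ tensorList X r ≫ (tensorListAppend X l' r).hom) := by
  refine h.induction (P := fun g l l' f => ListActs (WeakBraid.shift 0 (by omega) g : Braid N)
    (l ++ r) (l' ++ r) ((tensorListAppend X l r).inv ≫ f ▷ tensorList X r ≫
      (tensorListAppend X l' r).hom)) ?_ ?_ ?_ ?_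
  · intro l hl
    rw [map_one, MonoidalCategory.id_whiskerRight, Category.id_comp, Iso.inv_hom_id]
    exact one (by simp; omega)
  · intro i l hi hl
    rw [shift_gen _ hi, zero_add]
    refine (swap (X := X) (l := l ++ r) (i := i) (by omega) (by simp; omega)).congr ?_
    have := ListHom.comp_eq (tensorListAppend X l r).inv
      (swapIso_append_right X l r i (by omega))
    rwa [Iso.inv_hom_id_assoc] at this
  · intro g g' l l' l'' f f' h h'
    rw [map_mul]
    have := h'.mul h
    simpa using this
  · intro g l l' e h
    rw [map_inv]
    have : ListActs (WeakBraid.shift 0 (by omega) g : Braid N) (l ++ r) (l' ++ r)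
      ((tensorListAppend X l r).symm ≪≫ MonoidalCategory.whiskerRightIso e (tensorList X r) ≪≫
        tensorListAppend X l' r).hom := h
    simpa using this.inv

end ListActs

end braidAction

/-- The variables of a word from left to right. -/
def Term.varList {α : Type} : Term α → List α
  | x0 => []
  | var a => [a]
  | nu p q => p.varList ++ q.varList

theorem Term.varList_eq_vars {α : Type} (p : Term α) : p.varList = p.vars := by
  induction p with
  | x0 => rfl
  | var a => rfl
  | nu p q hp hq => simp only [varList, vars, chars, List.reduceOption_append] at *; rw [hp, hq]

/-! ### Composites of structure morphisms between words, and why the braid determines them. -/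

section termAction

variable {C : Type u} [Category.{v} C] [MonoidalCategory C] {A : Type}
  (X : A → C)

/-- The iterated tensor product of objects according to a word. -/
abbrev wordTensor (p : Term A) : C := (tensorTerm p).obj X

/-- The iterated tensor product according to a word is isomorphic to the one along its list of
variables. -/
def wordTensorIso : (p : Term A) → (wordTensor X p ≅ tensorList X p.varList)
  | .x0 => Iso.refl (𝟙_ C)
  -- `tensorList X [a]` ends in a unit: it is `X a ⊗ 𝟙_ C`.
  | .var a => (ρ_ (X a)).symm
  | .nu p q => MonoidalCategory.tensorIso (wordTensorIso p) (wordTensorIso q) ≪≫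
      tensorListAppend X p.varList q.varList

variable [BraidedCategory C]

/-- The morphisms between iterated tensor products that are composed of the structure morphisms of
the braided monoidal category `C`, with the braids they realize. -/
inductive TermActs : {n : ℕ} → Braid n → (p q : Term A) → (wordTensor X p ⟶ wordTensor X q) → Prop
  | id {n : ℕ} (p : Term A) (h : p.varList.length = n) :
    TermActs (1 : Braid n) p p (𝟙 (wordTensor X p))
  | comp {n : ℕ} {g g' : Braid n} {p q r : Term A} {f : wordTensor X p ⟶ wordTensor X q}
    {f' : wordTensor X q ⟶ wordTensor X r} : TermActs g p q f → TermActs g' q r f' →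
      TermActs (g' * g) p r (f ≫ f')
  | inv {n : ℕ} {g : Braid n} {p q : Term A} (e : wordTensor X p ≅ wordTensor X q) :
    TermActs g p q e.hom → TermActs g⁻¹ q p e.inv
  | associator {n : ℕ} (p q r : Term A) (h : ((p.nu q).nu r).varList.length = n) :
    TermActs (1 : Braid n) ((p.nu q).nu r) (p.nu (q.nu r))
      (α_ (wordTensor X p) (wordTensor X q) (wordTensor X r)).hom
  | leftUnitor {n : ℕ} (p : Term A) (h : p.varList.length = n) :
    TermActs (1 : Braid n) (Term.nu .x0 p) p (λ_ (wordTensor X p)).hom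
  | rightUnitor {n : ℕ} (p : Term A) (h : p.varList.length = n) :
    TermActs (1 : Braid n) (Term.nu p .x0) p (ρ_ (wordTensor X p)).hom
  -- Only two single variables need to be braided; braidings of arbitrary words are recovered from
  -- the hexagons in `TermActs.blockCross`.
  | braiding (a b : A) :
    TermActs (gen 2 0) (Term.nu (.var a) (.var b)) (Term.nu (.var b) (.var a)) (β_ (X a) (X b)).hom
  | whiskerLeft {n N : ℕ} (r : Term A) (h : r.varList.length + n = N) {g : Braid n} {p q : Term A}
    {f : wordTensor X p ⟶ wordTensor X q} : TermActs g p q f →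
      TermActs (shift r.varList.length h.le g : Braid N) (r.nu p) (r.nu q) (wordTensor X r ◁ f)
  | whiskerRight {n N : ℕ} (r : Term A) (h : n + r.varList.length = N) {g : Braid n} {p q : Term A}
    {f : wordTensor X p ⟶ wordTensor X q} : TermActs g p q f →
      TermActs (shift 0 (by omega) g : Braid N) (p.nu r) (q.nu r) (f ▷ wordTensor X r)

variable {X}

/-- For associators and unitors, realizing the trivial braid means commuting with the comparison to
lists. -/
theorem ListActs.one_of_eq {n : ℕ} {p q : Term A} {f : wordTensor X p ⟶ wordTensor X q}
    (h : p.varList.length = n)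
    (e : (⟨p.varList, (wordTensorIso X p).hom⟩ : ListHom X (wordTensor X p)) =
      ⟨q.varList, f ≫ (wordTensorIso X q).hom⟩) :
    ListActs (1 : Braid n) p.varList q.varList
      ((wordTensorIso X p).inv ≫ f ≫ (wordTensorIso X q).hom) := by
  refine (ListActs.one (X := X) h).congr ?_
  have := ListHom.comp_eq (wordTensorIso X p).inv e
  rwa [Iso.inv_hom_id] at this

omit [BraidedCategory C] in
theorem tensorHom_tail {p q r P Q R M M' : C} (a : p ⟶ P) (b : q ⟶ Q) (c : r ⟶ R)
    (μ : P ⊗ Q ⟶ M) (μ' : M ⊗ R ⟶ M') :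
    (((a ⊗ₘ b) ≫ μ) ⊗ₘ c) ≫ μ' = ((a ⊗ₘ b) ⊗ₘ c) ≫ μ ▷ R ≫ μ' := by
  rw [← MonoidalCategory.tensorHom_id, MonoidalCategory.tensorHom_comp_tensorHom_assoc,
    Category.comp_id]

omit [BraidedCategory C] in
theorem associator_tensorHom_tail {p q r P Q R M M' : C} (a : p ⟶ P) (b : q ⟶ Q) (c : r ⟶ R)
    (μ : Q ⊗ R ⟶ M) (μ' : P ⊗ M ⟶ M') :
    ((a ⊗ₘ b) ⊗ₘ c) ≫ (α_ P Q R).hom ≫ P ◁ μ ≫ μ' =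
      (α_ p q r).hom ≫ (a ⊗ₘ ((b ⊗ₘ c) ≫ μ)) ≫ μ' := by
  simp [MonoidalCategory.tensorHom_def]

omit [BraidedCategory C] in
theorem tensorIso_whiskerLeft {p q r P Q R M M' : C} (a : p ≅ P) (b : q ≅ Q) (c : r ≅ R)
    (f : p ⟶ q) (μ : R ⊗ P ≅ M) (μ' : R ⊗ Q ≅ M') :
    μ.inv ≫ R ◁ (a.inv ≫ f ≫ b.hom) ≫ μ'.hom =
      (MonoidalCategory.tensorIso c a ≪≫ μ).inv ≫ r ◁ f ≫
        (MonoidalCategory.tensorIso c b ≪≫ μ').hom := by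
  simp [MonoidalCategory.tensorHom_def, MonoidalCategory.whisker_exchange_assoc]

omit [BraidedCategory C] in
theorem tensorIso_whiskerRight {p q r P Q R M M' : C} (a : p ≅ P) (b : q ≅ Q) (c : r ≅ R)
    (f : p ⟶ q) (μ : P ⊗ R ≅ M) (μ' : Q ⊗ R ≅ M') :
    μ.inv ≫ (a.inv ≫ f ≫ b.hom) ▷ R ≫ μ'.hom =
      (MonoidalCategory.tensorIso a c ≪≫ μ).inv ≫ f ▷ r ≫
        (MonoidalCategory.tensorIso b c ≪≫ μ').hom := by
  simp [MonoidalCategory.tensorHom_def', ← MonoidalCategory.whisker_exchange_assoc]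

/-- Compares the bare braiding of two objects with `swapIso` on a list of two entries, which carries
a unit as its tail. -/
theorem braiding_unit_tail (x y : C) :
    (β_ x y).hom ≫ ((ρ_ y).inv ⊗ₘ (ρ_ x).inv) ≫ (α_ y (𝟙_ C) (x ⊗ 𝟙_ C)).hom ≫
      y ◁ (λ_ (x ⊗ 𝟙_ C)).hom =
    (((ρ_ x).inv ⊗ₘ (ρ_ y).inv) ≫ (α_ x (𝟙_ C) (y ⊗ 𝟙_ C)).hom ≫ x ◁ (λ_ (y ⊗ 𝟙_ C)).hom) ≫
      (α_ x y (𝟙_ C)).inv ≫ (β_ x y).hom ▷ 𝟙_ C ≫ (α_ y x (𝟙_ C)).hom := by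
  monoidal

namespace TermActs

variable {n : ℕ} {g : Braid n} {p q : Term A} {f f' : wordTensor X p ⟶ wordTensor X q}

/-- The coherence theorem. Associators and right unitors reduce to `tensorListAppend_assoc` and
`tensorListAppend_right_unit`, left unitors to naturality, the braiding to a single `swapIso`, and
whiskering to whiskering of list actions. -/
theorem listActs (h : TermActs X g p q f) :
    ListActs g p.varList q.varList ((wordTensorIso X p).inv ≫ f ≫ (wordTensorIso X q).hom) := by
  induction h with
  | id p h =>
    rw [Category.id_comp, Iso.inv_hom_id]
    exact ListActs.one h
  | comp _ _ h h' => simpa using h'.mul h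
  | @inv n g p q e _ h =>
    have : ListActs g p.varList q.varList
      ((wordTensorIso X p).symm ≪≫ e ≪≫ wordTensorIso X q).hom := h
    simpa using this.inv
  | associator p q r h =>
    refine ListActs.one_of_eq h ?_
    have := ListHom.comp_eq (((wordTensorIso X p).hom ⊗ₘ (wordTensorIso X q).hom) ⊗ₘ
      (wordTensorIso X r).hom) (tensorListAppend_assoc X p.varList q.varList r.varList)
    refine Eq.trans (congrArg (Sigma.mk _) ?_) (this.trans (congrArg (Sigma.mk _) ?_))
    · exact tensorHom_tail (wordTensorIso X p).hom (wordTensorIso X q).hom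
        (wordTensorIso X r).hom _ _
    · exact associator_tensorHom_tail (wordTensorIso X p).hom (wordTensorIso X q).hom
        (wordTensorIso X r).hom _ _
  | leftUnitor p h =>
    refine ListActs.one_of_eq h (congrArg (Sigma.mk p.varList) ?_)
    exact (congrArg (· ≫ _) (MonoidalCategory.id_tensorHom _ _)).trans
      (MonoidalCategory.leftUnitor_naturality _)
  | rightUnitor p h =>
    refine ListActs.one_of_eq (by simpa [Term.varList] using h) ?_
    have := ListHom.comp_eq ((wordTensorIso X p).hom ▷ 𝟙_ C)
      (tensorListAppend_right_unit X p.varList)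
    refine Eq.trans (congrArg (Sigma.mk _) ?_) (this.trans (congrArg (Sigma.mk _) ?_))
    · exact congrArg (· ≫ _) (MonoidalCategory.tensorHom_id _ _)
    · exact MonoidalCategory.rightUnitor_naturality _
  | braiding a b =>
    have := ListActs.swap (X := X) (n := 2) (i := 0) (l := [a, b]) (by omega) rfl
    refine this.congr (congrArg (Sigma.mk [b, a]) ?_)
    exact (Iso.eq_inv_comp (wordTensorIso X ((Term.var a).nu (Term.var b)))).2
      (braiding_unit_tail (X a) (X b)).symm
  | @whiskerLeft n N r hN g p q f _ h =>
    exact (h.whiskerLeft r.varList hN).congr (congrArg (Sigma.mk (r.varList ++ q.varList))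
      (tensorIso_whiskerLeft _ _ _ f _ _))
  | @whiskerRight n N r hN g p q f _ h =>
    exact (h.whiskerRight r.varList hN).congr (congrArg (Sigma.mk (q.varList ++ r.varList))
      (tensorIso_whiskerRight _ _ _ f _ _))

/-- After conjugation by `wordTensorIso`, both morphisms are the action of `g` on the same list. -/
theorem unique (h : TermActs X g p q f) (h' : TermActs X g p q f') : f = f' := by
  have := h.listActs.unique h'.listActs
  simpa using this

theorem isIso (h : TermActs X g p q f) : IsIso f := by
  have := h.listActs.isIso
  have e : f = (wordTensorIso X p).hom ≫ ((wordTensorIso X p).inv ≫ f ≫ (wordTensorIso X q).hom) ≫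
    (wordTensorIso X q).inv := by simp
  rw [e]; infer_instance

end TermActs

end termAction

/-! ### Colour lists carried by braids, and iterated shifts. -/

section carries

variable {α : Type*} {n N : ℕ}

theorem Carries.unique {g : Braid n} {l l' l'' : List α} (h : Carries g l l')
    (h' : Carries g l l'') : l' = l'' := by
  apply List.ext_getElem?
  intro j
  by_cases hj : j < n
  · have h1 := h.2.2 ((perm g).symm ⟨j, hj⟩)
    have h2 := h'.2.2 ((perm g).symm ⟨j, hj⟩)
    rw [Equiv.apply_symm_apply] at h1 h2
    exact h1.trans h2.symm
  · rw [List.getElem?_eq_none (by rw [h.2.1]; omega), List.getElem?_eq_none (by rw [h'.2.1]; omega)]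

theorem Carries.exists_right {g : Braid n} {l : List α} (h : l.length = n) :
    ∃ l', Carries g l l' := by
  obtain ⟨l', h'⟩ := Carries.exists g⁻¹ l h
  exact ⟨l', by simpa using h'.inv⟩

theorem shift_shift {m M o o' : ℕ} (h : o' + m ≤ M) (h' : o + M ≤ N) (g : Braid m) :
    shift o h' (shift o' h g) = shift (o + o') (by omega) g := by
  induction g using Braid.induction with
  | one => simp
  | of i hi => rw [shift_gen h hi, shift_gen h' (by omega), shift_gen _ hi, add_assoc]
  | mul a b ha hb => rw [map_mul, map_mul, ha, hb, map_mul]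
  | inv a ha => rw [map_inv, map_inv, ha, map_inv]

theorem shift_zero (h : 0 + n ≤ n) (g : Braid n) : shift 0 h g = g := by
  induction g using Braid.induction with
  | one => simp
  | of i hi => rw [shift_gen h hi, zero_add]
  | mul a b ha hb => rw [map_mul, ha, hb]
  | inv a ha => rw [map_inv, ha]

end carries

/-- The word with the given list of variables, parenthesized to the right. -/
def Term.ofList {α : Type} : List α → Term α
  | [] => x0
  | a :: l => nu (var a) (ofList l)

theorem Term.varList_ofList {α : Type} (l : List α) : (ofList l).varList = l := by
  induction l with
  | nil => rfl
  | cons a l ih => simp [ofList, varList, ih]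

/-! ### Existence and naturality of the action on words, and braidings of words. -/

section termAction

variable {C : Type u} [Category.{v} C] [MonoidalCategory C] [BraidedCategory C] {A : Type}
  {X : A → C}

omit [BraidedCategory C] in
theorem whiskerLeft_tensorHom_comm {p q P Q r R : C} {f : p ⟶ q} {F : P ⟶ Q} {a : p ⟶ P}
    {b : q ⟶ Q} (h : f ≫ b = a ≫ F) (c : r ⟶ R) : r ◁ f ≫ (c ⊗ₘ b) = (c ⊗ₘ a) ≫ R ◁ F := by
  rw [← MonoidalCategory.id_tensorHom, ← MonoidalCategory.id_tensorHom,
    MonoidalCategory.tensorHom_comp_tensorHom, MonoidalCategory.tensorHom_comp_tensorHom, h,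
    Category.id_comp, Category.comp_id]

omit [BraidedCategory C] in
theorem whiskerRight_tensorHom_comm {p q P Q r R : C} {f : p ⟶ q} {F : P ⟶ Q} {a : p ⟶ P}
    {b : q ⟶ Q} (h : f ≫ b = a ≫ F) (c : r ⟶ R) : f ▷ r ≫ (b ⊗ₘ c) = (a ⊗ₘ c) ≫ F ▷ R := by
  rw [← MonoidalCategory.tensorHom_id, ← MonoidalCategory.tensorHom_id,
    MonoidalCategory.tensorHom_comp_tensorHom, MonoidalCategory.tensorHom_comp_tensorHom, h,
    Category.id_comp, Category.comp_id]

namespace TermActs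

variable {n N : ℕ} {g : Braid n} {p q r : Term A} {f f' : wordTensor X p ⟶ wordTensor X q}

/-- The converse of `exists_of_carries`. It also supplies the strand counts needed when expressions
are combined. -/
theorem carries (h : TermActs X g p q f) : Carries g p.varList q.varList := by
  induction h with
  | id p h => exact .one h
  | comp _ _ h h' => exact h'.mul h
  | inv e _ h => exact h.inv
  | associator p q r h =>
    rw [show (p.nu (q.nu r)).varList = ((p.nu q).nu r).varList from (List.append_assoc _ _ _).symm]
    exact .one h
  | leftUnitor p h => exact .one h
  | rightUnitor p h =>
    rw [show (p.nu Term.x0).varList = p.varList from List.append_nil _]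
    exact .one h
  | braiding a b => exact .gen [] [] a b rfl
  | whiskerLeft r hN _ h =>
    simpa [Term.varList] using h.shift r.varList [] hN.le (by have := h.1; simp; omega)
  | whiskerRight r hN _ h =>
    simpa [Term.varList] using h.shift [] r.varList (N := _) (by simp; omega)
      (by have := h.1; simp; omega)

theorem congr_braid {g' : Braid n} (h : TermActs X g p q f) (e : g = g') : TermActs X g' p q f :=
  e ▸ h

theorem congr_hom (h : TermActs X g p q f) (e : f = f') : TermActs X g p q f' :=
  e ▸ h

theorem inv' [IsIso f] (h : TermActs X g p q f) : TermActs X g⁻¹ q p (CategoryTheory.inv f) :=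
  TermActs.inv (asIso f) h

theorem whiskerLeft_one (r : Term A) (h : TermActs X (1 : Braid n) p q f)
    (hN : (r.nu p).varList.length = N) :
    TermActs X (1 : Braid N) (r.nu p) (r.nu q) (wordTensor X r ◁ f) := by
  have := h.whiskerLeft (N := N) r (by
    rw [← hN, ← h.carries.1]; exact (List.length_append).symm)
  rwa [map_one] at this

theorem whiskerRight_one (r : Term A) (h : TermActs X (1 : Braid n) p q f)
    (hN : (p.nu r).varList.length = N) :
    TermActs X (1 : Braid N) (p.nu r) (q.nu r) (f ▷ wordTensor X r) := by
  have := h.whiskerRight (N := N) r (by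
    rw [← hN, ← h.carries.1]; exact (List.length_append).symm)
  rwa [map_one] at this

theorem comp_one {f' : wordTensor X q ⟶ wordTensor X r} (h : TermActs X (1 : Braid n) p q f)
    (h' : TermActs X (1 : Braid n) q r f') : TermActs X (1 : Braid n) p r (f ≫ f') := by
  simpa using h.comp h'

variable (X) in
theorem exists_ofList_append (l l' : List A) (h : (l ++ l').length = n) :
    ∃ f, TermActs X (1 : Braid n) ((Term.ofList l).nu (.ofList l')) (.ofList (l ++ l')) f := by
  induction l generalizing n with
  | nil => exact ⟨_, leftUnitor _ (by simpa [Term.varList_ofList] using h)⟩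
  | cons a l ih =>
    obtain ⟨f, hf⟩ := ih rfl
    have h1 := hf.whiskerLeft_one (N := n) (.var a)
      (by simpa [Term.varList, Term.varList_ofList, add_comm, add_left_comm] using h)
    have h2 := associator (X := X) (n := n) (.var a) (.ofList l) (.ofList l')
      (by simpa [Term.varList, Term.varList_ofList, add_comm, add_left_comm] using h)
    exact ⟨_, h2.comp_one h1⟩

variable (X) in
-- Each word is brought to right-parenthesized form by structure morphisms that cross no strands, so
-- questions of existence reduce to lists.
theorem exists_ofList (p : Term A) (h : p.varList.length = n) :
    ∃ f, TermActs X (1 : Braid n) p (.ofList p.varList) f := by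
  induction p generalizing n with
  | x0 => exact ⟨_, id _ h⟩
  | var a =>
    have := rightUnitor (X := X) (.var a) h
    have := this.isIso
    have h := (rightUnitor (X := X) (.var a) h).inv'
    rw [inv_one] at h
    exact ⟨_, h⟩
  | nu p q hp hq =>
    obtain ⟨f, hf⟩ := hp rfl
    obtain ⟨f', hf'⟩ := hq rfl
    obtain ⟨f'', h''⟩ := exists_ofList_append X p.varList q.varList h
    exact ⟨_, ((hf.whiskerRight_one q h).comp_one (hf'.whiskerLeft_one (N := n) (.ofList p.varList)
      (by simpa [Term.varList, Term.varList_ofList] using h))).comp_one h''⟩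

variable (X) in
-- After reassociation the first two factors can be braided; the prefix `P` is then added one
-- variable at a time, each shifting the braid by one strand.
theorem exists_gen (P Q : List A) (a b : A) (h : (P ++ a :: b :: Q).length = n) :
    ∃ f, TermActs X (gen n P.length) (.ofList (P ++ a :: b :: Q))
      (.ofList (P ++ b :: a :: Q)) f := by
  induction P generalizing n with
  | nil =>
    have h1 := fun a b : A => associator (X := X) (n := n) (.var a) (.var b) (.ofList Q)
      (by simpa [Term.varList, Term.varList_ofList, add_comm, add_left_comm] using h)
    have h2 := (braiding (X := X) a b).whiskerRight (N := n) (.ofList Q)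
      (by simpa [Term.varList_ofList, add_comm, add_left_comm] using h)
    have := (h1 a b).isIso
    have h3 := ((h1 a b).inv'.comp h2).comp (h1 b a)
    rw [inv_one, mul_one, one_mul, shift_gen _ (by omega), zero_add] at h3
    exact ⟨_, h3⟩
  | cons c P ih =>
    obtain ⟨f, hf⟩ := ih rfl
    have h1 := hf.whiskerLeft (N := n) (.var c)
      (by simpa [Term.varList, add_comm, add_left_comm] using h)
    rw [shift_gen _ (by simp)] at h1
    rw [List.length_cons, add_comm]
    exact ⟨_, h1⟩

variable (X) in
theorem exists_ofList_of_carries (g : Braid n) {l l' : List A} (h : Carries g l l') :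
    ∃ f, TermActs X g (.ofList l) (.ofList l') f := by
  induction g using Braid.induction generalizing l l' with
  | one =>
    obtain rfl := h.unique (.one h.1)
    exact ⟨_, id _ (by rw [Term.varList_ofList]; exact h.1)⟩
  | of i hi =>
    obtain ⟨P, a, b, Q, hP, e⟩ := exists_split l.get (i := i) (by rw [h.1]; exact hi)
    rw [List.ofFn_get] at e
    subst hP e
    -- The braid and its source list determine the target list, so `l'` is `l` with `a` and `b`
    -- exchanged.
    obtain rfl := (Carries.gen P Q a b h.1).unique h
    exact exists_gen X P Q a b h.1
  | mul a b ha hb =>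
    obtain ⟨l₁, h₁⟩ := Carries.exists_right (g := b) h.1
    obtain ⟨l₂, h₂⟩ := Carries.exists_right (g := a) h₁.2.1
    obtain rfl := (h₂.mul h₁).unique h
    obtain ⟨f, hf⟩ := hb h₁
    obtain ⟨f', hf'⟩ := ha h₂
    exact ⟨_, hf.comp hf'⟩
  | inv a ha =>
    obtain ⟨f, hf⟩ := ha (by simpa using h.inv)
    have := hf.isIso
    exact ⟨_, hf.inv'⟩

variable (X) in
-- Normalize `p`, act by `g` on lists, and undo the normalization of `q`; the two normalizations
-- contribute trivial braids.
theorem exists_of_carries (h : Carries g p.varList q.varList) : ∃ f, TermActs X g p q f := by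
  obtain ⟨f₁, h₁⟩ := exists_ofList X p h.1
  obtain ⟨f₂, h₂⟩ := exists_ofList X q h.2.1
  obtain ⟨f, hf⟩ := exists_ofList_of_carries X g h
  have := h₂.isIso
  have := (h₁.comp hf).comp h₂.inv'
  rw [inv_one, mul_one, one_mul] at this
  exact ⟨_, this⟩

/-- The actions of braids are natural. -/
theorem naturality {X' : A → C} (u : X ⟶ X') (h : TermActs X g p q f) :
    ∃ f', TermActs X' g p q f' ∧ f ≫ (tensorTerm q).map u = (tensorTerm p).map u ≫ f' := by
  -- The witness is the same expression evaluated on `X'`. Since `f'` realizes the same braid,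
  -- `TermActs.unique` later identifies it with the chosen action.
  induction h with
  | id p h => exact ⟨_, id p h, by simp⟩
  | comp _ _ h h' =>
    obtain ⟨f₁, h₁, e₁⟩ := h
    obtain ⟨f₂, h₂, e₂⟩ := h'
    exact ⟨_, h₁.comp h₂, by rw [Category.assoc, e₂, reassoc_of% e₁]⟩
  | inv e _ h =>
    obtain ⟨f₁, h₁, e₁⟩ := h
    have := h₁.isIso
    refine ⟨_, h₁.inv', ?_⟩
    rw [Iso.inv_comp_eq, ← Category.assoc, e₁, Category.assoc, IsIso.hom_inv_id, Category.comp_id]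
  | associator p q r h =>
    exact ⟨_, associator p q r h, (MonoidalCategory.associator_naturality _ _ _).symm⟩
  | leftUnitor p h =>
    exact ⟨_, leftUnitor p h, (MonoidalCategory.leftUnitor_naturality _).symm.trans
      (congrArg (· ≫ _) (MonoidalCategory.id_tensorHom _ _).symm)⟩
  | rightUnitor p h =>
    exact ⟨_, rightUnitor p h, (MonoidalCategory.rightUnitor_naturality _).symm.trans
      (congrArg (· ≫ _) (MonoidalCategory.tensorHom_id _ _).symm)⟩
  | braiding a b =>
    exact ⟨_, braiding a b, (BraidedCategory.braiding_naturality _ _).symm⟩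
  | whiskerLeft r hN _ h =>
    obtain ⟨f₁, h₁, e₁⟩ := h
    exact ⟨_, h₁.whiskerLeft r hN, whiskerLeft_tensorHom_comm e₁ _⟩
  | whiskerRight r hN _ h =>
    obtain ⟨f₁, h₁, e₁⟩ := h
    exact ⟨_, h₁.whiskerRight r hN, whiskerRight_tensorHom_comm e₁ _⟩

variable (X) in
theorem associator_inv (p q r : Term A) (h : ((p.nu q).nu r).varList.length = n) :
    TermActs X (1 : Braid n) (p.nu (q.nu r)) ((p.nu q).nu r)
      (α_ (wordTensor X p) (wordTensor X q) (wordTensor X r)).inv := by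
  have := TermActs.inv (X := X) (p := (p.nu q).nu r) (q := p.nu (q.nu r))
    (α_ (wordTensor X p) (wordTensor X q) (wordTensor X r)) (associator p q r h)
  rwa [inv_one] at this

variable (X) in
theorem leftUnitor_inv (p : Term A) (h : p.varList.length = n) :
    TermActs X (1 : Braid n) p (Term.nu .x0 p) (λ_ (wordTensor X p)).inv := by
  have := TermActs.inv (X := X) (p := Term.nu .x0 p) (q := p) (λ_ (wordTensor X p)) (leftUnitor p h)
  rwa [inv_one] at this

variable (X) in
theorem rightUnitor_inv (p : Term A) (h : p.varList.length = n) :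
    TermActs X (1 : Braid n) p (Term.nu p .x0) (ρ_ (wordTensor X p)).inv := by
  have := TermActs.inv (X := X) (p := Term.nu p .x0) (q := p) (ρ_ (wordTensor X p))
    (rightUnitor p h)
  rwa [inv_one] at this

variable (X) in
-- By the hexagon for `p ⊗ q`, moving `a` leftwards past `p ⊗ q` is moving it past `q` and then past
-- `p`, as in `strandCross_add`. For `x₀`, the braiding with the unit is a composite of unitors.
theorem strandCross (p : Term A) (a : A) (h : p.varList.length + 1 = N) :
    TermActs X (strandCross N 0 p.varList.length) (p.nu (.var a)) (.nu (.var a) p)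
      (β_ (wordTensor X p) (X a)).hom := by
  induction p generalizing N with
  | x0 =>
    have := (leftUnitor (X := X) (n := N) (.var a) h).comp_one (rightUnitor_inv X (.var a) h)
    exact this.congr_hom (braiding_tensorUnit_left (X a)).symm
  | var b =>
    obtain rfl : N = 2 := h.symm
    exact (braiding b a).congr_braid (strandCross_one 0).symm
  | nu p q hp hq =>
    rw [Term.varList, List.length_append] at h ⊢
    have h1 := (hq rfl).whiskerLeft (N := N) p (by omega)
    have h2 := (hp rfl).whiskerRight (N := N) q (by omega)
    rw [shift_strandCross _ (by omega)] at h1 h2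
    have h3 := (associator (X := X) (n := N) p q (.var a) (by simp [Term.varList]; omega)).comp
      (h1.comp ((associator_inv X (n := N) p (.var a) q (by simp [Term.varList]; omega)).comp
      (h2.comp (associator (X := X) (n := N) (.var a) p q (by simp [Term.varList]; omega)))))
    refine (h3.congr_braid ?_).congr_hom ?_
    · rw [strandCross_add]; simp
    · exact (BraidedCategory.braiding_tensor_left_hom (wordTensor X p) (wordTensor X q) (X a)).symm

variable (X) in
/-- The braiding of words realizes the crossing of two blocks of strands. -/
theorem blockCross (p q : Term A) (h : p.varList.length + q.varList.length = N) :
    TermActs X (blockCross N 0 p.varList.length q.varList.length) (p.nu q) (.nu q p)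
      (β_ (wordTensor X p) (wordTensor X q)).hom := by
  induction q generalizing N with
  | x0 =>
    have := (rightUnitor (X := X) (n := N) p h).comp_one (leftUnitor_inv X p h)
    exact this.congr_hom (braiding_tensorUnit_right (wordTensor X p)).symm
  | var b => exact (strandCross X p b h).congr_braid (blockCross_one 0 _).symm
  | nu q r hq hr =>
    rw [Term.varList, List.length_append] at h ⊢
    have h1 := (hq rfl).whiskerRight (N := N) r (by omega)
    have h2 := (hr rfl).whiskerLeft (N := N) q (by omega)
    rw [shift_blockCross _ (by omega)] at h1 h2
    have h3 := (associator_inv X (n := N) p q r (by simp [Term.varList]; omega)).comp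
      (h1.comp ((associator (X := X) (n := N) q p r (by simp [Term.varList]; omega)).comp
      (h2.comp (associator_inv X (n := N) q r p (by simp [Term.varList]; omega)))))
    refine (h3.congr_braid ?_).congr_hom ?_
    -- The other hexagon is the splitting of the right-hand block: `p` first crosses `q`, then `r`.
    · rw [blockCross_add_right]; simp
    · exact (BraidedCategory.braiding_tensor_right_hom (wordTensor X p) (wordTensor X q)
        (wordTensor X r)).symm

end TermActs

end termAction

theorem Carries.map {α β : Type*} {n : ℕ} {g : Braid n} {l l' : List α} (h : Carries g l l')
    (f : α → β) : Carries g (l.map f) (l'.map f) :=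
  ⟨by simpa using h.1, by simpa using h.2.1, fun k => by
    rw [List.getElem?_map, List.getElem?_map, h.2.2]⟩

/-- Applied to the widths of the cables: the number of strands of a cabled braid is the same at both
ends. -/
theorem Carries.sum_eq {n : ℕ} {g : Braid n} {l l' : List ℕ} (h : Carries g l l') :
    l'.sum = l.sum := by
  have e : (List.ofFn (fn n l)).sum = (List.ofFn (fn n l')).sum := by
    rw [List.sum_ofFn, List.sum_ofFn, ← comp_perm_of_carries h, sum_comp_perm]
  rw [ofFn_fn _ h.1, ofFn_fn _ h.2.1] at e
  exact e.symm

theorem Term.varList_bind {α β : Type} (s : α → Term β) (p : Term α) :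
    (p.bind s).varList = p.varList.flatMap fun a => (s a).varList := by
  induction p with
  | x0 => rfl
  | var a => simp [bind, varList]
  | nu p q hp hq => simp [bind, varList, hp, hq]

theorem Term.length_varList_bind {α β : Type} (s : α → Term β) (p : Term α) :
    (p.bind s).varList.length = (p.varList.map fun a => (s a).varList.length).sum := by
  rw [varList_bind, List.length_flatMap]

/-! ### Substitution of words and cabling of braids. -/

section bind

variable {C : Type u} [Category.{v} C] [MonoidalCategory C] {A B : Type}

/-- The compatibility of iterated tensor products with substitution. -/
def bindIso (X : B → C) (s : A → Term B) :
    (p : Term A) → (wordTensor X (p.bind s) ≅ wordTensor (fun a => wordTensor X (s a)) p)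
  | .x0 => Iso.refl (𝟙_ C)
  | .var a => Iso.refl (wordTensor X (s a))
  | .nu p q => MonoidalCategory.tensorIso (bindIso X s p) (bindIso X s q)

/-- The `_conj` lemmas express the naturality of structure morphisms in the form required by
`bindIso`, which is a tensor product of isomorphisms on each `ν`. -/
theorem associator_conj {p q r P Q R : C} (a : p ≅ P) (b : q ≅ Q) (c : r ≅ R) :
    (α_ p q r).hom = (MonoidalCategory.tensorIso (MonoidalCategory.tensorIso a b) c).hom ≫
      (α_ P Q R).hom ≫
        (MonoidalCategory.tensorIso a (MonoidalCategory.tensorIso b c)).inv := by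
  rw [← Category.assoc, Iso.eq_comp_inv]
  exact (MonoidalCategory.associator_naturality _ _ _).symm

theorem whiskerLeft_conj {p q r P Q R : C} (a : p ≅ P) (b : q ≅ Q) (c : r ≅ R) (f : P ⟶ Q) :
    r ◁ (a.hom ≫ f ≫ b.inv) = (MonoidalCategory.tensorIso c a).hom ≫ R ◁ f ≫
        (MonoidalCategory.tensorIso c b).inv := by
  rw [← Category.assoc (MonoidalCategory.tensorIso c a).hom, Iso.eq_comp_inv]
  exact whiskerLeft_tensorHom_comm (by simp) _

theorem whiskerRight_conj {p q r P Q R : C} (a : p ≅ P) (b : q ≅ Q) (c : r ≅ R) (f : P ⟶ Q) :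
    (a.hom ≫ f ≫ b.inv) ▷ r = (MonoidalCategory.tensorIso a c).hom ≫ f ▷ R ≫
        (MonoidalCategory.tensorIso b c).inv := by
  rw [← Category.assoc (MonoidalCategory.tensorIso a c).hom, Iso.eq_comp_inv]
  exact whiskerRight_tensorHom_comm (by simp) _

theorem leftUnitor_conj {p P : C} (a : p ≅ P) :
    (λ_ p).hom = (MonoidalCategory.tensorIso (Iso.refl (𝟙_ C)) a).hom ≫ (λ_ P).hom ≫ a.inv := by
  simp

theorem rightUnitor_conj {p P : C} (a : p ≅ P) :
    (ρ_ p).hom = (MonoidalCategory.tensorIso a (Iso.refl (𝟙_ C))).hom ≫ (ρ_ P).hom ≫ a.inv := by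
  simp

theorem tensorHom_conj {p q r t P Q R T : C} (a : p ≅ P) (b : q ≅ Q) (c : r ≅ R) (d : t ≅ T)
    (f : P ⟶ Q) (g : R ⟶ T) :
    (a.hom ≫ f ≫ b.inv) ▷ r ≫ q ◁ (c.hom ≫ g ≫ d.inv) = (MonoidalCategory.tensorIso a c).hom ≫
      (f ⊗ₘ g) ≫ (MonoidalCategory.tensorIso b d).inv := by
  rw [← MonoidalCategory.tensorHom_def]
  simp

variable [BraidedCategory C] {X : B → C}

theorem braiding_conj (x y : C) : (β_ x y).hom =
    (MonoidalCategory.tensorIso (Iso.refl x) (Iso.refl y)).hom ≫ (β_ x y).hom ≫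
      (MonoidalCategory.tensorIso (Iso.refl y) (Iso.refl x)).inv := by
  simp

/-- The substitution of words realizes the cabling of braids. -/
theorem TermActs.bind (s : A → Term B) {n N : ℕ} {g : Braid n} {p q : Term A}
    {f : wordTensor (fun a => wordTensor X (s a)) p ⟶ wordTensor (fun a => wordTensor X (s a)) q}
    (h : TermActs (fun a => wordTensor X (s a)) g p q f) (hN : (p.bind s).varList.length = N) :
    TermActs X (cable N (fn n (q.varList.map fun a => (s a).varList.length)) g) (p.bind s)
      (q.bind s) ((bindIso X s p).hom ≫ f ≫ (bindIso X s q).inv) := by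
  induction h generalizing N with
  | id p h =>
    rw [cable_one, Category.id_comp, Iso.hom_inv_id]
    exact id _ hN
  | comp h h' ih ih' =>
    have h1 := ih hN
    have h2 := ih' h1.carries.2.1
    -- The second braid is cabled with the widths at the final word, the first with the widths at
    -- the intermediate one.
    rw [cable_mul_of_carries (h'.carries.map _)]
    exact (h1.comp h2).congr_hom (by simp)
  | @inv n g p q e h ih =>
    have hN' : (p.bind s).varList.length = N := by
      rw [← hN, Term.length_varList_bind, Term.length_varList_bind, (h.carries.map _).sum_eq]
    have h1 := TermActs.inv (bindIso X s p ≪≫ e ≪≫ (bindIso X s q).symm) (ih hN')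
    rw [cable_inv, comp_perm_of_carries (h.carries.inv.map _)]
    exact h1.congr_hom (by simp)
  | associator p q r h =>
    rw [cable_one]
    exact (associator (p.bind s) (q.bind s) (r.bind s) hN).congr_hom (associator_conj _ _ _)
  | leftUnitor p h =>
    rw [cable_one]
    exact (leftUnitor (p.bind s) hN).congr_hom (leftUnitor_conj _)
  | rightUnitor p h =>
    rw [cable_one]
    exact (rightUnitor (p.bind s) (by simpa [Term.bind, Term.varList] using hN)).congr_hom
      (rightUnitor_conj _)
  | braiding a b =>
    have h1 := blockCross X (s a) (s b) (N := N)
      (by simpa [Term.bind, Term.varList] using hN)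
    refine (h1.congr_braid ?_).congr_hom (braiding_conj _ _)
    -- The output widths are those of `s b` and `s a`, in this order and with nothing on either
    -- side, so the cabled generator is a single block crossing.
    refine (cable_gen_eq (n := 2) (N := N) _ [] [] _ _ (ofFn_fn _ rfl) ?_).symm
    simpa [Term.bind, Term.varList, add_comm] using hN
  | @whiskerLeft n N' r hN' g p q f h ih =>
    have h1 := ih rfl
    have hN1 : (r.bind s).varList.length + (p.bind s).varList.length = N := by
      rw [← hN]; exact (List.length_append).symm
    have h2 := h1.whiskerLeft (r.bind s) hN1
    refine (h2.congr_braid ?_).congr_hom (whiskerLeft_conj _ _ _ _)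
    -- The idle strands of `r` become cables as well: the shift by the number of variables of `r`
    -- turns into the shift by their total width.
    have := cable_shift (N := N') (M := N) (m' := (p.bind s).varList.length) g
      (r.varList.map fun a => (s a).varList.length) (q.varList.map fun a => (s a).varList.length) []
      (by simp; omega)
      (by simpa using h.carries.2.1) (by have := h.carries.2.1; simp; omega)
      (by rw [List.append_nil, List.sum_append, ← Term.length_varList_bind,
        ← Term.length_varList_bind, h1.carries.2.1, hN1])
      (by rw [← Term.length_varList_bind, h1.carries.2.1])
      (by rw [← Term.length_varList_bind, hN1])
    rw [List.append_nil, ← List.map_append] at this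
    refine (BWord.shift_congr (Term.length_varList_bind s r) _ _ _).trans (this.symm.trans ?_)
    exact congrArg (cable N _) (BWord.shift_congr (List.length_map _) _ _ _)
  | @whiskerRight n N' r hN' g p q f h ih =>
    have h1 := ih rfl
    have hN1 : (p.bind s).varList.length + (r.bind s).varList.length = N := by
      rw [← hN]; exact (List.length_append).symm
    have h2 := h1.whiskerRight (r.bind s) hN1
    refine (h2.congr_braid ?_).congr_hom (whiskerRight_conj _ _ _ _)
    have := cable_shift (N := N') (M := N) (m' := (p.bind s).varList.length) g []
      (q.varList.map fun a => (s a).varList.length) (r.varList.map fun a => (s a).varList.length)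
      (by simp; omega)
      (by simpa using h.carries.2.1) (by have := h.carries.2.1; simp; omega)
      (by rw [List.nil_append, List.sum_append, ← Term.length_varList_bind,
        ← Term.length_varList_bind, h1.carries.2.1, hN1])
      (by rw [← Term.length_varList_bind, h1.carries.2.1])
      (by simp; omega)
    rw [List.nil_append, ← List.map_append] at this
    exact this.symm

/-- Morphisms between the factors of an iterated tensor product, all of which realize trivial
braids, realize a trivial braid. -/
theorem TermActs.map_one {s s' : A → Term B}
    (u : (fun a => wordTensor X (s a)) ⟶ fun a => wordTensor X (s' a)) {N : ℕ} (q : Term A)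
    (hu : ∀ a ∈ q.varList, TermActs X (1 : Braid (s a).varList.length) (s a) (s' a) (u a))
    (hN : (q.bind s).varList.length = N) :
    TermActs X (1 : Braid N) (q.bind s) (q.bind s')
      ((bindIso X s q).hom ≫ (tensorTerm q).map u ≫ (bindIso X s' q).inv) := by
  induction q generalizing N with
  | x0 =>
    refine (TermActs.id (X := X) Term.x0 hN).congr_hom ?_
    exact ((Category.id_comp _).trans (Category.id_comp _)).symm
  | var a =>
    obtain rfl : (s a).varList.length = N := hN
    refine (hu a (by simp [Term.varList])).congr_hom ?_
    exact ((Category.id_comp _).trans (Category.comp_id _)).symm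
  | nu p q hp hq =>
    have h1 := hp (fun a ha => hu a (by simp [Term.varList, ha])) rfl
    have h2 := hq (fun a ha => hu a (by simp [Term.varList, ha])) rfl
    have h3 := h1.whiskerRight_one (q.bind s) hN
    have h4 := h2.whiskerLeft_one (p.bind s') h3.carries.2.1
    exact (h3.comp_one h4).congr_hom (tensorHom_conj _ _ _ _ _ _)

/-- A morphism between the `i`-th factors of an iterated tensor product that realizes a braid `g`
realizes a shift of `g`. -/
theorem TermActs.map {s s' : A → Term B}
    (u : (fun a => wordTensor X (s a)) ⟶ fun a => wordTensor X (s' a)) {m N : ℕ} (q : Term A)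
    (i : A) (P Q : List A) (hq : q.varList = P ++ i :: Q) (g : Braid m)
    (hi : TermActs X g (s i) (s' i) (u i))
    (hu : ∀ a ∈ P ++ Q, TermActs X (1 : Braid (s a).varList.length) (s a) (s' a) (u a))
    (hN : (q.bind s).varList.length = N)
    (ho : (P.map fun a => (s a).varList.length).sum + m ≤ N) :
    TermActs X (shift (P.map fun a => (s a).varList.length).sum ho g) (q.bind s) (q.bind s')
      ((bindIso X s q).hom ≫ (tensorTerm q).map u ≫ (bindIso X s' q).inv) := by
  induction q generalizing N P Q with
  | x0 => simp [Term.varList] at hq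
  | var a =>
    obtain ⟨rfl, rfl, rfl⟩ : P = [] ∧ a = i ∧ Q = [] := by
      cases P <;> simp_all [Term.varList]
    obtain rfl : m = N := hi.carries.1.symm.trans hN
    refine (hi.congr_braid (shift_zero _ g).symm).congr_hom ?_
    exact ((Category.id_comp _).trans (Category.comp_id _)).symm
  | nu p q hp' hq' =>
    have hN' : (p.bind s).varList.length + (q.bind s).varList.length = N := by
      rw [← hN]; exact (List.length_append).symm
    -- The marked occurrence of `i` lies in the right factor or in the left one; the other factor
    -- then realizes a trivial braid by `TermActs.map_one`.
    have hsplit : (∃ P', P = p.varList ++ P' ∧ q.varList = P' ++ i :: Q) ∨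
        ∃ Q', p.varList = P ++ i :: Q' ∧ Q = Q' ++ q.varList := by
      rcases List.append_eq_append_iff.1 hq with ⟨P', h1, h2⟩ | ⟨Q', h1, h2⟩
      · exact Or.inl ⟨P', h1, h2⟩
      · cases Q' with
        -- An empty overlap means that `i` is the first variable of the right factor.
        | nil => exact Or.inl ⟨[], by simpa using h1.symm, by simpa using h2.symm⟩
        | cons a Q' =>
          obtain ⟨rfl, rfl⟩ : i = a ∧ Q = Q' ++ q.varList := by simpa using h2
          exact Or.inr ⟨Q', h1, rfl⟩
    rcases hsplit with ⟨P', rfl, h2⟩ | ⟨Q', h1, rfl⟩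
    · have h3 := TermActs.map_one u p (fun a ha => hu a (by simp [ha])) rfl
      have e := Term.length_varList_bind s q
      rw [h2, List.map_append, List.map_cons, List.sum_append, List.sum_cons, hi.carries.1] at e
      have h4 := hq' P' Q h2 (fun a ha => hu a (by simp at ha ⊢; tauto)) rfl (by omega)
      have h5 := h4.whiskerLeft (p.bind s') (N := N) (by rw [h3.carries.2.1, hN'])
      have h6 := (h3.whiskerRight_one (q.bind s) hN).comp h5
      refine (h6.congr_braid ?_).congr_hom (tensorHom_conj _ _ _ _ _ _)
      rw [mul_one, shift_shift]
      refine BWord.shift_congr ?_ _ _ _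
      rw [List.map_append, List.sum_append, h3.carries.2.1, Term.length_varList_bind]
    · have h3 := TermActs.map_one u q (fun a ha => hu a (by simp [ha])) rfl
      have e := Term.length_varList_bind s p
      rw [h1, List.map_append, List.map_cons, List.sum_append, List.sum_cons, hi.carries.1] at e
      have h4 := hp' P Q' h1 (fun a ha => hu a (by simp at ha ⊢; tauto)) rfl (by omega)
      have h5 := h4.whiskerRight (q.bind s) (N := N) hN'
      have h6 := h5.comp (h3.whiskerLeft_one (p.bind s') h5.carries.2.1)
      refine (h6.congr_braid ?_).congr_hom (tensorHom_conj _ _ _ _ _ _)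
      rw [one_mul, shift_shift]
      exact BWord.shift_congr (zero_add _) _ _ _

end bind

/-- Cables of width one are strands: a crossing of two blocks of size one is the generator itself.
This is why renaming variables leaves braids unchanged. -/
theorem cable_ones {n : ℕ} (g : Braid n) : cable n (fun _ => 1) g = g := by
  induction g using Braid.induction with
  | one => exact cable_one _
  | of i hi =>
    have e : List.ofFn (fun _ : Fin n => 1) =
        List.replicate i 1 ++ 1 :: 1 :: List.replicate (n - i - 2) 1 := by
      rw [List.ofFn_const, ← List.replicate_succ, ← List.replicate_succ,
        List.replicate_append_replicate]
      congr 1; omega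
    have := cable_gen_eq (N := n) _ _ _ _ _ e (by simp; omega)
    simpa [blockCross_one, strandCross_one] using this
  | mul a b ha hb =>
    rw [cable_mul, ha]
    exact congrArg (a * ·) hb
  | inv a ha =>
    rw [cable_inv]
    exact congrArg _ ha

theorem eqToHom_conj_comp {C : Type*} [Category* C] {x x' y y' z z' : C} (h : x = x')
    (h₁ : y' = y) (h₂ : y = y') (h₃ : z' = z) (f : x' ⟶ y') (g : y' ⟶ z') :
    (eqToHom h ≫ f ≫ eqToHom h₁) ≫ (eqToHom h₂ ≫ g ≫ eqToHom h₃) =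
      eqToHom h ≫ (f ≫ g) ≫ eqToHom h₃ := by
  simp

theorem app_eqToHom_conj {D E : Type*} [Category* D] [Category* E] {F F' G G' : D ⥤ E}
    (h : F = F') (h' : G' = G) (a : F' ⟶ G') (X : D) :
    (eqToHom h ≫ a ≫ eqToHom h').app X =
      eqToHom (by rw [h]) ≫ a.app X ≫ eqToHom (by rw [h']) := by
  subst h h'; simp

/-! ### The functors `PaB(n) ⥤ End_C(n)` and their compatibility with the operad structures. -/

section

variable {C : Type u} [Category.{v} C] [MonoidalCategory C] {A B : Type}

/-- A strict equality of functors, as morphisms of operads demand: both sides obey the same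
recursion on `p`. -/
theorem tensorTerm_bind (s : A → Term B) (p : Term A) :
    tensorTerm (C := C) (p.bind s) =
      Functor.pi' (fun a => tensorTerm (C := C) (s a)) ⋙ tensorTerm p := by
  induction p with
  | x0 => rfl
  | var a => rfl
  | nu p q hp hq =>
    change (tensorTerm (p.bind s)).prod' (tensorTerm (q.bind s)) ⋙ MonoidalCategory.tensor C = _
    rw [hp, hq]
    rfl

theorem wordTensor_bind (X : B → C) (s : A → Term B) (p : Term A) :
    wordTensor X (p.bind s) = wordTensor (fun a => wordTensor X (s a)) p := by
  rw [wordTensor, tensorTerm_bind]; rfl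

theorem tensorHom_eqToHom {x x' y y' : C} (h : x = x') (h' : y = y') :
    (eqToHom h ⊗ₘ eqToHom h') = eqToHom (by rw [h, h']) := by
  subst h h'; simp

/-- The comparison used for cabling is the transport along the strict equality, so `TermActs.bind`
becomes a statement about the `eqToHom`s that occur in equalities of functors. -/
theorem bindIso_hom (X : B → C) (s : A → Term B) (p : Term A) :
    (bindIso X s p).hom = eqToHom (wordTensor_bind X s p) := by
  induction p with
  | x0 => rfl
  | var a => rfl
  | nu p q hp hq =>
    exact (congrArg₂ (· ⊗ₘ ·) hp hq).trans (tensorHom_eqToHom _ _)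

theorem bindIso_inv (X : B → C) (s : A → Term B) (p : Term A) :
    (bindIso X s p).inv = eqToHom (wordTensor_bind X s p).symm := by
  rw [← cancel_epi (bindIso X s p).hom, Iso.hom_inv_id, bindIso_hom, eqToHom_trans, eqToHom_refl]

variable [BraidedCategory C]

theorem Word.carries {n : ℕ} {p q : Word n} (g : p ⟶ q) :
    Carries g.braid p.term.varList q.term.varList := by
  rw [Term.varList_eq_vars, Term.varList_eq_vars]
  exact carries_iff.1 g.perm_eq

/-- The action of a parenthesized braid on the tensor product of objects of a braided monoidal
category. -/
noncomputable def braidMap {n : ℕ} {p q : Word n} (g : p ⟶ q) (X : Fin n → C) :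
    wordTensor X p.term ⟶ wordTensor X q.term :=
  (TermActs.exists_of_carries X (Word.carries g)).choose

theorem termActs_braidMap {n : ℕ} {p q : Word n} (g : p ⟶ q) (X : Fin n → C) :
    TermActs X g.braid p.term q.term (braidMap g X) :=
  (TermActs.exists_of_carries X (Word.carries g)).choose_spec

/-- Makes the choice in `braidMap` harmless: any expression that realizes the braid computes it. -/
theorem braidMap_eq {n : ℕ} {p q : Word n} {g : p ⟶ q} {X : Fin n → C}
    {f : wordTensor X p.term ⟶ wordTensor X q.term} (h : TermActs X g.braid p.term q.term f) :
    braidMap g X = f :=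
  (termActs_braidMap g X).unique h

variable (C) in
/-- The action of the parenthesized braids of arity `n` on a braided monoidal category. -/
noncomputable def braidFunctor (n : ℕ) : Word n ⥤ ((Fin n → C) ⥤ C) where
  obj p := tensorTerm p.term
  map {p q} g :=
    { app := fun X => braidMap g X
      naturality := fun X Y u => by
        -- `f` realizes the same braid on the objects `Y`, hence is the chosen action there.
        obtain ⟨f, hf, e⟩ := (termActs_braidMap g X).naturality u
        rw [braidMap_eq hf]
        exact e.symm }
  map_id p := by
    ext X
    exact braidMap_eq (TermActs.id p.term (by rw [Term.varList_eq_vars]; exact p.length_vars))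
  map_comp {p q r} f g := by
    ext X
    exact braidMap_eq (g := f ≫ g) ((termActs_braidMap f X).comp (termActs_braidMap g X))

/-- Renaming is substitution of single variables, for which all cables have width one. -/
theorem TermActs.rename {X : B → C} (s : A → B) {n : ℕ} {g : Braid n} {p q : Term A}
    {f : wordTensor (fun a => X (s a)) p ⟶ wordTensor (fun a => X (s a)) q}
    (h : TermActs (fun a => X (s a)) g p q f) :
    TermActs X g (p.rename s) (q.rename s)
      (eqToHom (wordTensor_bind X (fun a => .var (s a)) p) ≫ f ≫
        eqToHom (wordTensor_bind X (fun a => .var (s a)) q).symm) := by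
  have h1 := TermActs.bind (X := X) (N := n) (fun a => Term.var (s a)) h (by
    rw [Term.length_varList_bind]
    simpa [Term.varList] using h.carries.1)
  have e : fn n (q.varList.map fun a => (Term.var (s a)).varList.length) = fun _ => 1 := by
    funext j
    have := h.carries.2.1
    simp [fn, Term.varList, this]
  rw [e, cable_ones, bindIso_hom, bindIso_inv] at h1
  exact h1

variable (C) in
theorem braidFunctor_act {n : ℕ} (σ : Equiv.Perm (Fin n)) :
    PaB.act σ ⋙ braidFunctor C n = braidFunctor C n ⋙ (endOperad C).act σ := by
  refine CategoryTheory.Functor.ext (fun p => tensorTerm_bind _ p.term) fun p q g => ?_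
  ext X
  refine (braidMap_eq (g := (PaB.act σ).map g)
    ((termActs_braidMap g (fun a => X (σ a))).rename (X := X) σ)).trans ?_
  exact (app_eqToHom_conj _ _ (((endOperad C).act σ).map ((braidFunctor C n).map g)) X).symm

/-- The functor describing the `j`-th input of the outer operation in a partial composite. -/
def slotFunctor {m N : ℕ} (ι : Fin m → Fin N) :
    Option (Fin N) → (((Fin m → C) ⥤ C) × (Fin N → C) ⥤ C)
  | some b => CategoryTheory.Prod.snd ((Fin m → C) ⥤ C) (Fin N → C) ⋙ Pi.eval (fun _ => C) b
  | none => (𝟭 ((Fin m → C) ⥤ C)).prod (Pi.comap (fun _ => C) ι) ⋙ CategoryTheory.Prod.swap _ _ ⋙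
      evaluationUncurried (Fin m → C) C

/-- The word substituted for the `j`-th variable of the outer word in a partial composite. -/
def slotTerm {m N : ℕ} (ι : Fin m → Fin N) (q : Term (Fin m)) (o : Option (Fin N)) :
    Term (Fin N) :=
  o.elim (q.rename ι) Term.var

omit [BraidedCategory C] in
-- `slotFunctor` is the component of `insert` with the value of `slot` abstracted to a variable `o`,
-- so that a case distinction on it is possible.
theorem slotFunctor_obj {m N : ℕ} (ι : Fin m → Fin N) (q : Term (Fin m)) (o : Option (Fin N))
    (X : Fin N → C) :
    (slotFunctor (C := C) ι o).obj (tensorTerm q, X) = wordTensor X (slotTerm ι q o) := by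
  cases o with
  | some b => rfl
  | none => exact (wordTensor_bind X (fun a => .var (ι a)) q).symm

omit [BraidedCategory C] in
theorem curry_slotFunctor {m N : ℕ} (ι : Fin m → Fin N) (q : Term (Fin m)) (o : Option (Fin N)) :
    (Functor.curry.obj (slotFunctor (C := C) ι o)).obj (tensorTerm q) =
      tensorTerm (slotTerm ι q o) := by
  cases o with
  | some b => rfl
  | none =>
    refine Eq.trans ?_ (tensorTerm_bind (fun a => .var (ι a)) q).symm
    exact CategoryTheory.Functor.hext (fun X => rfl) fun X Y f => heq_of_eq (Category.comp_id _)

variable (C) in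
/-- The partial composition of functors. -/
abbrev endComp {n m N : ℕ} (h : N + 1 = n + m) (i : Fin n) :
    ((Fin n → C) ⥤ C) × ((Fin m → C) ⥤ C) ⥤ ((Fin N → C) ⥤ C) :=
  (endOperad C).comp h i

/-- The partial composition of parenthesized braids. -/
abbrev wordComp {n m N : ℕ} (h : N + 1 = n + m) (i : Fin n) : Word n × Word m ⥤ Word N :=
  PaB.comp h i

omit [BraidedCategory C] in
variable (C) in
theorem tensorTerm_comp {n m N : ℕ} (h : N + 1 = n + m) (i : Fin n) (p : Word n)
    (q : Word m) : tensorTerm (C := C) (p.comp h i q).term =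
      (endComp C h i).obj (tensorTerm p.term, tensorTerm q.term) := by
  refine (tensorTerm_bind _ _).trans ?_
  have e : Functor.pi' (fun j => tensorTerm (C := C) (slotTerm (inner h i) q.term (slot h i j))) =
      (Functor.curry.obj (insert C h i)).obj (tensorTerm q.term) := by
    refine CategoryTheory.Functor.pi_ext _ _ fun j => ?_
    exact (curry_slotFunctor (inner h i) q.term (slot h i j)).symm
  refine (congrArg (· ⋙ tensorTerm p.term) e).trans ?_
  -- On morphisms, the composite in `endOperad` has an additional identity, the component of the
  -- identity transformation of the outer functor.
  exact CategoryTheory.Functor.hext (fun X => rfl) fun X Y f =>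
    heq_of_eq (Category.comp_id _).symm

/-- The inputs that `insert` provides are only propositionally equal to tensor products of words;
this version and `TermActs.map_of_eq` allow for that. -/
theorem TermActs.bind_of_eq {X : B → C} (s : A → Term B) {Y : A → C}
    (hY : Y = fun a => wordTensor X (s a)) {n N : ℕ} {g : Braid n} {p q : Term A}
    {f : wordTensor Y p ⟶ wordTensor Y q} (h : TermActs Y g p q f)
    (hN : (p.bind s).varList.length = N) :
    TermActs X (cable N (fn n (q.varList.map fun a => (s a).varList.length)) g) (p.bind s)
      (q.bind s) (eqToHom (by rw [wordTensor_bind, hY]) ≫ f ≫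
        eqToHom (by rw [wordTensor_bind, hY])) := by
  subst hY
  have := h.bind s hN
  rwa [bindIso_hom, bindIso_inv] at this

theorem TermActs.map_of_eq {X : B → C} {s s' : A → Term B} {Y Y' : A → C}
    (hY : ∀ a, Y a = wordTensor X (s a)) (hY' : ∀ a, Y' a = wordTensor X (s' a)) (u : Y ⟶ Y')
    {m N : ℕ} (q : Term A) (i : A) (P Q : List A) (hq : q.varList = P ++ i :: Q) (g : Braid m)
    (hi : TermActs X g (s i) (s' i) (eqToHom (hY i).symm ≫ u i ≫ eqToHom (hY' i)))
    (hu : ∀ a ∈ P ++ Q, TermActs X (1 : Braid (s a).varList.length) (s a) (s' a)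
      (eqToHom (hY a).symm ≫ u a ≫ eqToHom (hY' a)))
    (hN : (q.bind s).varList.length = N)
    (ho : (P.map fun a => (s a).varList.length).sum + m ≤ N) :
    TermActs X (shift (P.map fun a => (s a).varList.length).sum ho g) (q.bind s) (q.bind s')
      (eqToHom (by rw [wordTensor_bind, funext hY]) ≫ (tensorTerm q).map u ≫
        eqToHom (by rw [wordTensor_bind, funext hY'])) := by
  obtain rfl : Y = fun a => wordTensor X (s a) := funext hY
  obtain rfl : Y' = fun a => wordTensor X (s' a) := funext hY'
  simp only [eqToHom_refl, Category.id_comp, Category.comp_id] at hi hu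
  have := TermActs.map u q i P Q hq g hi hu hN ho
  rwa [bindIso_hom, bindIso_inv] at this

/-- The input into which the inner operation is substituted is acted on by the inner braid, while
`termActs_slotFunctor_some` says that every other input undergoes the trivial braid. These are the
hypotheses of `TermActs.map_of_eq`. -/
theorem termActs_slotFunctor_none {m N : ℕ} (ι : Fin m → Fin N) {p q : Word m} (g : p ⟶ q)
    (X : Fin N → C) {o : Option (Fin N)} (ho : o = none) :
    TermActs X g.braid (slotTerm ι p.term o) (slotTerm ι q.term o)
      (eqToHom (slotFunctor_obj ι p.term o X).symm ≫
        (slotFunctor ι o).map (((braidFunctor C m).map g, 𝟙 X) :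
          (tensorTerm (C := C) p.term, X) ⟶ (tensorTerm (C := C) q.term, X)) ≫
        eqToHom (slotFunctor_obj ι q.term o X)) := by
  subst ho
  have h := (termActs_braidMap g (fun a => X (ι a))).rename (X := X) ι
  have e : (slotFunctor ι none).map (((braidFunctor C m).map g, 𝟙 X) :
      (tensorTerm (C := C) p.term, X) ⟶ (tensorTerm (C := C) q.term, X)) =
      braidMap g (fun a => X (ι a)) :=
    (congrArg (· ≫ _) ((tensorTerm p.term).map_id _)).trans (Category.id_comp _)
  rw [e]
  exact h

theorem termActs_slotFunctor_some {m N : ℕ} (ι : Fin m → Fin N) {p q : Word m} (g : p ⟶ q)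
    (X : Fin N → C) {o : Option (Fin N)} {b : Fin N} (ho : o = some b) :
    TermActs X (1 : Braid (slotTerm ι p.term o).varList.length) (slotTerm ι p.term o)
      (slotTerm ι q.term o)
      (eqToHom (slotFunctor_obj ι p.term o X).symm ≫
        (slotFunctor ι o).map (((braidFunctor C m).map g, 𝟙 X) :
          (tensorTerm (C := C) p.term, X) ⟶ (tensorTerm (C := C) q.term, X)) ≫
        eqToHom (slotFunctor_obj ι q.term o X)) := by
  subst ho
  refine (TermActs.id (X := X) (.var b) rfl).congr_hom ?_
  exact ((Category.id_comp _).trans (Category.id_comp _)).symm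

omit [BraidedCategory C] [MonoidalCategory C] [Category.{v} C] in
theorem Word.exists_split {n : ℕ} (p : Word n) (i : Fin n) :
    ∃ P Q : List (Fin n), p.term.varList = P ++ i :: Q ∧ (∀ j ∈ P ++ Q, j ≠ i) ∧
      P.length = (p.tau.symm i : ℕ) := by
  have h1 := p.tau_apply (p.tau.symm i)
  rw [Equiv.apply_symm_apply] at h1
  obtain ⟨hlt, h2⟩ := List.getElem?_eq_some_iff.1 h1
  set a := ((p.tau.symm i : Fin n) : ℕ)
  have hv : p.term.vars = p.term.vars.take a ++ i :: p.term.vars.drop (a + 1) := by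
    conv_lhs => rw [← List.take_append_drop a p.term.vars, List.drop_eq_getElem_cons hlt, h2]
  have hnd := p.nodup
  rw [hv, List.nodup_append, List.nodup_cons] at hnd
  refine ⟨_, _, (Term.varList_eq_vars _).trans hv, fun j hj => ?_, by simp; omega⟩
  rintro rfl
  rcases List.mem_append.1 hj with hj | hj
  · exact hnd.2.2 j hj j (by simp) rfl
  · exact hnd.2.1.1 hj

theorem length_slotTerm {n m N : ℕ} (h : N + 1 = n + m) (i j : Fin n) (q : Word m) :
    (slotTerm (inner h i) q.term (slot h i j)).varList.length = if j = i then m else 1 := by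
  split_ifs with hj
  · rw [hj, slot_self]
    change (q.term.rename (inner h i)).varList.length = m
    rw [Term.varList_eq_vars, Term.vars_rename, List.length_map, q.length_vars]
  · cases e : slot h i j with
    | none => exact absurd ((slot_eq_none h i).1 e) hj
    | some b => rfl

/-- Matches the widths coming from `TermActs.bind` with those in the definition of `braidComp`: the
one occurrence of `xᵢ` has width `m`, all other variables have width one. -/
theorem Word.map_length_slotTerm {n m N : ℕ} (h : N + 1 = n + m) (i : Fin n) (p : Word n)
    (q : Word m) : fn n (p.term.varList.map fun j =>
      (slotTerm (inner h i) q.term (slot h i j)).varList.length) = single (p.tau.symm i) m := by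
  obtain ⟨P, Q, e, hPQ, hP⟩ := p.exists_split i
  have key : ∀ L : List (Fin n), (∀ j ∈ L, j ≠ i) → ∀ x ∈ L.map fun j =>
      (slotTerm (inner h i) q.term (slot h i j)).varList.length, x = 1 := by
    intro L hL x hx
    obtain ⟨j, hj, rfl⟩ := List.mem_map.1 hx
    rw [length_slotTerm, if_neg (hL j hj)]
  refine BWord.single_eq _ _ _ _ _ ?_ (by rw [e, List.map_append, List.map_cons,
    length_slotTerm h i i, if_pos rfl]) (key P fun j hj => hPQ j (by simp [hj]))
    (key Q fun j hj => hPQ j (by simp [hj])) (by simpa using hP)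
  rw [List.length_map, Term.varList_eq_vars, p.length_vars]

/-- A composite in `endOperad` first applies the inner morphism inside the `i`-th input, which
realizes a shift of `g'`, and then the outer one to the new inputs, which realizes a cabling of `g`.
-/
theorem termActs_comp {n m N : ℕ} (h : N + 1 = n + m) (i : Fin n) {p q : Word n} {p' q' : Word m}
    (g : p ⟶ q) (g' : p' ⟶ q') (X : Fin N → C) :
    TermActs X (braidComp h (q.tau.symm i) g.braid g'.braid) (p.comp h i p').term
      (q.comp h i q').term
      (eqToHom (CategoryTheory.Functor.congr_obj (tensorTerm_comp C h i p p') X) ≫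
        ((tensorTerm p.term).map ((insert C h i).map (((braidFunctor C m).map g', 𝟙 X) :
          (tensorTerm (C := C) p'.term, X) ⟶ (tensorTerm (C := C) q'.term, X))) ≫
        braidMap (C := C) g ((insert C h i).obj (tensorTerm q'.term, X))) ≫
      eqToHom (CategoryTheory.Functor.congr_obj (tensorTerm_comp C h i q q') X).symm) := by
  have hs : ∀ (r : Word m) (j : Fin n), ((insert C h i).obj (tensorTerm r.term, X)) j =
      wordTensor X (slotTerm (inner h i) r.term (slot h i j)) :=
    fun r j => slotFunctor_obj _ _ _ _
  have hN : ∀ (p : Word n) (r : Word m),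
      (p.term.bind fun j => slotTerm (inner h i) r.term (slot h i j)).varList.length = N :=
    fun p r => (congrArg List.length (Term.varList_eq_vars (p.comp h i r).term)).trans
      (p.comp h i r).length_vars
  obtain ⟨P, Q, e, hPQ, hP⟩ := p.exists_split i
  have hsum : (P.map fun j =>
      (slotTerm (inner h i) p'.term (slot h i j)).varList.length).sum = p.tau.symm i := by
    -- All variables to the left of `xᵢ` have width one, so the inner braid starts at the position
    -- of `xᵢ` among the variables of `p`.
    rw [List.map_congr_left (g := fun _ => 1) fun j hj => by
      rw [length_slotTerm, if_neg (hPQ j (by simp [hj]))]]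
    simpa using hP
  have h1 := TermActs.map_of_eq (hs p') (hs q') ((insert C h i).map
    (((braidFunctor C m).map g', 𝟙 X) :
      (tensorTerm (C := C) p'.term, X) ⟶ (tensorTerm (C := C) q'.term, X)))
    p.term i P Q e g'.braid (termActs_slotFunctor_none (inner h i) g' X (slot_self h i))
    (fun j hj => by
      obtain ⟨b, hb⟩ := Option.ne_none_iff_exists'.1 (mt (slot_eq_none h i).1 (hPQ j hj))
      exact termActs_slotFunctor_some (inner h i) g' X hb)
    (hN p p') (by rw [hsum]; exact braidComp_arity h _)
  have h2 := TermActs.bind_of_eq (X := X) _ (funext (hs q')) (termActs_braidMap g _) (hN p q')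
  rw [Word.map_length_slotTerm] at h2
  refine ((h1.comp h2).congr_braid ?_).congr_hom ?_
  -- Here `g'` acts before `g`, at the position of `xᵢ` in the source `p`, while `braidComp` places
  -- it after `g`, at the position in the target `q`. Sliding it along the cable reconciles the two.
  · rw [braidComp, ← cable_shift_comm h]
    refine congrArg (_ * ·) (BWord.shift_congr ?_ _ _ _)
    rw [Word.symm_tau_eq g.perm_eq, hsum]
  · exact eqToHom_conj_comp _ _ _ _ _ _

variable (C) in
theorem braidFunctor_comp {n m N : ℕ} (h : N + 1 = n + m) (i : Fin n) :
    wordComp h i ⋙ braidFunctor C N =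
      (braidFunctor C n).prod (braidFunctor C m) ⋙ endComp C h i := by
  refine CategoryTheory.Functor.ext (fun p => tensorTerm_comp C h i p.1 p.2) ?_
  rintro ⟨p, p'⟩ ⟨q, q'⟩ ⟨g, g'⟩
  ext X
  have h1 := termActs_comp h i g g' X
  have h2 := app_eqToHom_conj (tensorTerm_comp C h i p p') (tensorTerm_comp C h i q q').symm
    ((endComp C h i).map (((braidFunctor C n).map g, (braidFunctor C m).map g') :
      (tensorTerm p.term, tensorTerm p'.term) ⟶ (tensorTerm q.term, tensorTerm q'.term))) X
  exact (braidMap_eq (g := (wordComp h i).map ((g, g') : (p, p') ⟶ (q, q'))) h1).trans h2.symm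

end

end WeakBraid

theorem mainTheorem4 (C : Type u) [Category.{v} C] [MonoidalCategory C] [BraidedCategory C] :
    ∃ φ : WeakBraid.PaB.Hom (WeakBraid.endOperad C),
      WeakBraid.IsBraidedAlgebra φ ∧
        ∃ ψ : WeakBraid.WeakBraidedStructure C, ψ = WeakBraid.forgetBraid.trans φ := by
  -- The unit is preserved by definition: the word `x₁` acts as the projection to the only input.
  refine ⟨⟨WeakBraid.braidFunctor C, rfl, WeakBraid.braidFunctor_act C,
    WeakBraid.braidFunctor_comp C⟩, ?_, _, rfl⟩
  -- Each of the four generators is a constructor of `TermActs`, so uniqueness identifies its action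
  -- with the structure morphism. The objects agree definitionally, so the heterogeneous equalities
  -- are ordinary ones.
  exact
    { obj := fun n p => rfl
      associator := fun X => heq_of_eq (WeakBraid.braidMap_eq (.associator _ _ _ rfl))
      leftUnitor := fun X => heq_of_eq (WeakBraid.braidMap_eq (.leftUnitor _ rfl))
      rightUnitor := fun X => heq_of_eq (WeakBraid.braidMap_eq (.rightUnitor _ rfl))
      braiding := fun X => heq_of_eq (WeakBraid.braidMap_eq (.braiding _ _)) }
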